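/- **Setting.** Let $x=(x_1,x_2)$, $x_2=(x_2',x_2'')$, with values in $\mathbb R^{n}\times\mathbb R^{m}\times\mathbb R^{l}$; let $\mathcal X_2=\mathcal X_2'\times\mathcal X_2''$, $D_1\subseteq\mathcal X_1\subseteq\mathbb R^n$, $D_2\subseteq\mathcal X_2$, and write $x'=(x_1,x_2')$. For parameters $\beta,\gamma,\theta=1/\tau$ and $\varepsilon>0$ consider the hybrid system $$\mathcal H_1:\quad \dot x\in\begin{pmatrix}I&0\\0&\tfrac1\varepsilon I\end{pmatrix}F(x),\ x\in C:=\mathcal X_1\times\mathcal X_2;\qquad x^+\in G(x),\ x\in D:=D_1\times D_2,$$ where $F=F_{\beta,\gamma,\theta}$, $G=G_{\beta,\gamma,\theta}$ are set-valued and $G(x)=G_1(x')\times G_2'(x)\subseteq C$ for $x\in D$. Solutions are hybrid arcs on hybrid time domains (locally absolutely continuous in $t$). $\|\cdot\|_S$ is the Euclidean distance to $S$. A class $\mathcal K$ function is continuous and strictly increasing on $[0,\infty)$ with value $0$ at $0$; it is of class $\mathcal K_\infty$ if it is also unbounded. Let $\mathcal A\subseteq\mathcal X_1$ be nonempty and compact,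 and let $\bar\beta,\bar\gamma,\bar\theta>0$. "For all parameters" means $\beta\in(0,\bar\beta]$, $\gamma\in(0,\bar\gamma]$, $\theta\in(0,\bar\theta]$. A set $S$ is *SGPAS as $(\varepsilon_1,\dots,\varepsilon_k)\to0$* for a parametrized hybrid system if for all $\Delta>\delta>0$ there is $\varepsilon_1^*>0$ such that for each $\varepsilon_1\in(0,\varepsilon_1^*)$ there is $\varepsilon_2^*>0$ such that for each $\varepsilon_2\in(0,\varepsilon_2^*)$ … for each $\varepsilon_k\in(0,\varepsilon_k^*)$: (i) for each $R\ge\delta$ there is $r>0$ with $\|\phi(s,i)\|_S\le r\Rightarrow\|\phi(t,j)\|_S\le R$ whenever $s+i\le t+j$, for every solution $\phi$; (ii) for all $\Delta\ge R\ge r\ge\delta$ there is $T\ge0$ with $\|\phi(s,i)\|_S\le R\Rightarrow\|\phi(t,j)\|_S\le r$ whenever $t+j\ge T+s+i$, for every solution $\phi$. **Assumptions.** 1. *(Regularity.)* $C$ and $D$ are closed. For all parameters, $F$ is outer semicontinuous and locally bounded relative to $C$ with nonempty convex values on $C$, and every maximal solution of $\mathcal H_1$ is complete, for every $\varepsilon>0$.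 For all $(\beta,\gamma,\theta)\in[0,\bar\beta]\times[0,\bar\gamma]\times[0,\bar\theta]$, $G$ is outer semicontinuous and locally bounded relative to $D$ with nonempty values on $D$. The dependence on the parameters is regular up to the limit values, uniformly in $x_2''$: the projection $D'$ of $D$ to the $x'$-space is closed; $(\beta,\gamma,\theta,x')\mapsto G_1(x')$ is jointly outer semicontinuous and locally bounded relative to $[0,\bar\beta]\times[0,\bar\gamma]\times[0,\bar\theta]\times D'$; and for each $\gamma\in(0,\bar\gamma],\theta\in(0,\bar\theta]$ the map $(\beta,x')\mapsto\{f_1:(f_1,f_2)\in F(x',x_2''),\ x_2''\in\mathcal X_2''\}$ is jointly outer semicontinuous and locally bounded relative to $[0,\bar\beta]\times\mathcal X_1\times\mathcal X_2'$. 2. *(Steady states.)* For all parameters and all $x_1\in\mathcal X_1$, $\{x_2\in\mathcal X_2: (f_1,0)\in F(x_1,x_2)\text{ for some }f_1\}=H(x_1):=H_1(x_1)\times\mathcal X_2''$, a nonempty subset of $\mathcal X_2$ that does not depend on the parameters; $H_1$ is outer semicontinuous and locally bounded on $\mathcal X_1$. 3. *(Boundary layer.)* For every $\rho>0$ put $\mathcal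 X_1^\rho=\{x_1\in\mathcal X_1:\|x_1\|_{\mathcal A}\le\rho\}$ and $M_\rho=\{x: x_1\in\mathcal X_1^\rho,\ x_2\in H(x_1)\}$. For each $\gamma,\theta$ in the range, $M_\rho$ is SGPAS as $\beta\to0$ for $\dot x\in\begin{pmatrix}0&0\\0&I\end{pmatrix}F(x)$, $x\in\mathcal X_1^\rho\times\mathcal X_2$ (no jumps). There are $\underline\alpha_2\in\mathcal K_\infty$ and $\overline\alpha_2,\hat\alpha_\beta\in\mathcal K$ such that for every $\Delta>0$ there are a $C^1$ function $V_2$ and $\alpha_2,\alpha_\beta\in\mathcal K$ with the following properties. For $x\in\mathcal X_1^\rho\times\mathcal X_2$: $\underline\alpha_2(\|x\|_{M_\rho})\le V_2(x)\le\overline\alpha_2(\|x\|_{M_\rho})$. For all parameters, $x\in\mathcal X_1^\rho\times\mathcal X_2$ with $\|x\|_{M_\rho}\le\Delta$, and $(f_1,f_2)\in F(x)$: $\langle\nabla V_2(x),(0,f_2)\rangle\le-\alpha_2(\|x\|_{M_\rho})$ if $\|x\|_{M_\rho}\ge\alpha_\beta(\beta)$, and $\langle\nabla V_2(x),(0,f_2)\rangle\le\hat\alpha_\beta(\beta)$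 if $\|x\|_{M_\rho}\le\alpha_\beta(\beta)$. Moreover $\nabla V_2=0$ on $M_\rho$, and for each compact $K\subseteq\mathcal X_1^\rho\times\mathcal X_2'$ the function $|V_2|+\|\nabla_{x_1}V_2\|$ is bounded on $K\times\mathcal X_2''$. 4. *(Regular jumps.)* There is a function $\underline\sigma>0$ on $(0,\infty)$ such that for every $\Delta>0$ there is $N^*$ such that for all parameters and all $\varepsilon>0$ there is $T^*$ for which every solution $\phi$ of $\mathcal H_1$ with $\|\phi(0,0)\|_{\mathcal A\times\mathcal X_2}\le\Delta$ has at most $N^*$ jumps preceded by an interval of flow shorter than $\underline\sigma(\tau)$, all of them at times $t\le T^*$. 5. *(Reduced system.)* Let $F_r(x_1)=\overline{\mathrm{co}}\{f_1:(f_1,f_2)\in F(x_1,x_2),x_2\in H(x_1)\}$ and $G_r(x_1)=\{g_1:(g_1,g_2)\in G(x_1,x_2),\ x_2\in H(x_1),\ (x_1,x_2)\in D\}$. For each $\beta\in(0,\bar\beta],\theta\in(0,\bar\theta]$ the set $\mathcal A$ is SGPAS as $\gamma\to0$ for $\dot x_1\in F_r(x_1)$, $x_1\in\mathcal X_1$;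 $x_1^+\in G_r(x_1)$, $x_1\in D_1$. There are $\underline\alpha_1\in\mathcal K_\infty$, $\overline\alpha_1,\hat\alpha_\gamma\in\mathcal K$ and a function $\hat\sigma>0$ on $(0,\infty)$ such that for every $\Delta>0$ there are a $C^1$ function $V_1$ and $\alpha_1,\alpha_\gamma\in\mathcal K$ with $\underline\alpha_1(\|x_1\|_{\mathcal A})\le V_1(x_1)\le\overline\alpha_1(\|x_1\|_{\mathcal A})$ on $\mathcal X_1$ and, for $\beta\in[0,\bar\beta]$, $\gamma\in(0,\bar\gamma]$, $\theta\in(0,\bar\theta]$ and $x_1\in\mathcal X_1$ with $\alpha_\gamma(\gamma)\le\|x_1\|_{\mathcal A}\le\Delta$: $\langle\nabla V_1(x_1),f\rangle\le-\hat\sigma(\tau)\hat\alpha_\gamma(\gamma)\alpha_1(\|x_1\|_{\mathcal A})$ for $f\in F_r(x_1)$, and, if $x_1\in D_1$, $V_1(g)-V_1(x_1)\le-\hat\alpha_\gamma(\gamma)\alpha_1(\|x_1\|_{\mathcal A})$ for $g\in G_r(x_1)$. 6. *(Invariance under jumps.)* $M_{\mathcal A}=\{(x_1,x_2):x_1\in\mathcal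 A,\ x_2\in H(x_1)\}$ satisfies $G(M_{\mathcal A}\cap D)\subseteq M_{\mathcal A}$ for all $(\beta,\gamma,\theta)\in[0,\bar\beta]\times[0,\bar\gamma]\times[0,\bar\theta]$. **Theorem.** Under assumptions 1–6 (no compactness of $\mathcal X_2'$ is assumed), $M_{\mathcal A}$ is SGPAS as $(\gamma,\tfrac1\tau,\varepsilon,\beta)\to0$ for $\mathcal H_1$. -/

import Mathlib

open Set Filter Topology MeasureTheory

namespace SingPert

noncomputable section

/-! ### Comparison functions -/

/-- Class `𝒦` on `[0, ∞)`: continuous, strictly increasing, zero at zero. -/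
structure IsClassK (α : ℝ → ℝ) : Prop where
  continuousOn : ContinuousOn α (Ici 0)
  strictMonoOn : StrictMonoOn α (Ici 0)
  map_zero : α 0 = 0

/-- Class `𝒦∞`: class `𝒦` and unbounded, so that the inverse is defined on all of `[0, ∞)`. -/
structure IsClassKInfty (α : ℝ → ℝ) : Prop extends IsClassK α where
  tendsto_atTop : Tendsto α atTop atTop

/-! ### Set-valued mappings -/

/-- `Φ` is outer semicontinuous relative to `S`. -/
def OuterSemicontOn {X Y : Type*} [TopologicalSpace X] [TopologicalSpace Y]
    (Φ : X → Set Y) (S : Set X) : Prop :=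
  ∀ x ∈ S, ∀ y : Y, ∀ (u : ℕ → X) (v : ℕ → Y), (∀ n, u n ∈ S ∧ v n ∈ Φ (u n)) →
    Tendsto u atTop (𝓝 x) → Tendsto v atTop (𝓝 y) → y ∈ Φ x

/-- `Φ` is locally bounded relative to `S`. -/
def LocallyBoundedOn {X Y : Type*} [TopologicalSpace X] [PseudoMetricSpace Y]
    (Φ : X → Set Y) (S : Set X) : Prop :=
  ∀ x ∈ S, ∃ U ∈ 𝓝 x, Bornology.IsBounded (⋃ x' ∈ U ∩ S, Φ x')

/-! ### Hybrid systems and their solutions -/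

/-- The data of a hybrid system: `ẋ ∈ flowMap x` on `flowSet`, `x⁺ ∈ jumpMap x` on `jumpSet`. -/
structure HybridSystem (E : Type*) where
  flowSet : Set E
  flowMap : E → Set E
  jumpSet : Set E
  jumpMap : E → Set E

/-- Compact hybrid time domain: `⋃_{j ≤ J} [t_j, t_{j+1}] × {j}` with `0 = t_0 ≤ t_1 ≤ ⋯`. -/
def IsCompactHybridTimeDomain (S : Set (ℝ × ℕ)) : Prop :=
  ∃ (J : ℕ) (t : ℕ → ℝ), t 0 = 0 ∧ Monotone t ∧
    S = {p | p.2 ≤ J ∧ t p.2 ≤ p.1 ∧ p.1 ≤ t (p.2 + 1)}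

/-- Hybrid time domain: every truncation at one of its points is a compact hybrid time domain. -/
def IsHybridTimeDomain (S : Set (ℝ × ℕ)) : Prop :=
  ∀ q ∈ S, IsCompactHybridTimeDomain (S ∩ {p | p.1 ≤ q.1 ∧ p.2 ≤ q.2})

section Hybrid

variable {E : Type*} [NormedAddCommGroup E] [NormedSpace ℝ E]

/-- `φ`, with domain `S`, is a solution of the hybrid system `ℋ`.
Values of `φ` outside `S` carry no meaning. -/
structure IsSolution (ℋ : HybridSystem E) (S : Set (ℝ × ℕ)) (φ : ℝ → ℕ → E) : Prop where
  isHybridTimeDomain : IsHybridTimeDomain S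
  zero_mem : ((0 : ℝ), 0) ∈ S
  init : φ 0 0 ∈ closure ℋ.flowSet ∪ ℋ.jumpSet
  absCont : ∀ (j : ℕ) (a b : ℝ), a ≤ b → (a, j) ∈ S → (b, j) ∈ S →
    AbsolutelyContinuousOnInterval (fun t => φ t j) a b
  flow_mem : ∀ (j : ℕ) (a b : ℝ), (a, j) ∈ S → (b, j) ∈ S →
    ∀ t ∈ Ioo a b, φ t j ∈ ℋ.flowSet
  flow : ∀ (j : ℕ) (a b : ℝ), (a, j) ∈ S → (b, j) ∈ S →
    ∀ᵐ t : ℝ, t ∈ Ioo a b → ∃ v ∈ ℋ.flowMap (φ t j), HasDerivAt (fun s => φ s j) v t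
  jump : ∀ (j : ℕ) (t : ℝ), (t, j) ∈ S → (t, j + 1) ∈ S →
    φ t j ∈ ℋ.jumpSet ∧ φ t (j + 1) ∈ ℋ.jumpMap (φ t j)

/-- A solution is maximal if it cannot be extended to a solution with a larger domain. -/
def IsMaximalSolution (ℋ : HybridSystem E) (S : Set (ℝ × ℕ)) (φ : ℝ → ℕ → E) : Prop :=
  IsSolution ℋ S φ ∧ ¬ ∃ (S' : Set (ℝ × ℕ)) (φ' : ℝ → ℕ → E),
    IsSolution ℋ S' φ' ∧ S ⊂ S' ∧ ∀ p ∈ S, φ' p.1 p.2 = φ p.1 p.2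

/-- Completeness of the solutions: every maximal solution has an unbounded domain. -/
def SolutionsComplete (ℋ : HybridSystem E) : Prop :=
  ∀ S φ, IsMaximalSolution ℋ S φ → ∀ M : ℝ, ∃ p ∈ S, M ≤ p.1 + (p.2 : ℝ)

/-- Semi-global stability of `A`, down to the radius `δ`. -/
def SemiGlobalStable (δ : ℝ) (ℋ : HybridSystem E) (A : Set E) : Prop :=
  ∀ R, δ ≤ R → ∃ r > 0, ∀ S φ, IsSolution ℋ S φ →
    ∀ p ∈ S, ∀ q ∈ S, p.1 + (p.2 : ℝ) ≤ q.1 + (q.2 : ℝ) →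
      Metric.infDist (φ p.1 p.2) A ≤ r → Metric.infDist (φ q.1 q.2) A ≤ R

/-- Practical attractivity of `A`, from the radius `Δ` down to the radius `δ`. -/
def PracticallyAttractive (δ Δ : ℝ) (ℋ : HybridSystem E) (A : Set E) : Prop :=
  ∀ R r, R ≤ Δ → r ≤ R → δ ≤ r → ∃ T : ℝ, 0 ≤ T ∧ ∀ S φ, IsSolution ℋ S φ →
    ∀ p ∈ S, ∀ q ∈ S, T + (p.1 + (p.2 : ℝ)) ≤ q.1 + (q.2 : ℝ) →
      Metric.infDist (φ p.1 p.2) A ≤ R → Metric.infDist (φ q.1 q.2) A ≤ r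

end Hybrid

/-- `∃ ε₁* > 0, ∀ ε₁ ∈ (0, ε₁*), ∃ ε₂* > 0, ∀ ε₂ ∈ (0, ε₂*), …, P (ε₁, …, ε_k)`. -/
def SuccessivelySmall : (k : ℕ) → ((Fin k → ℝ) → Prop) → Prop
  | 0, P => P Fin.elim0
  | k + 1, P => ∃ e > 0, ∀ x, 0 < x → x < e →
      SuccessivelySmall k (fun p => P (Fin.cons x p))

/-- `A` is semi-globally practically asymptotically stable as `(ε₁, …, ε_k) → 0` for the
parametrized hybrid system `ℋ`. -/
def SGPAS {E : Type*} [NormedAddCommGroup E] [NormedSpace ℝ E] (k : ℕ)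
    (ℋ : (Fin k → ℝ) → HybridSystem E) (A : Set E) : Prop :=
  ∀ δ Δ, 0 < δ → δ < Δ → SuccessivelySmall k
    (fun p => SemiGlobalStable δ (ℋ p) A ∧ PracticallyAttractive δ Δ (ℋ p) A)

/-! ### The singularly perturbed system -/

/-- The space `ℝⁿ` of slow states. -/
abbrev Slow (n : ℕ) : Type := EuclideanSpace ℝ (Fin n)

/-- The space of fast states `x₂ = (x₂', x₂'')`, with the Euclidean norm. -/
abbrev Fast (m l : ℕ) : Type := WithLp 2 (EuclideanSpace ℝ (Fin m) × EuclideanSpace ℝ (Fin l))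

/-- The space of states `x = (x₁, x₂)`, with the Euclidean norm. -/
abbrev State (n m l : ℕ) : Type := WithLp 2 (Slow n × Fast m l)

/-- The pair `(x₁, x₂')` of the slow state and the bounded part of the fast state. -/
def boundedPart {n m l : ℕ} (x : State n m l) : Slow n × EuclideanSpace ℝ (Fin m) :=
  (x.fst, x.snd.fst)

/-- Data of the parametrized system. The maps depend on `β`, `γ` and `θ = 1 / τ`, in this order.
The jump map is given in the decomposed form `G x = G₁ (x₁, x₂') × G₂' x`. -/
structure SPSystem (n m l : ℕ) where
  X₁ : Set (Slow n)
  X₂' : Set (EuclideanSpace ℝ (Fin m))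
  X₂'' : Set (EuclideanSpace ℝ (Fin l))
  D₁ : Set (Slow n)
  D₂ : Set (Fast m l)
  F : ℝ → ℝ → ℝ → State n m l → Set (State n m l)
  G₁ : ℝ → ℝ → ℝ → Slow n × EuclideanSpace ℝ (Fin m) →
    Set (Slow n × EuclideanSpace ℝ (Fin m))
  G₂' : ℝ → ℝ → ℝ → State n m l → Set (EuclideanSpace ℝ (Fin l))

namespace SPSystem

variable {n m l : ℕ} (Sys : SPSystem n m l)

/-- `X₂ = X₂' × X₂''`. -/
def X₂ : Set (Fast m l) := {x₂ | x₂.fst ∈ Sys.X₂' ∧ x₂.snd ∈ Sys.X₂''}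

/-- The flow set `X₁ × X₂`. -/
def C : Set (State n m l) := {x | x.fst ∈ Sys.X₁ ∧ x.snd ∈ Sys.X₂}

/-- The jump set `D₁ × D₂`. -/
def D : Set (State n m l) := {x | x.fst ∈ Sys.D₁ ∧ x.snd ∈ Sys.D₂}

/-- The projection of the jump set to the components `(x₁, x₂')`. -/
def D' : Set (Slow n × EuclideanSpace ℝ (Fin m)) := boundedPart '' Sys.D

/-- The jump map `G x = G₁ (x₁, x₂') × G₂' x`. -/
def G (β γ θ : ℝ) (x : State n m l) : Set (State n m l) :=
  {g | boundedPart g ∈ Sys.G₁ β γ θ (boundedPart x) ∧ g.snd.snd ∈ Sys.G₂' β γ θ x}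

/-- The system `ℋ₁`: flow map `diag(I, ε⁻¹ I) F`, jump map `G`. -/
def full (β γ θ ε : ℝ) : HybridSystem (State n m l) where
  flowSet := Sys.C
  flowMap x := {v | ∃ f ∈ Sys.F β γ θ x, v = WithLp.toLp 2 (f.fst, ε⁻¹ • f.snd)}
  jumpSet := Sys.D
  jumpMap := Sys.G β γ θ

/-- The equilibria of the fast dynamics: `{x₂ ∈ X₂ | 0 ∈ F₂ (x₁, x₂)}`. -/
def equilibria (β γ θ : ℝ) (x₁ : Slow n) : Set (Fast m l) :=
  {x₂ | x₂ ∈ Sys.X₂ ∧ ∃ f ∈ Sys.F β γ θ (WithLp.toLp 2 (x₁, x₂)), f.snd = 0}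

/-- `H x₁ = H₁ x₁ × X₂''`. -/
def H (H₁ : Slow n → Set (EuclideanSpace ℝ (Fin m))) (x₁ : Slow n) : Set (Fast m l) :=
  {x₂ | x₂.fst ∈ H₁ x₁ ∧ x₂.snd ∈ Sys.X₂''}

variable (A : Set (Slow n)) (H₁ : Slow n → Set (EuclideanSpace ℝ (Fin m)))

/-- The set `(A + ρ𝔹) ∩ X₁`, for a compact set `A`. -/
def tube (ρ : ℝ) : Set (Slow n) := {x₁ | x₁ ∈ Sys.X₁ ∧ Metric.infDist x₁ A ≤ ρ}

/-- The boundary layer manifold `M_ρ`. -/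
def manifold (ρ : ℝ) : Set (State n m l) :=
  {x | x.fst ∈ Sys.tube A ρ ∧ x.snd ∈ Sys.H H₁ x.fst}

/-- The restricted attractor `M_A = {(x₁, x₂) | x₁ ∈ A, x₂ ∈ H x₁}`. -/
def attractor : Set (State n m l) := {x | x.fst ∈ A ∧ x.snd ∈ Sys.H H₁ x.fst}

/-- The boundary layer system: `x₁` is frozen in `(A + ρ𝔹) ∩ X₁`, and there are no jumps. -/
def boundaryLayer (ρ β γ θ : ℝ) : HybridSystem (State n m l) where
  flowSet := {x | x.fst ∈ Sys.tube A ρ ∧ x.snd ∈ Sys.X₂}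
  flowMap x := {v | ∃ f ∈ Sys.F β γ θ x, v = WithLp.toLp 2 (0, f.snd)}
  jumpSet := ∅
  jumpMap _ := ∅

/-- The reduced flow map: closed convex hull of `{f₁ | (f₁, f₂) ∈ F (x₁, x₂), x₂ ∈ H x₁}`. -/
def Fr (β γ θ : ℝ) (x₁ : Slow n) : Set (Slow n) :=
  closedConvexHull ℝ {f₁ | ∃ x₂ ∈ Sys.H H₁ x₁,
    ∃ f ∈ Sys.F β γ θ (WithLp.toLp 2 (x₁, x₂)), f₁ = f.fst}

/-- The reduced jump map `{g₁ | (g₁, g₂) ∈ G (x₁, x₂), x₂ ∈ H x₁}`; the map `G` is evaluated on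
its domain `D₁ × D₂` only. -/
def Gr (β γ θ : ℝ) (x₁ : Slow n) : Set (Slow n) :=
  {g₁ | ∃ x₂ ∈ Sys.H H₁ x₁, WithLp.toLp 2 (x₁, x₂) ∈ Sys.D ∧
    ∃ g ∈ Sys.G β γ θ (WithLp.toLp 2 (x₁, x₂)), g₁ = g.fst}

/-- The reduced system. -/
def reduced (β γ θ : ℝ) : HybridSystem (Slow n) where
  flowSet := Sys.X₁
  flowMap := Sys.Fr H₁ β γ θ
  jumpSet := Sys.D₁
  jumpMap := Sys.Gr H₁ β γ θ

/-- The slow velocities at `(x₁, x₂')`, for all values of `x₂''`, as a mapping of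
`(β, (x₁, x₂'))`. -/
def slowVelocities (γ θ : ℝ) (p : ℝ × (Slow n × EuclideanSpace ℝ (Fin m))) : Set (Slow n) :=
  {f₁ | ∃ x : State n m l, x ∈ Sys.C ∧ boundedPart x = p.2 ∧ ∃ f ∈ Sys.F p.1 γ θ x, f₁ = f.fst}

/-! ### The standing assumptions -/

/-- Basic regularity of the hybrid system for all parameters in the given box, for the jump map
also at the limit values `0` of the parameters; completeness of the solutions. The last three
fields are the regularity in the parameters: it is joint with the state, includes the limit values,
and concerns the components `(x₁, x₂')` only, with no restriction on how `x₂''` moves. -/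
structure BasicAssumptions (β₀ γ₀ θ₀ : ℝ) : Prop where
  isClosed_flowSet : IsClosed Sys.C
  isClosed_jumpSet : IsClosed Sys.D
  D₁_subset : Sys.D₁ ⊆ Sys.X₁
  D₂_subset : Sys.D₂ ⊆ Sys.X₂
  flowMap : ∀ β ∈ Ioc 0 β₀, ∀ γ ∈ Ioc 0 γ₀, ∀ θ ∈ Ioc 0 θ₀,
    OuterSemicontOn (Sys.F β γ θ) Sys.C ∧ LocallyBoundedOn (Sys.F β γ θ) Sys.C ∧
      ∀ x ∈ Sys.C, (Sys.F β γ θ x).Nonempty ∧ Convex ℝ (Sys.F β γ θ x)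
  jumpMap : ∀ β ∈ Icc 0 β₀, ∀ γ ∈ Icc 0 γ₀, ∀ θ ∈ Icc 0 θ₀,
    OuterSemicontOn (Sys.G β γ θ) Sys.D ∧ LocallyBoundedOn (Sys.G β γ θ) Sys.D ∧
      ∀ x ∈ Sys.D, (Sys.G β γ θ x).Nonempty ∧ Sys.G β γ θ x ⊆ Sys.C
  complete : ∀ β ∈ Ioc 0 β₀, ∀ γ ∈ Ioc 0 γ₀, ∀ θ ∈ Ioc 0 θ₀, ∀ ε > 0,
    SolutionsComplete (Sys.full β γ θ ε)
  slowVelocities_regular : ∀ γ ∈ Ioc 0 γ₀, ∀ θ ∈ Ioc 0 θ₀,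
    OuterSemicontOn (Sys.slowVelocities γ θ) (Icc 0 β₀ ×ˢ (Sys.X₁ ×ˢ Sys.X₂')) ∧
    LocallyBoundedOn (Sys.slowVelocities γ θ) (Icc 0 β₀ ×ˢ (Sys.X₁ ×ˢ Sys.X₂'))
  isClosed_D' : IsClosed Sys.D'
  G₁_regular :
    OuterSemicontOn (fun p : (ℝ × ℝ × ℝ) × (Slow n × EuclideanSpace ℝ (Fin m)) =>
      Sys.G₁ p.1.1 p.1.2.1 p.1.2.2 p.2) ((Icc 0 β₀ ×ˢ (Icc 0 γ₀ ×ˢ Icc 0 θ₀)) ×ˢ Sys.D') ∧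
    LocallyBoundedOn (fun p : (ℝ × ℝ × ℝ) × (Slow n × EuclideanSpace ℝ (Fin m)) =>
      Sys.G₁ p.1.1 p.1.2.1 p.1.2.2 p.2) ((Icc 0 β₀ ×ˢ (Icc 0 γ₀ ×ˢ Icc 0 θ₀)) ×ˢ Sys.D')

/-- The steady-state mapping: the fast equilibria at `x₁ ∈ X₁` form the set
`H x₁ = H₁ x₁ × X₂''`, a non-empty subset of `X₂`, and `H₁` is outer semicontinuous and locally
bounded on `X₁`. -/
structure SteadyStateAssumptions (β₀ γ₀ θ₀ : ℝ) : Prop where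
  equilibria_eq : ∀ β ∈ Ioc 0 β₀, ∀ γ ∈ Ioc 0 γ₀, ∀ θ ∈ Ioc 0 θ₀, ∀ x₁ ∈ Sys.X₁,
    Sys.equilibria β γ θ x₁ = Sys.H H₁ x₁
  nonempty : ∀ x₁ ∈ Sys.X₁, (Sys.H H₁ x₁).Nonempty
  subset : ∀ x₁ ∈ Sys.X₁, Sys.H H₁ x₁ ⊆ Sys.X₂
  outerSemicont : OuterSemicontOn H₁ Sys.X₁
  locallyBounded : LocallyBoundedOn H₁ Sys.X₁

/-- For every `ρ > 0` the manifold `M_ρ` is SGPAS as `β → 0` for the boundary layer system, and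
for every `Δ > 0` there is a Lyapunov function on the points of the flow set at distance at most `Δ`
from `M_ρ`. -/
def BoundaryLayerAssumption (β₀ γ₀ θ₀ : ℝ) : Prop :=
  ∀ ρ > 0,
    (∀ γ ∈ Ioc 0 γ₀, ∀ θ ∈ Ioc 0 θ₀,
      SGPAS 1 (fun p => Sys.boundaryLayer A ρ (p 0) γ θ) (Sys.manifold A H₁ ρ)) ∧
    ∃ (αlo αup αβhat : ℝ → ℝ), IsClassKInfty αlo ∧ IsClassK αup ∧ IsClassK αβhat ∧
      ∀ Δ > 0, ∃ (V : State n m l → ℝ) (α αβ : ℝ → ℝ),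
        ContDiff ℝ 1 V ∧ IsClassK α ∧ IsClassK αβ ∧
        (∀ x : State n m l, x.fst ∈ Sys.tube A ρ → x.snd ∈ Sys.X₂ →
          αlo (Metric.infDist x (Sys.manifold A H₁ ρ)) ≤ V x ∧
          V x ≤ αup (Metric.infDist x (Sys.manifold A H₁ ρ))) ∧
        (∀ β ∈ Ioc 0 β₀, ∀ γ ∈ Ioc 0 γ₀, ∀ θ ∈ Ioc 0 θ₀,
          ∀ x : State n m l, x.fst ∈ Sys.tube A ρ → x.snd ∈ Sys.X₂ →
          Metric.infDist x (Sys.manifold A H₁ ρ) ≤ Δ → ∀ f ∈ Sys.F β γ θ x,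
          (αβ β ≤ Metric.infDist x (Sys.manifold A H₁ ρ) →
            inner ℝ (gradient V x) (WithLp.toLp 2 (0, f.snd))
              ≤ -α (Metric.infDist x (Sys.manifold A H₁ ρ))) ∧
          (Metric.infDist x (Sys.manifold A H₁ ρ) ≤ αβ β →
            inner ℝ (gradient V x) (WithLp.toLp 2 (0, f.snd)) ≤ αβhat β)) ∧
        (∀ x ∈ Sys.manifold A H₁ ρ, gradient V x = 0) ∧
        (∀ K : Set (Slow n × EuclideanSpace ℝ (Fin m)), IsCompact K →
          K ⊆ Sys.tube A ρ ×ˢ Sys.X₂' → ∃ M > 0, ∀ x : State n m l, boundedPart x ∈ K →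
            x.snd.snd ∈ Sys.X₂'' → |V x| + ‖(gradient V x).fst‖ ≤ M)

/-- The set `A` is SGPAS as `γ → 0` for the reduced system, and for every `Δ > 0` there is a
Lyapunov function on the points at distance at most `Δ` from `A`. The inequalities include the
limit value `β = 0`. -/
def ReducedAssumption (β₀ γ₀ θ₀ : ℝ) : Prop :=
  (∀ β ∈ Ioc 0 β₀, ∀ θ ∈ Ioc 0 θ₀, SGPAS 1 (fun p => Sys.reduced H₁ β (p 0) θ) A) ∧
  ∃ (αlo αup αγhat σhat : ℝ → ℝ), IsClassKInfty αlo ∧ IsClassK αup ∧ IsClassK αγhat ∧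
    (∀ τ > 0, 0 < σhat τ) ∧
    ∀ Δ > 0, ∃ (V : Slow n → ℝ) (α αγ : ℝ → ℝ),
      ContDiff ℝ 1 V ∧ IsClassK α ∧ IsClassK αγ ∧
      (∀ x₁ ∈ Sys.X₁, αlo (Metric.infDist x₁ A) ≤ V x₁ ∧ V x₁ ≤ αup (Metric.infDist x₁ A)) ∧
      ∀ β ∈ Icc 0 β₀, ∀ γ ∈ Ioc 0 γ₀, ∀ θ ∈ Ioc 0 θ₀,
        ∀ x₁ ∈ Sys.X₁, αγ γ ≤ Metric.infDist x₁ A → Metric.infDist x₁ A ≤ Δ →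
          (∀ f₁ ∈ Sys.Fr H₁ β γ θ x₁,
            inner ℝ (gradient V x₁) f₁ ≤ -(σhat θ⁻¹ * αγhat γ * α (Metric.infDist x₁ A))) ∧
          (x₁ ∈ Sys.D₁ → ∀ g₁ ∈ Sys.Gr H₁ β γ θ x₁,
            V g₁ - V x₁ ≤ -(αγhat γ * α (Metric.infDist x₁ A)))

/-- The `s`-irregular jumps of a hybrid arc with domain `S`: the levels `j` at which a jump from
level `j` to level `j + 1` occurs after an interval of flow shorter than `s`. -/
def irregularJumps (S : Set (ℝ × ℕ)) (s : ℝ) : Set ℕ :=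
  {j | (∃ t, (t, j) ∈ S ∧ (t, j + 1) ∈ S) ∧
    sSup {d | ∃ t t', (t, j) ∈ S ∧ (t', j) ∈ S ∧ d = |t - t'|} < s}

/-- Almost all jumps are `σ(τ)`-regular: for initial conditions within `Δ` of `A × X₂` there are at
most `N` irregular jumps, all of them up to a time `T`, which may depend on the parameters. -/
def JumpRegularityAssumption (β₀ γ₀ θ₀ : ℝ) : Prop :=
  ∃ σ : ℝ → ℝ, (∀ τ > 0, 0 < σ τ) ∧ ∀ Δ > 0, ∃ N : ℕ,
    ∀ β ∈ Ioc 0 β₀, ∀ γ ∈ Ioc 0 γ₀, ∀ θ ∈ Ioc 0 θ₀, ∀ ε > 0, ∃ T : ℝ,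
      ∀ S φ, IsSolution (Sys.full β γ θ ε) S φ →
        Metric.infDist (φ 0 0) {x : State n m l | x.fst ∈ A ∧ x.snd ∈ Sys.X₂} ≤ Δ →
        (irregularJumps S (σ θ⁻¹)).encard ≤ N ∧
        ∀ j ∈ irregularJumps S (σ θ⁻¹), ∀ t, (t, j) ∈ S → t ≤ T

/-- The jumps keep the restricted attractor invariant: `G(M_A) ⊆ M_A`. -/
def JumpInvarianceAssumption (β₀ γ₀ θ₀ : ℝ) : Prop :=
  ∀ β ∈ Icc 0 β₀, ∀ γ ∈ Icc 0 γ₀, ∀ θ ∈ Icc 0 θ₀,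
    ∀ x ∈ Sys.attractor A H₁ ∩ Sys.D, Sys.G β γ θ x ⊆ Sys.attractor A H₁

end SPSystem

end

end SingPert

open SingPert

/-! ### Absolutely continuous functions and differential inequalities -/

theorem AbsolutelyContinuousOnInterval.sub_le_mul {v : ℝ → ℝ} {a b c : ℝ} (hab : a ≤ b)
    (hv : AbsolutelyContinuousOnInterval v a b)
    (h : ∀ᵐ t : ℝ, t ∈ Ioo a b → ∃ d, HasDerivAt v d t ∧ d ≤ c) : v b - v a ≤ c * (b - a) := by
  rw [← hv.integral_deriv_eq_sub]
  have h1 : ∫ t in a..b, deriv v t ≤ ∫ _ in a..b, c := by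
    refine intervalIntegral.integral_mono_ae_restrict hab hv.intervalIntegrable_deriv
      intervalIntegrable_const ?_
    rw [Filter.EventuallyLE, ae_restrict_iff' measurableSet_Icc]
    have ha : ∀ᵐ t : ℝ, t ≠ a := by simp [ae_iff, measure_singleton]
    have hb : ∀ᵐ t : ℝ, t ≠ b := by simp [ae_iff, measure_singleton]
    filter_upwards [h, ha, hb] with t ht hta htb hmem
    obtain ⟨d, hd, hdc⟩ := ht ⟨lt_of_le_of_ne hmem.1 (Ne.symm hta), lt_of_le_of_ne hmem.2 htb⟩
    rw [hd.deriv]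
    exact hdc
  simpa [mul_comm] using h1

theorem AbsolutelyContinuousOnInterval.mono_Icc {X : Type*} [PseudoMetricSpace X] {v : ℝ → X}
    {a b c d : ℝ} (hv : AbsolutelyContinuousOnInterval v a b) (hac : a ≤ c) (hcd : c ≤ d)
    (hdb : d ≤ b) : AbsolutelyContinuousOnInterval v c d := by
  refine hv.mono ?_
  rw [uIcc_of_le hcd, uIcc_of_le (hac.trans (hcd.trans hdb))]
  exact Icc_subset_Icc hac hdb

theorem LipschitzOnWith.comp_absolutelyContinuousOnInterval {X Y : Type*} [PseudoMetricSpace X]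
    [PseudoMetricSpace Y] {f : X → Y} {K : NNReal} {s : Set X} {x : ℝ → X} {a b : ℝ}
    (hf : LipschitzOnWith K f s) (hx : AbsolutelyContinuousOnInterval x a b)
    (hs : ∀ t ∈ uIcc a b, x t ∈ s) : AbsolutelyContinuousOnInterval (fun t => f (x t)) a b := by
  have h0 : Tendsto (fun E : ℕ × (ℕ → ℝ × ℝ) =>
      (K : ℝ) * ∑ i ∈ Finset.range E.1, dist (x (E.2 i).1) (x (E.2 i).2))
      (AbsolutelyContinuousOnInterval.totalLengthFilter ⊓
        𝓟 (AbsolutelyContinuousOnInterval.disjWithin a b)) (𝓝 0) := by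
    simpa using Tendsto.const_mul (K : ℝ) hx
  refine squeeze_zero' (Eventually.of_forall fun E => Finset.sum_nonneg fun i _ => dist_nonneg)
    ?_ h0
  have : ∀ᶠ E in (AbsolutelyContinuousOnInterval.totalLengthFilter ⊓
      𝓟 (AbsolutelyContinuousOnInterval.disjWithin a b) : Filter (ℕ × (ℕ → ℝ × ℝ))),
      E ∈ AbsolutelyContinuousOnInterval.disjWithin a b :=
    eventually_inf_principal.2 (Eventually.of_forall fun _ h => h)
  filter_upwards [this] with E hE
  rw [Finset.mul_sum]
  exact Finset.sum_le_sum fun i hi =>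
    hf.dist_le_mul _ (hs _ (hE.1 i hi).1) _ (hs _ (hE.1 i hi).2)

/-- A `C¹` function is locally Lipschitz, hence Lipschitz on the compact image of the curve. -/
theorem AbsolutelyContinuousOnInterval.comp_contDiff {E : Type*} [NormedAddCommGroup E]
    [NormedSpace ℝ E] {V : E → ℝ} (hV : ContDiff ℝ 1 V) {x : ℝ → E} {a b : ℝ}
    (hx : AbsolutelyContinuousOnInterval x a b) :
    AbsolutelyContinuousOnInterval (fun t => V (x t)) a b := by
  have hc : IsCompact (x '' uIcc a b) := isCompact_uIcc.image_of_continuousOn hx.continuousOn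
  obtain ⟨K, hK⟩ := LocallyLipschitzOn.exists_lipschitzOnWith_of_compact hc
    (hV.locallyLipschitz.locallyLipschitzOn)
  exact LipschitzOnWith.comp_absolutelyContinuousOnInterval hK hx fun t ht => mem_image_of_mem _ ht

/-- A function that decreases at rate `c` while it is above the level `ℓ`. -/
theorem AbsolutelyContinuousOnInterval.le_max_of_decreasing_above {v : ℝ → ℝ} {a b c ℓ : ℝ}
    (hab : a ≤ b) (hc : 0 ≤ c) (hv : AbsolutelyContinuousOnInterval v a b)
    (h : ∀ᵐ t : ℝ, t ∈ Ioo a b → ℓ < v t → ∃ d, HasDerivAt v d t ∧ d ≤ -c) :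
    v b ≤ max (v a - c * (b - a)) ℓ := by
  by_contra! hcon
  obtain ⟨h1, h2⟩ := max_lt_iff.1 hcon
  have hcont : ContinuousOn v (Icc a b) := by simpa [uIcc_of_le hab] using hv.continuousOn
  by_cases hne : ∃ t ∈ Icc a b, v t ≤ ℓ
  · have hcl : IsCompact (Icc a b ∩ v ⁻¹' Iic ℓ) :=
      isCompact_Icc.of_isClosed_subset
        (hcont.preimage_isClosed_of_isClosed isClosed_Icc isClosed_Iic) inter_subset_left
    -- `s` is the last time at which `v ≤ ℓ`; after it the decrease applies without interruption.
    obtain ⟨s, ⟨hs, hsℓ⟩, hmax⟩ := hcl.exists_isGreatest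
      (by obtain ⟨t, ht, htℓ⟩ := hne; exact ⟨t, ht, htℓ⟩)
    have hsub := AbsolutelyContinuousOnInterval.sub_le_mul (c := -c) hs.2
      (AbsolutelyContinuousOnInterval.mono_Icc hv hs.1 hs.2 le_rfl) (by
        filter_upwards [h] with t ht hmem
        refine ht ⟨lt_of_le_of_lt hs.1 hmem.1, hmem.2⟩ ?_
        by_contra! hle
        exact absurd (hmax ⟨⟨hs.1.trans hmem.1.le, hmem.2.le⟩, hle⟩) (not_le.2 hmem.1))
    have : 0 ≤ c * (b - s) := mul_nonneg hc (sub_nonneg.2 hs.2)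
    have hsℓ' : v s ≤ ℓ := hsℓ
    linarith
  · push Not at hne
    have hsub := AbsolutelyContinuousOnInterval.sub_le_mul (c := -c) hab hv (by
        filter_upwards [h] with t ht hmem
        exact ht hmem (hne t ⟨hmem.1.le, hmem.2.le⟩))
    linarith

/-- Bootstrap principle: at the first time with `f ≥ 0`, continuity from the left gives `f ≤ 0` up
to and including that time, and the hypothesis then contradicts it. It serves to remove an a priori
restriction to a region. -/
theorem ContinuousOn.neg_of_neg_of_nonpos_before {f : ℝ → ℝ} {a b : ℝ}
    (hf : ContinuousOn f (Icc a b)) (ha : f a < 0)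
    (h : ∀ t ∈ Icc a b, (∀ s ∈ Icc a t, f s ≤ 0) → f t < 0) : ∀ t ∈ Icc a b, f t < 0 := by
  by_contra! hcon
  obtain ⟨t, ht, hft⟩ := hcon
  have hcl : IsCompact (Icc a b ∩ f ⁻¹' Ici 0) :=
    isCompact_Icc.of_isClosed_subset
      (hf.preimage_isClosed_of_isClosed isClosed_Icc isClosed_Ici) inter_subset_left
  obtain ⟨s, ⟨hs, hfs⟩, hmin⟩ := hcl.exists_isLeast ⟨t, ht, hft⟩
  have hlt : ∀ r ∈ Icc a b, r < s → f r < 0 := fun r hr hrs => by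
    by_contra! h0
    exact absurd (hmin ⟨hr, h0⟩) (not_le.2 hrs)
  have has : a < s := by
    rcases eq_or_lt_of_le hs.1 with h0 | h0
    · subst h0; exact absurd ha (not_lt.2 hfs)
    · exact h0
  have hs0 : f s ≤ 0 := by
    have hc := (hf s hs).mono_left (nhdsWithin_mono s (s := Ico a s)
      fun r hr => ⟨hr.1, hr.2.le.trans hs.2⟩)
    have : (𝓝[Ico a s] s).NeBot := by
      rw [nhdsWithin_Ico_eq_nhdsLT has]; infer_instance
    refine le_of_tendsto hc ?_
    filter_upwards [self_mem_nhdsWithin] with r hr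
    exact (hlt r ⟨hr.1, hr.2.le.trans hs.2⟩ hr.2).le
  have := h s hs fun r hr => by
    rcases eq_or_lt_of_le hr.2 with h0 | h0
    · rw [h0]; exact hs0
    · exact (hlt r ⟨hr.1, hr.2.trans hs.2⟩ h0).le
  exact absurd this (not_lt.2 hfs)

/-- Two differential inequalities on different time scales, valid in the region
`v₁ ≤ b₁ + ν`, `v₂ ≤ W`: the fast variable falls below `ℓ₂` within time `κ`, and the slow
variable decreases at rate `c` as soon as it has done so. -/
theorem two_scale_bound {v₁ v₂ : ℝ → ℝ} {a b b₁ ν b₂ W ℓ₁ ℓ₂ L c c₂ κ w : ℝ}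
    (h₁ : AbsolutelyContinuousOnInterval v₁ a b) (h₂ : AbsolutelyContinuousOnInterval v₂ a b)
    (hL : 0 ≤ L) (hc : 0 ≤ c) (hc₂ : 0 ≤ c₂) (hκ : 0 ≤ κ) (hLκ : L * κ < ν) (hw : w ≤ b₁)
    (hℓ₁ : ℓ₁ ≤ b₁) (hℓ₂ : ℓ₂ ≤ b₂) (hW : b₂ < W) (hκ₂ : b₂ - c₂ * κ ≤ ℓ₂)
    (hv₁ : v₁ a ≤ w) (hv₂ : v₂ a ≤ b₂)
    (h : ∀ᵐ t : ℝ, t ∈ Ioo a b → v₁ t ≤ b₁ + ν → v₂ t ≤ W →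
      ∃ d₁ d₂, HasDerivAt v₁ d₁ t ∧ HasDerivAt v₂ d₂ t ∧ d₁ ≤ L ∧ (ℓ₂ < v₂ t → d₂ ≤ -c₂) ∧
        (v₂ t ≤ ℓ₂ → ℓ₁ < v₁ t → d₁ ≤ -c)) :
    ∀ t ∈ Icc a b, v₂ t ≤ b₂ ∧ (a + κ ≤ t → v₂ t ≤ ℓ₂) ∧
      v₁ t ≤ max (w - c * (t - a - κ)) ℓ₁ + L * κ := by
  by_cases hab : a ≤ b
  swap
  · intro t ht; exact absurd (ht.1.trans ht.2) hab
  -- The estimates under the assumption that the region has not been left before `t`; `hfin` removes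
  -- it.
  have key : ∀ t ∈ Icc a b, (∀ s ∈ Icc a t, v₁ s ≤ b₁ + ν ∧ v₂ s ≤ W) →
      v₂ t ≤ b₂ ∧ (a + κ ≤ t → v₂ t ≤ ℓ₂) ∧ v₁ t ≤ max (w - c * (t - a - κ)) ℓ₁ + L * κ := by
    intro t ht hreg
    have hfast : ∀ s ∈ Icc a t, v₂ s ≤ max (b₂ - c₂ * (s - a)) ℓ₂ := by
      intro s hs
      refine (AbsolutelyContinuousOnInterval.le_max_of_decreasing_above (ℓ := ℓ₂) hs.1 hc₂
        (AbsolutelyContinuousOnInterval.mono_Icc h₂ le_rfl hs.1 (hs.2.trans ht.2)) ?_).trans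
        (max_le_max (by linarith) le_rfl)
      filter_upwards [h] with r hr hmem hlt
      obtain ⟨h3, h4⟩ := hreg r ⟨hmem.1.le, hmem.2.le.trans hs.2⟩
      obtain ⟨d₁, d₂, -, hd₂, -, h5, -⟩ := hr ⟨hmem.1, hmem.2.trans_le (hs.2.trans ht.2)⟩ h3 h4
      exact ⟨d₂, hd₂, h5 hlt⟩
    have hlate : ∀ s ∈ Icc a t, a + κ ≤ s → v₂ s ≤ ℓ₂ := by
      intro s hs hκs
      refine (hfast s hs).trans (max_le ?_ le_rfl)
      have : c₂ * κ ≤ c₂ * (s - a) := mul_le_mul_of_nonneg_left (by linarith) hc₂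
      linarith
    have hgrow : ∀ s ∈ Icc a t, v₁ s ≤ w + L * (s - a) := by
      intro s hs
      have := AbsolutelyContinuousOnInterval.sub_le_mul (c := L) hs.1
        (AbsolutelyContinuousOnInterval.mono_Icc h₁ le_rfl hs.1 (hs.2.trans ht.2)) (by
          filter_upwards [h] with r hr hmem
          obtain ⟨h3, h4⟩ := hreg r ⟨hmem.1.le, hmem.2.le.trans hs.2⟩
          obtain ⟨d₁, d₂, hd₁, -, h5, -⟩ := hr ⟨hmem.1, hmem.2.trans_le (hs.2.trans ht.2)⟩ h3 h4
          exact ⟨d₁, hd₁, h5⟩)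
      linarith
    refine ⟨?_, hlate t ⟨ht.1, le_rfl⟩, ?_⟩
    · refine (hfast t ⟨ht.1, le_rfl⟩).trans (max_le ?_ hℓ₂)
      have : 0 ≤ c₂ * (t - a) := mul_nonneg hc₂ (by linarith [ht.1])
      linarith
    · rcases le_total t (a + κ) with htκ | htκ
      · have h3 := hgrow t ⟨ht.1, le_rfl⟩
        have h4 : L * (t - a) ≤ L * κ := mul_le_mul_of_nonneg_left (by linarith) hL
        have h5 : 0 ≤ c * (a + κ - t) := mul_nonneg hc (by linarith)
        have h6 := le_max_left (w - c * (t - a - κ)) ℓ₁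
        nlinarith
      · have hm : a + κ ∈ Icc a t := ⟨by linarith, htκ⟩
        have h3 := hgrow _ hm
        have h4 := AbsolutelyContinuousOnInterval.le_max_of_decreasing_above (ℓ := ℓ₁) htκ hc
          (AbsolutelyContinuousOnInterval.mono_Icc h₁ hm.1 htκ ht.2) (by
            filter_upwards [h] with r hr hmem hlt
            obtain ⟨h3, h4⟩ := hreg r ⟨hm.1.trans hmem.1.le, hmem.2.le⟩
            obtain ⟨d₁, d₂, hd₁, -, -, -, h5⟩ :=
              hr ⟨hm.1.trans_lt hmem.1, hmem.2.trans_le ht.2⟩ h3 h4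
            exact ⟨d₁, hd₁, h5 (hlate r ⟨hm.1.trans hmem.1.le, hmem.2.le⟩ hmem.1.le) hlt⟩)
        have h5 : 0 ≤ L * κ := mul_nonneg hL hκ
        refine h4.trans ?_
        rw [← max_add_add_right]
        refine max_le_max ?_ (by linarith)
        have : c * (t - (a + κ)) = c * (t - a - κ) := by ring
        linarith
  have hfin : ∀ t ∈ Icc a b, max (v₁ t - (b₁ + ν)) (v₂ t - W) < 0 := by
    refine ContinuousOn.neg_of_neg_of_nonpos_before ?_ ?_ ?_
    · have e1 : ContinuousOn v₁ (Icc a b) := by simpa [uIcc_of_le hab] using h₁.continuousOn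
      have e2 : ContinuousOn v₂ (Icc a b) := by simpa [uIcc_of_le hab] using h₂.continuousOn
      exact (e1.sub continuousOn_const).sup (e2.sub continuousOn_const)
    · have : 0 ≤ L * κ := mul_nonneg hL hκ
      exact max_lt (by linarith) (by linarith)
    · intro t ht hreg
      obtain ⟨h3, -, h4⟩ := key t ht fun s hs => by
        have := max_le_iff.1 (hreg s hs)
        exact ⟨by linarith [this.1], by linarith [this.2]⟩
      refine max_lt ?_ (by linarith)
      -- Before `a + κ` the entry `w - c * (t - a - κ)` exceeds `w`, and the bound from `key` may be
      -- too weak; the growth rate `L` with `L * κ < ν` is used directly.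
      rcases le_total t (a + κ) with htκ | htκ
      · have hgrow := AbsolutelyContinuousOnInterval.sub_le_mul (c := L) ht.1
          (AbsolutelyContinuousOnInterval.mono_Icc h₁ le_rfl ht.1 ht.2) (by
            filter_upwards [h] with r hr hmem
            have := max_le_iff.1 (hreg r ⟨hmem.1.le, hmem.2.le⟩)
            obtain ⟨d₁, d₂, hd₁, -, h5, -⟩ :=
              hr ⟨hmem.1, hmem.2.trans_le ht.2⟩ (by linarith [this.1]) (by linarith [this.2])
            exact ⟨d₁, hd₁, h5⟩)
        have h4 : L * (t - a) ≤ L * κ := mul_le_mul_of_nonneg_left (by linarith) hL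
        linarith
      · have h5 : 0 ≤ c * (t - a - κ) := mul_nonneg hc (by linarith)
        have : max (w - c * (t - a - κ)) ℓ₁ ≤ b₁ := max_le (by linarith) hℓ₁
        linarith
  intro t ht
  refine key t ht fun s hs => ?_
  have := max_lt_iff.1 (hfin s ⟨hs.1, hs.2.trans ht.2⟩)
  exact ⟨by linarith [this.1], by linarith [this.2]⟩


namespace SingPert

/-! ### Set-valued mappings on compact sets -/

theorem LocallyBoundedOn.isBounded_iUnion {X Y : Type*} [TopologicalSpace X] [PseudoMetricSpace Y]
    {Φ : X → Set Y} {S K : Set X} (h : LocallyBoundedOn Φ S) (hK : IsCompact K) (hKS : K ⊆ S) :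
    Bornology.IsBounded (⋃ x ∈ K, Φ x) := by
  refine hK.induction_on (p := fun s => Bornology.IsBounded (⋃ x ∈ s ∩ K, Φ x)) ?_ ?_ ?_ ?_
    |>.subset (by simp)
  · simp
  · intro s t hst ht
    exact ht.subset (biUnion_subset_biUnion_left (inter_subset_inter_left _ hst))
  · intro s t hs ht
    rw [union_inter_distrib_right, biUnion_union]
    exact hs.union ht
  · intro x hx
    obtain ⟨U, hU, hb⟩ := h x (hKS hx)
    refine ⟨U, mem_nhdsWithin_of_mem_nhds hU, hb.subset ?_⟩
    exact biUnion_subset_biUnion_left (inter_subset_inter_right _ hKS)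

/-- Local boundedness supplies convergent subsequences of the values, and outer semicontinuity keeps
the limits in the graph. -/
theorem isCompact_graph {X Y : Type*} [PseudoMetricSpace X] [PseudoMetricSpace Y] [ProperSpace Y]
    {Φ : X → Set Y} {S K : Set X} (ho : OuterSemicontOn Φ S) (hb : LocallyBoundedOn Φ S)
    (hK : IsCompact K) (hKS : K ⊆ S) : IsCompact {p : X × Y | p.1 ∈ K ∧ p.2 ∈ Φ p.1} := by
  refine IsSeqCompact.isCompact fun u hu => ?_
  obtain ⟨x, hx, f, hf, hxt⟩ := hK.isSeqCompact fun n => (hu n).1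
  have hB := hb.isBounded_iUnion hK hKS
  obtain ⟨y, -, g, hg, hyt⟩ := tendsto_subseq_of_bounded hB (x := fun n => (u (f n)).2)
    fun n => mem_biUnion (hu (f n)).1 (hu (f n)).2
  have hxt' : Tendsto (fun n => (u (f (g n))).1) atTop (𝓝 x) := hxt.comp hg.tendsto_atTop
  refine ⟨(x, y), ⟨hx, ?_⟩, f ∘ g, hf.comp hg, ?_⟩
  · exact ho x (hKS hx) y _ _ (fun n => ⟨hKS (hu (f (g n))).1, (hu (f (g n))).2⟩) hxt' hyt
  · exact hxt'.prodMk_nhds hyt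

/-- A strict inequality that holds on the values of a set-valued mapping at the points of a
compact set where `f ≤ 0` holds also where `f` is small. -/
theorem exists_pos_forall_of_outerSemicontOn {X Y : Type*} [PseudoMetricSpace X]
    [PseudoMetricSpace Y] [ProperSpace Y] {Φ : X → Set Y} {S K : Set X}
    (ho : OuterSemicontOn Φ S) (hb : LocallyBoundedOn Φ S) (hK : IsCompact K) (hKS : K ⊆ S)
    {f : X → ℝ} (hf : Continuous f) {h : X × Y → ℝ} (hh : Continuous h)
    (hlt : ∀ x ∈ K, f x ≤ 0 → ∀ y ∈ Φ x, h (x, y) < 0) :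
    ∃ η > 0, ∀ x ∈ K, f x ≤ η → ∀ y ∈ Φ x, h (x, y) < 0 := by
  -- The points of the graph that violate `h < 0` form a compact set on which `f` is positive. Half
  -- the minimum of `f` there is a valid `η`.
  have hZ : IsCompact ({p : X × Y | p.1 ∈ K ∧ p.2 ∈ Φ p.1} ∩ h ⁻¹' Ici 0) :=
    (isCompact_graph ho hb hK hKS).inter_right (isClosed_Ici.preimage hh)
  rcases eq_empty_or_nonempty ({p : X × Y | p.1 ∈ K ∧ p.2 ∈ Φ p.1} ∩ h ⁻¹' Ici 0) with h0 | h0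
  · refine ⟨1, one_pos, fun x hx _ y hy => ?_⟩
    by_contra! hle
    exact (h0 ▸ (⟨⟨hx, hy⟩, hle⟩ :
      (x, y) ∈ ({p : X × Y | p.1 ∈ K ∧ p.2 ∈ Φ p.1} ∩ h ⁻¹' Ici 0)) : (x, y) ∈ (∅ : Set _))
  · obtain ⟨p, hp, hmin⟩ := hZ.exists_isMinOn h0 (hf.comp continuous_fst).continuousOn
    have hpos : 0 < f p.1 := by
      by_contra! hle
      exact absurd (hlt _ hp.1.1 hle _ hp.1.2) (not_lt.2 hp.2)
    refine ⟨f p.1 / 2, half_pos hpos, fun x hx hfx y hy => ?_⟩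
    by_contra! hle
    have := isMinOn_iff.1 hmin (x, y) ⟨⟨hx, hy⟩, hle⟩
    simp only [Function.comp] at this
    linarith

/-- The case of a single-valued mapping. -/
theorem IsCompact.exists_pos_forall_le {X : Type*} [PseudoMetricSpace X] {K : Set X}
    (hK : IsCompact K) {f g : X → ℝ} (hf : Continuous f) (hg : Continuous g)
    (hlt : ∀ x ∈ K, f x ≤ 0 → g x < 0) : ∃ η > 0, ∀ x ∈ K, f x ≤ η → g x < 0 := by
  obtain ⟨η, hη, h⟩ := exists_pos_forall_of_outerSemicontOn (Φ := fun _ : X => ({0} : Set ℝ))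
    (S := univ) (fun _ _ _ _ v hv _ hy => by
      have : v = fun _ => 0 := funext fun n => (hv n).2
      subst this
      exact (tendsto_nhds_unique hy tendsto_const_nhds))
    (fun x _ => ⟨univ, univ_mem, (Bornology.isBounded_singleton (x := (0 : ℝ))).subset (by simp)⟩) hK
    (subset_univ _) hf (h := fun p => g p.1) (hg.comp continuous_fst)
    (fun x hx hfx _ _ => hlt x hx hfx)
  exact ⟨η, hη, fun x hx hfx => h x hx hfx 0 rfl⟩

/-! ### Comparison functions -/

theorem IsClassK.pos {α : ℝ → ℝ} (h : IsClassK α) {s : ℝ} (hs : 0 < s) : 0 < α s := by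
  rw [← h.map_zero]
  exact h.strictMonoOn (mem_Ici.2 le_rfl) (mem_Ici.2 hs.le) hs

theorem IsClassK.nonneg {α : ℝ → ℝ} (h : IsClassK α) {s : ℝ} (hs : 0 ≤ s) : 0 ≤ α s := by
  rw [← h.map_zero]
  exact h.strictMonoOn.monotoneOn (mem_Ici.2 le_rfl) (mem_Ici.2 hs) hs

theorem IsClassK.le_iff {α : ℝ → ℝ} (h : IsClassK α) {s t : ℝ} (hs : 0 ≤ s) (ht : 0 ≤ t) :
    α s ≤ α t ↔ s ≤ t := h.strictMonoOn.le_iff_le hs ht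

/-- Class `𝒦` functions are small near zero. -/
theorem IsClassK.exists_le {α : ℝ → ℝ} (h : IsClassK α) {c : ℝ} (hc : 0 < c) :
    ∃ s > 0, ∀ t, 0 ≤ t → t ≤ s → α t ≤ c := by
  have h0 : Tendsto α (𝓝[Ici 0] 0) (𝓝 0) := by
    have := h.continuousOn 0 (mem_Ici.2 le_rfl)
    rwa [ContinuousWithinAt, h.map_zero] at this
  have h1 := h0.eventually (Iic_mem_nhds hc)
  obtain ⟨s, hs, hsub⟩ := mem_nhdsGE_iff_exists_Icc_subset.1 h1
  exact ⟨s, hs, fun t ht hts => hsub ⟨ht, hts⟩⟩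

theorem IsClassKInfty.exists_ge {α : ℝ → ℝ} (h : IsClassKInfty α) (c : ℝ) :
    ∃ s > 0, c ≤ α s := by
  obtain ⟨s, hs⟩ := ((h.tendsto_atTop.eventually_ge_atTop c).and (eventually_gt_atTop 0)).exists
  exact ⟨s, hs.2, hs.1⟩

/-! ### Successively small parameters -/

/-- In filter form, finitely many successive smallness conditions combine without bookkeeping of
thresholds. -/
theorem successivelySmall_succ {k : ℕ} {P : (Fin (k + 1) → ℝ) → Prop} :
    SuccessivelySmall (k + 1) P ↔
      ∀ᶠ x in 𝓝[>] (0 : ℝ), SuccessivelySmall k fun p => P (Fin.cons x p) := by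
  rw [Filter.Eventually, mem_nhdsGT_iff_exists_Ioo_subset]
  constructor
  · rintro ⟨e, he, h⟩
    exact ⟨e, he, fun x hx => h x hx.1 hx.2⟩
  · rintro ⟨e, he, h⟩
    exact ⟨e, he, fun x hx hxe => h ⟨hx, hxe⟩⟩

/-- The property `Q γ θ ε β` holds for successively small `γ`, `θ`, `ε`, `β`. -/
def EventuallySmall (Q : ℝ → ℝ → ℝ → ℝ → Prop) : Prop :=
  ∀ᶠ γ in 𝓝[>] (0 : ℝ), ∀ᶠ θ in 𝓝[>] (0 : ℝ), ∀ᶠ ε in 𝓝[>] (0 : ℝ), ∀ᶠ β in 𝓝[>] (0 : ℝ), Q γ θ ε β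

theorem successivelySmall_four {P : (Fin 4 → ℝ) → Prop} :
    SuccessivelySmall 4 P ↔ EventuallySmall fun γ θ ε β => P ![γ, θ, ε, β] := by
  change SuccessivelySmall (0 + 1 + 1 + 1 + 1) P ↔ _
  simp only [successivelySmall_succ]
  rfl

theorem EventuallySmall.mono {Q Q' : ℝ → ℝ → ℝ → ℝ → Prop} (h : EventuallySmall Q)
    (hQ : ∀ γ θ ε β, Q γ θ ε β → Q' γ θ ε β) : EventuallySmall Q' :=
  Filter.Eventually.mono h fun _ h => h.mono fun _ h => h.mono fun _ h => h.mono fun _ h => hQ _ _ _ _ h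

theorem EventuallySmall.and {Q Q' : ℝ → ℝ → ℝ → ℝ → Prop} (h : EventuallySmall Q)
    (h' : EventuallySmall Q') : EventuallySmall fun γ θ ε β => Q γ θ ε β ∧ Q' γ θ ε β := by
  unfold EventuallySmall
  filter_upwards [h, h'] with γ h h'
  filter_upwards [h, h'] with θ h h'
  filter_upwards [h, h'] with ε h h'
  filter_upwards [h, h'] with β h h' using ⟨h, h'⟩

theorem eventuallySmall_mem_Ioc {β₀ γ₀ θ₀ : ℝ} (hβ₀ : 0 < β₀) (hγ₀ : 0 < γ₀) (hθ₀ : 0 < θ₀) :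
    EventuallySmall fun γ θ ε β => γ ∈ Ioc 0 γ₀ ∧ θ ∈ Ioc 0 θ₀ ∧ 0 < ε ∧ β ∈ Ioc 0 β₀ := by
  unfold EventuallySmall
  filter_upwards [Ioc_mem_nhdsGT hγ₀] with γ h1
  filter_upwards [Ioc_mem_nhdsGT hθ₀] with θ h2
  filter_upwards [self_mem_nhdsWithin] with ε h3
  filter_upwards [Ioc_mem_nhdsGT hβ₀] with β h4 using ⟨h1, h2, h3, h4⟩

/-! ### Hybrid time domains -/

/-- The last level of the truncation at `(a, k)` is `k` and ends at `a`, since the end point of the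
last level and `(a, k)` both lie in the truncation. All later arguments use the definition in this
normal form. -/
theorem IsHybridTimeDomain.exists_times {S : Set (ℝ × ℕ)} (h : IsHybridTimeDomain S) {a : ℝ}
    {k : ℕ} (hq : (a, k) ∈ S) : ∃ t : ℕ → ℝ, t 0 = 0 ∧ Monotone t ∧ t (k + 1) = a ∧
      ∀ s j, ((s, j) ∈ S ∧ s ≤ a ∧ j ≤ k) ↔ (j ≤ k ∧ t j ≤ s ∧ s ≤ t (j + 1)) := by
  obtain ⟨J, t, h0, hmono, heq⟩ := h _ hq
  have hiff : ∀ s j, ((s, j) ∈ S ∧ s ≤ a ∧ j ≤ k) ↔ (j ≤ J ∧ t j ≤ s ∧ s ≤ t (j + 1)) :=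
    fun s j => Set.ext_iff.1 heq (s, j)
  obtain ⟨h1, h2, h3⟩ := (hiff a k).1 ⟨hq, le_rfl, le_rfl⟩
  obtain ⟨-, -, h4⟩ := (hiff (t J) J).2 ⟨le_rfl, le_rfl, hmono (Nat.le_succ J)⟩
  obtain rfl : J = k := le_antisymm h4 h1
  obtain ⟨-, h5, -⟩ := (hiff (t (J + 1)) J).2 ⟨le_rfl, hmono (Nat.le_succ J), le_rfl⟩
  exact ⟨t, h0, hmono, le_antisymm h5 h3, hiff⟩

theorem IsHybridTimeDomain.mem_of_mem_Icc {S : Set (ℝ × ℕ)} (h : IsHybridTimeDomain S)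
    {a b c : ℝ} {j : ℕ} (ha : (a, j) ∈ S) (hb : (b, j) ∈ S) (hc : c ∈ Icc a b) : (c, j) ∈ S := by
  obtain ⟨t, -, -, ht, hiff⟩ := h.exists_times hb
  obtain ⟨-, h1, -⟩ := (hiff a j).1 ⟨ha, hc.1.trans hc.2, le_rfl⟩
  exact ((hiff c j).2 ⟨le_rfl, h1.trans hc.1, ht ▸ hc.2⟩).1

theorem IsHybridTimeDomain.exists_jump {S : Set (ℝ × ℕ)} (h : IsHybridTimeDomain S) {a : ℝ}
    {k i : ℕ} (hq : (a, k) ∈ S) (hi : i < k) : ∃ τ ≤ a, (τ, i) ∈ S ∧ (τ, i + 1) ∈ S := by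
  obtain ⟨t, -, hmono, ht, hiff⟩ := h.exists_times hq
  exact ⟨t (i + 1), ht ▸ hmono (by omega),
    ((hiff _ i).2 ⟨hi.le, hmono (Nat.le_succ i), le_rfl⟩).1,
    ((hiff _ (i + 1)).2 ⟨hi, le_rfl, hmono (Nat.le_succ _)⟩).1⟩

/-- An extension adds nothing to the past of a point: each level of the smaller truncation lies in
the same level of the larger one, and since consecutive levels share end points, the switching times
agree. -/
theorem IsHybridTimeDomain.mem_of_subset {S S' : Set (ℝ × ℕ)} (h : IsHybridTimeDomain S)
    (h' : IsHybridTimeDomain S') (hSS : S ⊆ S') {a s : ℝ} {k j : ℕ} (hq : (a, k) ∈ S)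
    (hp : (s, j) ∈ S') (hs : s ≤ a) (hj : j ≤ k) : (s, j) ∈ S := by
  obtain ⟨t, h0, hmono, ht, hiff⟩ := h.exists_times hq
  obtain ⟨t', h0', hmono', ht', hiff'⟩ := h'.exists_times (hSS hq)
  have hmem : ∀ i ≤ k, ∀ r, t i ≤ r → r ≤ t (i + 1) → t' i ≤ r ∧ r ≤ t' (i + 1) := by
    intro i hi r h1 h2
    obtain ⟨h3, h4, -⟩ := (hiff r i).2 ⟨hi, h1, h2⟩
    exact ((hiff' r i).1 ⟨hSS h3, h4, hi⟩).2
  have hle : ∀ i ≤ k, t i ≤ t' i := by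
    intro i hi
    cases i with
    | zero => rw [h0, h0']
    | succ i => exact (hmem i (by omega) _ (hmono (Nat.le_succ i)) le_rfl).2
  have hge : ∀ i ≤ k + 1, t' i ≤ t i := by
    intro i hi
    rcases eq_or_lt_of_le hi with rfl | hi
    · rw [ht, ht']
    · exact (hmem i (by omega) _ le_rfl (hmono (Nat.le_succ i))).1
  obtain ⟨-, h1, h2⟩ := (hiff' s j).1 ⟨hp, hs, hj⟩
  exact ((hiff s j).2 ⟨hj, (hle j hj).trans h1, h2.trans (hge _ (by omega))⟩).1

/-- After a jump out of a level that extends beyond the jump time, no time passes. -/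
theorem IsHybridTimeDomain.le_of_branching {S : Set (ℝ × ℕ)} (h : IsHybridTimeDomain S)
    {t t' a : ℝ} {j k : ℕ} (h1 : (t, j) ∈ S) (h2 : (t, j + 1) ∈ S) (h3 : (t', j) ∈ S)
    (htt : t < t') (hk : j + 1 ≤ k) (ha : (a, k) ∈ S) : a ≤ t := by
  by_contra! hlt
  obtain ⟨τ, -, hmono, hτ, hiff⟩ := h.exists_times ha
  obtain ⟨-, h4, -⟩ := (hiff t (j + 1)).1 ⟨h2, hlt.le, hk⟩
  have hmin : (min a t', j) ∈ S :=
    h.mem_of_mem_Icc h1 h3 ⟨le_min hlt.le htt.le, min_le_right _ _⟩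
  obtain ⟨-, -, h5⟩ := (hiff _ j).1 ⟨hmin, min_le_left _ _, by omega⟩
  exact absurd (h5.trans h4) (not_le.2 (lt_min hlt htt))

/-- A higher level is reached through a jump out of level `j`. That jump is also a branching, so the
upper bound applies to both jump times and identifies them. -/
theorem IsHybridTimeDomain.eq_of_branching {S : Set (ℝ × ℕ)} (h : IsHybridTimeDomain S)
    {t t' a : ℝ} {j k : ℕ} (h1 : (t, j) ∈ S) (h2 : (t, j + 1) ∈ S) (h3 : (t', j) ∈ S)
    (htt : t < t') (hk : j + 1 ≤ k) (ha : (a, k) ∈ S) : a = t := by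
  refine le_antisymm (h.le_of_branching h1 h2 h3 htt hk ha) ?_
  obtain ⟨τ, hτ, h4, h5⟩ := h.exists_jump ha (show j < k by omega)
  have hτt := hτ.trans (h.le_of_branching h1 h2 h3 htt hk ha)
  exact (h.le_of_branching h4 h5 h3 (hτt.trans_lt htt) le_rfl h2).trans hτ

/-- A lower level that extends beyond `t` would itself branch at a time at most `t`, which would
forbid the later point `(t', j)` above it. -/
theorem IsHybridTimeDomain.le_of_lt_branching {S : Set (ℝ × ℕ)} (h : IsHybridTimeDomain S)
    {t t' a : ℝ} {i j : ℕ} (h1 : (t, j) ∈ S) (h3 : (t', j) ∈ S)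
    (htt : t < t') (hi : i < j) (ha : (a, i) ∈ S) : a ≤ t := by
  by_contra! hlt
  obtain ⟨τ, hτ, h4, h5⟩ := h.exists_jump h1 hi
  exact absurd ((h.le_of_branching h4 h5 ha (hτ.trans_lt hlt) hi h3).trans hτ) (not_le.2 htt)

/-- In an unbounded domain with finitely many irregular jumps at bounded times, no level extends
beyond the time of a jump out of it. -/
theorem IsHybridTimeDomain.le_of_jump {S : Set (ℝ × ℕ)} (h : IsHybridTimeDomain S)
    (hunb : ∀ M : ℝ, ∃ p ∈ S, M ≤ p.1 + (p.2 : ℝ)) {σ T : ℝ} (hσ : 0 < σ)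
    (hfin : (SPSystem.irregularJumps S σ).Finite)
    (hT : ∀ j ∈ SPSystem.irregularJumps S σ, ∀ t, (t, j) ∈ S → t ≤ T)
    {t t' : ℝ} {j : ℕ} (h1 : (t, j) ∈ S) (h2 : (t, j + 1) ∈ S) (h3 : (t', j) ∈ S) : t' ≤ t := by
  by_contra! htt
  by_cases hK : ∃ K : ℕ, ∀ p ∈ S, p.2 ≤ K
  · obtain ⟨K, hK⟩ := hK
    -- Branching confines every other level to times at most `t`, so an unbounded domain with
    -- boundedly many levels is unbounded in time on level `j` itself.
    have hlev : ∀ M : ℝ, ∃ a, (a, j) ∈ S ∧ M ≤ a := by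
      intro M
      obtain ⟨⟨a, k⟩, hp, hM⟩ := hunb (max M (t + 1) + K)
      have hk : (k : ℝ) ≤ K := by exact_mod_cast hK _ hp
      have hM' : max M (t + 1) ≤ a := by simp only at hM; linarith
      have hat : t < a := by linarith [le_max_right M (t + 1)]
      rcases lt_trichotomy k j with hkj | rfl | hkj
      · exact absurd (h.le_of_lt_branching h1 h3 htt hkj hp) (not_le.2 hat)
      · exact ⟨a, hp, (le_max_left _ _).trans hM'⟩
      · exact absurd (h.le_of_branching h1 h2 h3 htt hkj hp) (not_le.2 hat)
    have hirr : j ∈ SPSystem.irregularJumps S σ := by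
      refine ⟨⟨t, h1, h2⟩, ?_⟩
      -- The supremum of an unbounded set of reals is `0` by convention, so a level of infinite
      -- length counts as irregular; this contradicts the time bound `T`.
      rw [Real.sSup_of_not_bddAbove]
      · exact hσ
      · rintro ⟨B, hB⟩
        obtain ⟨a, ha, hBa⟩ := hlev (t + |B| + 1)
        have := hB ⟨a, t, ha, h1, rfl⟩
        have h4 := le_abs_self B
        have h5 := le_abs_self (a - t)
        linarith
    obtain ⟨a, ha, hTa⟩ := hlev (T + 1)
    linarith [hT j hirr a ha]
  · push Not at hK
    -- With unboundedly many levels, all those above `j` are concentrated at time `t`, have length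
    -- `0`, and give infinitely many irregular jumps.
    refine ((Ici_infinite (j + 1)).mono fun k hk => ?_) hfin
    obtain ⟨⟨a, i⟩, hp, hi⟩ := hK k
    obtain ⟨τ, -, h4, h5⟩ := h.exists_jump hp hi
    refine ⟨⟨τ, h4, h5⟩, lt_of_le_of_lt (csSup_le ⟨_, τ, τ, h4, h4, rfl⟩ ?_) hσ⟩
    rintro d ⟨r, r', hr, hr', rfl⟩
    rw [h.eq_of_branching h1 h2 h3 htt hk hr, h.eq_of_branching h1 h2 h3 htt hk hr']
    simp

/-- Without branching, the order of hybrid times is that of `t + j`. -/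
theorem IsHybridTimeDomain.le_of_add_le {S : Set (ℝ × ℕ)} (h : IsHybridTimeDomain S)
    (hbr : ∀ t t' j, (t, j) ∈ S → (t, j + 1) ∈ S → (t', j) ∈ S → t' ≤ t) {p q : ℝ × ℕ}
    (hp : p ∈ S) (hq : q ∈ S) (hpq : p.1 + (p.2 : ℝ) ≤ q.1 + (q.2 : ℝ)) :
    p.1 ≤ q.1 ∧ p.2 ≤ q.2 := by
  obtain ⟨a, i⟩ := p
  obtain ⟨b, k⟩ := q
  simp only at hpq ⊢
  rcases lt_trichotomy i k with hik | rfl | hik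
  · obtain ⟨τ, hτ, h1, h2⟩ := h.exists_jump hq hik
    exact ⟨(hbr τ a i h1 h2 hp).trans hτ, hik.le⟩
  · exact ⟨by linarith, le_rfl⟩
  · obtain ⟨τ, hτ, h1, h2⟩ := h.exists_jump hp hik
    have := (hbr τ b k h1 h2 hq).trans hτ
    have : (k : ℝ) < i := by exact_mod_cast hik
    linarith

/-! ### Operations on solutions -/

theorem AbsolutelyContinuousOnInterval.congr {X : Type*} [PseudoMetricSpace X] {f g : ℝ → X}
    {a b : ℝ} (hf : AbsolutelyContinuousOnInterval f a b) (hfg : EqOn f g (uIcc a b)) :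
    AbsolutelyContinuousOnInterval g a b := by
  rw [absolutelyContinuousOnInterval_iff] at hf ⊢
  intro ε hε
  obtain ⟨δ, hδ, h⟩ := hf ε hε
  refine ⟨δ, hδ, fun E hE hlt => ?_⟩
  have := h E hE hlt
  rwa [Finset.sum_congr rfl fun i hi => by rw [hfg (hE.1 i hi).1, hfg (hE.1 i hi).2]] at this

theorem AbsolutelyContinuousOnInterval.comp_add_right {X : Type*} [PseudoMetricSpace X]
    {f : ℝ → X} {a b c : ℝ} (hf : AbsolutelyContinuousOnInterval f (a + c) (b + c)) :
    AbsolutelyContinuousOnInterval (fun s => f (s + c)) a b := by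
  rw [absolutelyContinuousOnInterval_iff] at hf ⊢
  intro ε hε
  obtain ⟨δ, hδ, h⟩ := hf ε hε
  refine ⟨δ, hδ, fun E hE hlt => ?_⟩
  refine h (E.1, fun i => ((E.2 i).1 + c, (E.2 i).2 + c)) ⟨fun i hi => ?_, ?_⟩ ?_
  · have := hE.1 i hi
    simp only [mem_uIcc, add_le_add_iff_right] at this ⊢
    exact this
  · intro i hi k hk hik
    have := hE.2 hi hk hik
    simp only [Function.onFun, Set.disjoint_left, mem_uIoc] at this ⊢
    intro r hr hr'
    refine this (a := r - c) ?_ ?_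
    · rcases hr with hr | hr
      · exact Or.inl ⟨by linarith, by linarith⟩
      · exact Or.inr ⟨by linarith, by linarith⟩
    · rcases hr' with hr | hr
      · exact Or.inl ⟨by linarith, by linarith⟩
      · exact Or.inr ⟨by linarith, by linarith⟩
  · simpa using hlt

section Solutions

variable {E : Type*} [NormedAddCommGroup E] [NormedSpace ℝ E] {ℋ : HybridSystem E}

/-- The union of a chain of solutions is a solution. -/
theorem IsSolution.iUnion_chain {c : Set (Set (ℝ × ℕ) × (ℝ → ℕ → E))} (hne : c.Nonempty)
    (hsol : ∀ x ∈ c, IsSolution ℋ x.1 x.2)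
    (hchain : ∀ x ∈ c, ∀ y ∈ c, (x.1 ⊆ y.1 ∧ ∀ p ∈ x.1, y.2 p.1 p.2 = x.2 p.1 p.2) ∨
      (y.1 ⊆ x.1 ∧ ∀ p ∈ y.1, x.2 p.1 p.2 = y.2 p.1 p.2)) :
    ∃ φ : ℝ → ℕ → E, IsSolution ℋ (⋃ x ∈ c, x.1) φ ∧
      ∀ x ∈ c, ∀ p ∈ x.1, φ p.1 p.2 = x.2 p.1 p.2 := by
  classical
  let φ : ℝ → ℕ → E := fun t j =>
    if h : ∃ x ∈ c, (t, j) ∈ x.1 then (Classical.choose h).2 t j else 0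
  have hφ : ∀ x ∈ c, ∀ t j, (t, j) ∈ x.1 → φ t j = x.2 t j := by
    intro x hx t j hp
    have h : ∃ x ∈ c, (t, j) ∈ x.1 := ⟨x, hx, hp⟩
    obtain ⟨h1, h2⟩ := Classical.choose_spec h
    have h3 : φ t j = (Classical.choose h).2 t j := dif_pos h
    rw [h3]
    rcases hchain x hx _ h1 with h4 | h4
    · exact h4.2 (t, j) hp
    · exact (h4.2 (t, j) h2).symm
  have hcommon : ∀ p q : ℝ × ℕ, p ∈ (⋃ x ∈ c, x.1) → q ∈ (⋃ x ∈ c, x.1) →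
      ∃ x ∈ c, p ∈ x.1 ∧ q ∈ x.1 := by
    intro p q hp hq
    obtain ⟨x, hx, hp⟩ := mem_iUnion₂.1 hp
    obtain ⟨y, hy, hq⟩ := mem_iUnion₂.1 hq
    rcases hchain x hx y hy with h4 | h4
    · exact ⟨y, hy, h4.1 hp, hq⟩
    · exact ⟨x, hx, hp, h4.1 hq⟩
  have hlevel : ∀ x ∈ c, ∀ a b j, (a, j) ∈ x.1 → (b, j) ∈ x.1 → ∀ t ∈ Icc a b,
      φ t j = x.2 t j := fun x hx a b j ha hb t ht =>
    hφ x hx t j ((hsol x hx).isHybridTimeDomain.mem_of_mem_Icc ha hb ht)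
  refine ⟨φ, ?_, fun x hx p hp => hφ x hx p.1 p.2 hp⟩
  obtain ⟨x₀, hx₀⟩ := hne
  constructor
  · intro q hq
    obtain ⟨x, hx, hqx⟩ := mem_iUnion₂.1 hq
    -- The truncation of the union at `q` is already that of any member containing `q`, by
    -- `mem_of_subset`.
    have : (⋃ x ∈ c, x.1) ∩ {p | p.1 ≤ q.1 ∧ p.2 ≤ q.2} = x.1 ∩ {p | p.1 ≤ q.1 ∧ p.2 ≤ q.2} := by
      ext p
      refine ⟨fun ⟨hp, hpq⟩ => ⟨?_, hpq⟩, fun ⟨hp, hpq⟩ => ⟨mem_biUnion hx hp, hpq⟩⟩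
      obtain ⟨y, hy, hpy⟩ := mem_iUnion₂.1 hp
      rcases hchain x hx y hy with h4 | h4
      · exact (hsol x hx).isHybridTimeDomain.mem_of_subset (hsol y hy).isHybridTimeDomain h4.1
          hqx hpy hpq.1 hpq.2
      · exact h4.1 hpy
    rw [this]
    exact (hsol x hx).isHybridTimeDomain q hqx
  · exact mem_biUnion hx₀ (hsol x₀ hx₀).zero_mem
  · rw [hφ x₀ hx₀ 0 0 (hsol x₀ hx₀).zero_mem]
    exact (hsol x₀ hx₀).init
  · intro j a b hab ha hb
    obtain ⟨x, hx, ha, hb⟩ := hcommon _ _ ha hb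
    refine AbsolutelyContinuousOnInterval.congr ((hsol x hx).absCont j a b hab ha hb) ?_
    rw [uIcc_of_le hab]
    exact fun t ht => (hlevel x hx a b j ha hb t ht).symm
  · intro j a b ha hb t ht
    obtain ⟨x, hx, ha, hb⟩ := hcommon _ _ ha hb
    rw [hlevel x hx a b j ha hb t (Ioo_subset_Icc_self ht)]
    exact (hsol x hx).flow_mem j a b ha hb t ht
  · intro j a b ha hb
    obtain ⟨x, hx, ha, hb⟩ := hcommon _ _ ha hb
    filter_upwards [(hsol x hx).flow j a b ha hb] with t ht hmem
    obtain ⟨v, hv, hd⟩ := ht hmem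
    refine ⟨v, by rwa [hlevel x hx a b j ha hb t (Ioo_subset_Icc_self hmem)], ?_⟩
    refine hd.congr_of_eventuallyEq ?_
    filter_upwards [Ioo_mem_nhds hmem.1 hmem.2] with s hs
    exact hlevel x hx a b j ha hb s (Ioo_subset_Icc_self hs)
  · intro j t h1 h2
    obtain ⟨x, hx, h1, h2⟩ := hcommon _ _ h1 h2
    rw [hφ x hx t j h1, hφ x hx t (j + 1) h2]
    exact (hsol x hx).jump j t h1 h2

/-- Zorn's lemma for the extension relation. Values outside the domain are arbitrary, so the
relation is only a preorder; maximality still rules out a strictly larger domain. -/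
theorem IsSolution.exists_maximal {S : Set (ℝ × ℕ)} {φ : ℝ → ℕ → E} (h : IsSolution ℋ S φ) :
    ∃ S' φ', IsMaximalSolution ℋ S' φ' ∧ S ⊆ S' ∧ ∀ p ∈ S, φ' p.1 p.2 = φ p.1 p.2 := by
  let r : (Set (ℝ × ℕ) × (ℝ → ℕ → E)) → (Set (ℝ × ℕ) × (ℝ → ℕ → E)) → Prop :=
    fun x y => x.1 ⊆ y.1 ∧ ∀ p ∈ x.1, y.2 p.1 p.2 = x.2 p.1 p.2
  have rtrans : ∀ x y z, r x y → r y z → r x z := fun x y z hxy hyz =>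
    ⟨hxy.1.trans hyz.1, fun p hp => (hyz.2 p (hxy.1 hp)).trans (hxy.2 p hp)⟩
  let α := {x : Set (ℝ × ℕ) × (ℝ → ℕ → E) // IsSolution ℋ x.1 x.2 ∧ r (S, φ) x}
  obtain ⟨m, hm⟩ := exists_maximal_of_chains_bounded (α := α) (r := fun x y => r x.1 y.1) (by
      intro c hc
      rcases c.eq_empty_or_nonempty with rfl | hne
      · exact ⟨⟨(S, φ), h, subset_rfl, fun _ _ => rfl⟩, by simp⟩
      · obtain ⟨ψ, hψ, hag⟩ := IsSolution.iUnion_chain (ℋ := ℋ) (c := Subtype.val '' c)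
          (hne.image _) (by rintro _ ⟨x, hx, rfl⟩; exact x.2.1) (by
            rintro _ ⟨x, hx, rfl⟩ _ ⟨y, hy, rfl⟩
            rcases eq_or_ne x y with rfl | hxy
            · exact Or.inl ⟨subset_rfl, fun _ _ => rfl⟩
            · exact hc hx hy hxy)
        have hub : ∀ a ∈ c, r a.1 (⋃ x ∈ Subtype.val '' c, x.1, ψ) := fun a ha =>
          ⟨fun p hp => mem_biUnion (mem_image_of_mem _ ha) hp,
            hag _ (mem_image_of_mem _ ha)⟩
        obtain ⟨x, hx⟩ := hne
        exact ⟨⟨(⋃ x ∈ Subtype.val '' c, x.1, ψ), hψ, rtrans _ _ _ x.2.2 (hub x hx)⟩, hub⟩)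
    (fun {x y z} => rtrans _ _ _)
  refine ⟨m.1.1, m.1.2, ⟨m.2.1, ?_⟩, m.2.2⟩
  rintro ⟨S', φ', hsol, hss, hag⟩
  have h1 : r m.1 (S', φ') := ⟨hss.1, hag⟩
  exact hss.2 (hm ⟨(S', φ'), hsol, rtrans _ _ _ m.2.2 h1⟩ h1).1

/-- The first point of a level is the initial point or the image of a jump, and any other point is a
limit of interior flow points from the left. Hence every point of a solution is admissible as an
initial point, as `IsSolution.shift` requires. -/
theorem IsSolution.mem_closure_union {S : Set (ℝ × ℕ)} {φ : ℝ → ℕ → E} (h : IsSolution ℋ S φ)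
    (hG : ∀ x ∈ ℋ.jumpSet, ℋ.jumpMap x ⊆ ℋ.flowSet) {s : ℝ} {j : ℕ} (hs : (s, j) ∈ S) :
    φ s j ∈ closure ℋ.flowSet ∪ ℋ.jumpSet := by
  obtain ⟨t, h0, hmono, ht, hiff⟩ := h.isHybridTimeDomain.exists_times hs
  have hts : t j ≤ s := ht ▸ hmono (Nat.le_succ j)
  have hmem : (t j, j) ∈ S := ((hiff _ j).2 ⟨le_rfl, le_rfl, hmono (Nat.le_succ j)⟩).1
  rcases eq_or_lt_of_le hts with heq | hlt
  · cases j with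
    | zero => rw [← heq, h0]; exact h.init
    | succ j =>
      have h1 : (t (j + 1), j) ∈ S :=
        ((hiff _ j).2 ⟨Nat.le_succ j, hmono (Nat.le_succ j), le_rfl⟩).1
      obtain ⟨h2, h3⟩ := h.jump j _ h1 hmem
      rw [← heq]
      exact Or.inl (subset_closure (hG _ h2 h3))
  · left
    have hac := h.absCont j _ _ hts hmem hs
    have hc : ContinuousWithinAt (fun r => φ r j) (Ioo (t j) s) s := by
      have := hac.continuousOn s right_mem_uIcc
      refine this.mono ?_
      rw [uIcc_of_le hts]
      exact Ioo_subset_Icc_self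
    refine hc.mem_closure ?_ fun r hr => h.flow_mem j _ _ hmem hs r hr
    rw [closure_Ioo hlt.ne]
    exact ⟨hts, le_rfl⟩

/-- The tail of a hybrid time domain. -/
def shiftDomain (S : Set (ℝ × ℕ)) (a : ℝ) (k : ℕ) : Set (ℝ × ℕ) :=
  {x | 0 ≤ x.1 ∧ (x.1 + a, x.2 + k) ∈ S}

theorem IsHybridTimeDomain.shift {S : Set (ℝ × ℕ)} (h : IsHybridTimeDomain S) {a : ℝ} {k : ℕ}
    (hp : (a, k) ∈ S) : IsHybridTimeDomain (shiftDomain S a k) := by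
  rintro ⟨b, i⟩ ⟨hb, hq⟩
  simp only at hb hq
  obtain ⟨t, h0, hmono, ht, hiff⟩ := h.exists_times hq
  obtain ⟨-, h1, h2⟩ := (hiff a k).1 ⟨hp, by linarith, by omega⟩
  -- Level `k` of `S` is cut at `a`, not at its beginning `t k`; hence the special value for `l =
  -- 0`.
  refine ⟨i, fun l => if l = 0 then 0 else t (l + k) - a, by simp, ?_, ?_⟩
  · intro l l' hl
    by_cases hl0 : l = 0
    · by_cases hl' : l' = 0
      · simp [hl0, hl']
      · have : t (k + 1) ≤ t (l' + k) := hmono (by omega)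
        simp only [hl0, hl', if_true, if_false]
        linarith
    · have : t (l + k) ≤ t (l' + k) := hmono (by omega)
      simp only [hl0, show l' ≠ 0 by omega, if_false]
      linarith
  · ext ⟨s, l⟩
    have := hiff (s + a) (l + k)
    simp only [shiftDomain, mem_inter_iff, mem_ofPred_eq, Nat.succ_ne_zero, if_false]
    have e : l + 1 + k = l + k + 1 := by ring
    rw [e]
    constructor
    · rintro ⟨⟨hs, hS⟩, hsb, hli⟩
      obtain ⟨-, h3, h4⟩ := this.1 ⟨hS, by linarith, by omega⟩
      refine ⟨hli, ?_, by linarith⟩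
      split_ifs with hl
      · exact hs
      · linarith
    · rintro ⟨hli, h3, h4⟩
      have hs : 0 ≤ s ∧ t (l + k) ≤ s + a := by
        split_ifs at h3 with hl
        · subst hl
          rw [Nat.zero_add]
          exact ⟨h3, by linarith⟩
        · have : t (k + 1) ≤ t (l + k) := hmono (by omega)
          exact ⟨by linarith, by linarith⟩
      obtain ⟨h5, h6, -⟩ := this.2 ⟨by omega, hs.2, by linarith⟩
      exact ⟨⟨hs.1, h5⟩, by linarith, hli⟩

theorem IsSolution.shift {S : Set (ℝ × ℕ)} {φ : ℝ → ℕ → E} (h : IsSolution ℋ S φ)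
    (hG : ∀ x ∈ ℋ.jumpSet, ℋ.jumpMap x ⊆ ℋ.flowSet) {a : ℝ} {k : ℕ} (hp : (a, k) ∈ S) :
    IsSolution ℋ (shiftDomain S a k) (fun s j => φ (s + a) (j + k)) where
  isHybridTimeDomain := h.isHybridTimeDomain.shift hp
  zero_mem := ⟨le_rfl, by simpa using hp⟩
  init := by simpa using h.mem_closure_union hG hp
  absCont j b c hbc hb hc := AbsolutelyContinuousOnInterval.comp_add_right
    (f := fun s => φ s (j + k)) (h.absCont (j + k) _ _ (by linarith) hb.2 hc.2)
  flow_mem j b c hb hc t ht :=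
    h.flow_mem (j + k) _ _ hb.2 hc.2 (t + a) ⟨by linarith [ht.1], by linarith [ht.2]⟩
  flow j b c hb hc := by
    have h1 := h.flow (j + k) _ _ hb.2 hc.2
    have h2 := (measurePreserving_add_right volume a).quasiMeasurePreserving.ae h1
    filter_upwards [h2] with t ht hmem
    obtain ⟨v, hv, hd⟩ := ht ⟨by linarith [hmem.1], by linarith [hmem.2]⟩
    exact ⟨v, hv, hd.comp_add_const t a⟩
  jump j t h1 h2 := by
    have e : j + 1 + k = j + k + 1 := by ring
    have := h2.2
    simp only [e] at this ⊢
    exact h.jump (j + k) (t + a) h1.2 this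

/-- A hybrid arc with finitely many levels `0, …, J`, where level `j` is the time interval
`[t j, t (j + 1)]`, that satisfies the flow and jump conditions of `ℋ`. -/
structure IsArc (ℋ : HybridSystem E) (J : ℕ) (t : ℕ → ℝ) (φ : ℝ → ℕ → E) : Prop where
  le : ∀ j ≤ J, t j ≤ t (j + 1)
  absCont : ∀ j ≤ J, AbsolutelyContinuousOnInterval (fun s => φ s j) (t j) (t (j + 1))
  mem : ∀ j ≤ J, ∀ s ∈ Icc (t j) (t (j + 1)), φ s j ∈ closure ℋ.flowSet ∪ ℋ.jumpSet
  flow : ∀ j ≤ J, ∀ᵐ s : ℝ, s ∈ Ioo (t j) (t (j + 1)) →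
    ∃ v ∈ ℋ.flowMap (φ s j), HasDerivAt (fun r => φ r j) v s
  jump : ∀ j < J, φ (t (j + 1)) j ∈ ℋ.jumpSet ∧
    φ (t (j + 1)) (j + 1) ∈ ℋ.jumpMap (φ (t (j + 1)) j)

theorem IsSolution.isArc {S : Set (ℝ × ℕ)} {φ : ℝ → ℕ → E} (h : IsSolution ℋ S φ)
    (hG : ∀ x ∈ ℋ.jumpSet, ℋ.jumpMap x ⊆ ℋ.flowSet) {J : ℕ} {t : ℕ → ℝ} (hmono : Monotone t)
    (hS : ∀ j ≤ J, ∀ s ∈ Icc (t j) (t (j + 1)), (s, j) ∈ S) : IsArc ℋ J t φ where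
  le j _ := hmono (Nat.le_succ j)
  absCont j hj := h.absCont j _ _ (hmono (Nat.le_succ j))
    (hS j hj _ ⟨le_rfl, hmono (Nat.le_succ j)⟩) (hS j hj _ ⟨hmono (Nat.le_succ j), le_rfl⟩)
  mem j hj s hs := h.mem_closure_union hG (hS j hj s hs)
  flow j hj := h.flow j _ _
    (hS j hj _ ⟨le_rfl, hmono (Nat.le_succ j)⟩) (hS j hj _ ⟨hmono (Nat.le_succ j), le_rfl⟩)
  jump j hj := h.jump j _ (hS j hj.le _ ⟨hmono (Nat.le_succ j), le_rfl⟩)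
    (hS (j + 1) hj _ ⟨le_rfl, hmono (Nat.le_succ _)⟩)

theorem IsArc.monotone {J : ℕ} {t : ℕ → ℝ} {φ : ℝ → ℕ → E} (h : IsArc ℋ J t φ) {i j : ℕ}
    (hij : i ≤ j) (hj : j ≤ J + 1) : t i ≤ t j := by
  induction j, hij using Nat.le_induction with
  | base => exact le_rfl
  | succ j hij ih => exact (ih (by omega)).trans (h.le j (by omega))

theorem IsArc.take {J : ℕ} {t : ℕ → ℝ} {φ : ℝ → ℕ → E} (h : IsArc ℋ J t φ) {k : ℕ}
    (hk : k ≤ J) : IsArc ℋ k t φ where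
  le j hj := h.le j (hj.trans hk)
  absCont j hj := h.absCont j (hj.trans hk)
  mem j hj := h.mem j (hj.trans hk)
  flow j hj := h.flow j (hj.trans hk)
  jump j hj := h.jump j (hj.trans_le hk)

/-- The part of an arc that begins with level `k`. -/
theorem IsArc.tail {J : ℕ} {t : ℕ → ℝ} {φ : ℝ → ℕ → E} (h : IsArc ℋ J t φ) {k : ℕ}
    (hk : k ≤ J) : IsArc ℋ (J - k) (fun i => t (i + k)) (fun s j => φ s (j + k)) := by
  have e : ∀ j, j + 1 + k = j + k + 1 := fun j => by ring
  constructor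
  · intro j hj; simp only [e]; exact h.le _ (by omega)
  · intro j hj; simp only [e]; exact h.absCont _ (by omega)
  · intro j hj; simp only [e]; exact h.mem _ (by omega)
  · intro j hj; simp only [e]; exact h.flow _ (by omega)
  · intro j hj; simp only [e]; exact h.jump _ (by omega)

/-! ### Short levels and the passage from solutions to arcs -/

/-- The levels of an arc that last less than `σ` before the next jump. -/
noncomputable def shortLevels (J : ℕ) (t : ℕ → ℝ) (σ : ℝ) : Finset ℕ :=
  {j ∈ Finset.range J | t (j + 1) - t j < σ}

theorem mem_shortLevels {J : ℕ} {t : ℕ → ℝ} {σ : ℝ} {j : ℕ} :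
    j ∈ shortLevels J t σ ↔ j < J ∧ t (j + 1) - t j < σ := by
  simp [shortLevels]

theorem shortLevels_mono {J k : ℕ} (hk : k ≤ J) (t : ℕ → ℝ) (σ : ℝ) :
    shortLevels k t σ ⊆ shortLevels J t σ := fun _ hj =>
  mem_shortLevels.2 ⟨(mem_shortLevels.1 hj).1.trans_le hk, (mem_shortLevels.1 hj).2⟩

/-- The first short level splits off a part without short levels. -/
theorem exists_first_shortLevel {J : ℕ} {t : ℕ → ℝ} {σ : ℝ} (h : shortLevels J t σ ≠ ∅) :
    ∃ j ∈ shortLevels J t σ, shortLevels j t σ = ∅ ∧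
      (∀ i ∈ shortLevels (J - (j + 1)) (fun i => t (i + (j + 1))) σ,
        i + (j + 1) ∈ shortLevels J t σ) ∧
      (shortLevels (J - (j + 1)) (fun i => t (i + (j + 1))) σ).card + 1 ≤
        (shortLevels J t σ).card := by
  have hne : (shortLevels J t σ).Nonempty := Finset.nonempty_iff_ne_empty.2 h
  have hmem := (shortLevels J t σ).min'_mem hne
  set j := (shortLevels J t σ).min' hne with hj
  have htail : ∀ i ∈ shortLevels (J - (j + 1)) (fun i => t (i + (j + 1))) σ,
      i + (j + 1) ∈ shortLevels J t σ := by
    intro i hi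
    obtain ⟨h1, h2⟩ := mem_shortLevels.1 hi
    have e : i + 1 + (j + 1) = i + (j + 1) + 1 := by ring
    simp only [e] at h2
    exact mem_shortLevels.2 ⟨by omega, h2⟩
  refine ⟨j, hmem, ?_, htail, ?_⟩
  · refine Finset.eq_empty_of_forall_notMem fun i hi => ?_
    have h1 := (shortLevels J t σ).min'_le i
      (shortLevels_mono (mem_shortLevels.1 hmem).1.le t σ hi)
    have h2 := (mem_shortLevels.1 hi).1
    omega
  · rw [← Finset.card_map (addRightEmbedding (j + 1)),
      ← Finset.card_insert_of_notMem (a := j) (by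
        simp only [Finset.mem_map, addRightEmbedding_apply, not_exists, not_and]
        intro x _
        omega)]
    refine Finset.card_le_card fun i hi => ?_
    simp only [Finset.mem_insert, Finset.mem_map, addRightEmbedding_apply] at hi
    rcases hi with rfl | ⟨i, hi, rfl⟩
    · exact hmem
    · exact htail i hi

/-- The number of jumps of an arc is bounded by its duration and its number of short levels. -/
theorem IsArc.jumps_mul_le {J : ℕ} {t : ℕ → ℝ} {φ : ℝ → ℕ → E} (h : IsArc ℋ J t φ) {σ : ℝ}
    (hσ : 0 < σ) : σ * J ≤ σ * (shortLevels J t σ).card + (t (J + 1) - t 0) := by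
  -- Each level before `k` is either counted as short or contributes at least `σ` to the elapsed
  -- time.
  have key : ∀ k ≤ J, σ * k ≤ σ * ((shortLevels J t σ).filter (· < k)).card + (t k - t 0) := by
    intro k hk
    induction k with
    | zero => simp
    | succ k ih =>
      have ih := ih (by omega)
      have hle := h.le k (by omega)
      push_cast
      by_cases hshort : t (k + 1) - t k < σ
      · have : ((shortLevels J t σ).filter (· < k)).card + 1 ≤
            ((shortLevels J t σ).filter (· < k + 1)).card := by
          rw [← Finset.card_insert_of_notMem (a := k) (by simp)]
          refine Finset.card_le_card fun i hi => ?_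
          simp only [Finset.mem_insert, Finset.mem_filter, mem_shortLevels] at hi ⊢
          rcases hi with rfl | hi
          · exact ⟨⟨by omega, hshort⟩, by omega⟩
          · exact ⟨hi.1, by omega⟩
        have h2 : (((shortLevels J t σ).filter (· < k)).card : ℝ) + 1 ≤
            ((shortLevels J t σ).filter (· < k + 1)).card := by exact_mod_cast this
        nlinarith
      · have : ((shortLevels J t σ).filter (· < k)).card ≤
            ((shortLevels J t σ).filter (· < k + 1)).card :=
          Finset.card_le_card fun i hi => by
            simp only [Finset.mem_filter] at hi ⊢
            exact ⟨hi.1, by omega⟩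
        have h2 : (((shortLevels J t σ).filter (· < k)).card : ℝ) ≤
            ((shortLevels J t σ).filter (· < k + 1)).card := by exact_mod_cast this
        nlinarith
  have h1 := key J le_rfl
  have h2 : (shortLevels J t σ).filter (· < J) = shortLevels J t σ :=
    Finset.filter_true_of_mem fun i hi => (mem_shortLevels.1 hi).1
  rw [h2] at h1
  linarith [h.le J le_rfl]

/-- A solution of a system whose maximal solutions are complete and have finitely many irregular
jumps, from the hybrid time `p` to the hybrid time `q`. -/
theorem IsSolution.exists_arc {S : Set (ℝ × ℕ)} {φ : ℝ → ℕ → E} (h : IsSolution ℋ S φ)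
    (hG : ∀ x ∈ ℋ.jumpSet, ℋ.jumpMap x ⊆ ℋ.flowSet) (hcomplete : SolutionsComplete ℋ) {σ : ℝ}
    (hσ : 0 < σ)
    (hreg : ∀ S φ, IsSolution ℋ S φ → ∃ (N : ℕ) (T : ℝ),
      (SPSystem.irregularJumps S σ).encard ≤ N ∧
      ∀ j ∈ SPSystem.irregularJumps S σ, ∀ t, (t, j) ∈ S → t ≤ T)
    {p q : ℝ × ℕ} (hp : p ∈ S) (hq : q ∈ S) (hpq : p.1 + (p.2 : ℝ) ≤ q.1 + (q.2 : ℝ)) :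
    ∃ (S' : Set (ℝ × ℕ)) (ψ : ℝ → ℕ → E) (J : ℕ) (t : ℕ → ℝ), IsSolution ℋ S' ψ ∧
      IsArc ℋ J t ψ ∧ t 0 = 0 ∧ ψ 0 0 = φ p.1 p.2 ∧ q.1 = t (J + 1) + p.1 ∧ q.2 = J + p.2 ∧
      ψ (t (J + 1)) J = φ q.1 q.2 ∧
      (∀ j ≤ J, ∀ s ∈ Icc (t j) (t (j + 1)), (s, j) ∈ S' ∧ ∃ p' ∈ S, ψ s j = φ p'.1 p'.2 ∧
        p'.1 + (p'.2 : ℝ) ≤ q.1 + (q.2 : ℝ)) ∧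
      ∀ j ∈ shortLevels J t σ, j ∈ SPSystem.irregularJumps S' σ := by
  -- Branching is excluded in the maximal extension, whose domain is unbounded, and thus in every
  -- solution.
  have hbr : ∀ S φ, IsSolution ℋ S φ → ∀ t t' j, (t, j) ∈ S → (t, j + 1) ∈ S → (t', j) ∈ S →
      t' ≤ t := by
    intro S φ h t t' j h1 h2 h3
    obtain ⟨S', φ', hmax, hsub, -⟩ := h.exists_maximal
    obtain ⟨N, T, hN, hT⟩ := hreg S' φ' hmax.1
    exact hmax.1.isHybridTimeDomain.le_of_jump (hcomplete S' φ' hmax) hσ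
      (finite_of_encard_le_coe hN) hT (hsub h1) (hsub h2) (hsub h3)
  obtain ⟨h1, h2⟩ := h.isHybridTimeDomain.le_of_add_le (hbr S φ h) hp hq hpq
  obtain ⟨a, k⟩ := p
  obtain ⟨b, i⟩ := q
  simp only at h1 h2 hpq ⊢
  have hsol := h.shift hG hp
  have hq' : (b - a, i - k) ∈ shiftDomain S a k :=
    ⟨by simpa using h1, by simpa [Nat.sub_add_cancel h2] using hq⟩
  obtain ⟨t, h0, hmono, ht, hiff⟩ := hsol.isHybridTimeDomain.exists_times hq'
  have hmem : ∀ j ≤ i - k, ∀ s ∈ Icc (t j) (t (j + 1)), (s, j) ∈ shiftDomain S a k :=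
    fun j hj s hs => ((hiff s j).2 ⟨hj, hs.1, hs.2⟩).1
  refine ⟨shiftDomain S a k, _, i - k, t, hsol, hsol.isArc hG hmono hmem, h0, by simp,
    by rw [ht]; ring, by omega, by simp [ht, Nat.sub_add_cancel h2], fun j hj s hs =>
      ⟨hmem j hj s hs, (s + a, j + k), (hmem j hj s hs).2, rfl, ?_⟩, fun j hj => ?_⟩
  · have h3 : s ≤ b - a := ht ▸ hs.2.trans (hmono (by omega))
    have h4 : ((j + k : ℕ) : ℝ) ≤ i := by exact_mod_cast (by omega : j + k ≤ i)
    simp only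
    linarith
  · obtain ⟨hj, hjσ⟩ := mem_shortLevels.1 hj
    have h3 : (t (j + 1), j) ∈ shiftDomain S a k :=
      hmem j hj.le _ ⟨hmono (Nat.le_succ j), le_rfl⟩
    have h4 : (t (j + 1), j + 1) ∈ shiftDomain S a k :=
      hmem (j + 1) hj _ ⟨le_rfl, hmono (Nat.le_succ _)⟩
    refine ⟨⟨_, h3, h4⟩, lt_of_le_of_lt (csSup_le ⟨_, _, _, h3, h3, rfl⟩ ?_) hjσ⟩
    -- Irregularity refers to the whole level of the domain, the arc only to its truncation at `q`;
    -- without branching, the level ends at its jump and the two agree.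
    have hloc : ∀ r, (r, j) ∈ shiftDomain S a k → t j ≤ r ∧ r ≤ t (j + 1) := by
      intro r hr
      have h5 := hbr _ _ hsol _ r j h3 h4 hr
      exact ((hiff r j).1 ⟨hr, h5.trans (ht ▸ hmono (by omega)), hj.le⟩).2
    rintro d ⟨r, r', hr, hr', rfl⟩
    obtain ⟨h5, h6⟩ := hloc r hr
    obtain ⟨h7, h8⟩ := hloc r' hr'
    rw [abs_le]
    exact ⟨by linarith, by linarith⟩

end Solutions

/-! ### Geometry of the boundary layer manifold -/

theorem isCompact_infDist_le {X : Type*} [PseudoMetricSpace X] [ProperSpace X] {K : Set X}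
    (hK : IsCompact K) (hne : K.Nonempty) (r : ℝ) : IsCompact {x | Metric.infDist x K ≤ r} := by
  refine Metric.isCompact_of_isClosed_isBounded
    (isClosed_le (Metric.continuous_infDist_pt K) continuous_const) ?_
  refine (hK.isBounded.thickening (δ := r + 1)).subset fun x hx => ?_
  rw [Metric.mem_thickening_iff_infDist_lt hne]
  exact lt_of_le_of_lt hx (by linarith)

namespace SPSystem

variable {n m l : ℕ} {Sys : SPSystem n m l} {A : Set (Slow n)}
  {H₁ : Slow n → Set (EuclideanSpace ℝ (Fin m))} {β₀ γ₀ θ₀ : ℝ}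

theorem dist_boundedPart_le (x y : State n m l) : dist (boundedPart x) (boundedPart y) ≤ dist x y := by
  have h1 : ‖(x - y).fst‖ ≤ ‖x - y‖ := WithLp.norm_fst_le _ _
  have h2 : ‖(x - y).snd‖ ≤ ‖x - y‖ := WithLp.norm_snd_le _ _
  have h3 : ‖(x - y).snd.fst‖ ≤ ‖(x - y).snd‖ := WithLp.norm_fst_le _ _
  rw [Prod.dist_eq, dist_eq_norm, dist_eq_norm, dist_eq_norm]
  exact max_le h1 (h3.trans h2)

/-- Only the bounded components move and `x₂''` is kept. The factor `2` is a crude form of `√2`,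
from the maximum metric on pairs to the Euclidean one. -/
theorem dist_toLp_le (x : State n m l) (p : Slow n × EuclideanSpace ℝ (Fin m)) :
    dist x (WithLp.toLp 2 (p.1, WithLp.toLp 2 (p.2, x.snd.snd))) ≤ 2 * dist (boundedPart x) p := by
  have h1 : dist x.fst p.1 ≤ dist (boundedPart x) p := le_max_left _ _
  have h2 : dist x.snd.fst p.2 ≤ dist (boundedPart x) p := le_max_right _ _
  have h3 : dist x.snd (WithLp.toLp 2 (p.2, x.snd.snd)) = dist x.snd.fst p.2 := by
    rw [WithLp.prod_dist_eq_of_L2]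
    simp [Real.sqrt_sq dist_nonneg]
  have h0 : 0 ≤ dist (boundedPart x) p := dist_nonneg
  rw [WithLp.prod_dist_eq_of_L2]
  refine Real.sqrt_le_iff.2 ⟨by positivity, ?_⟩
  change dist x.fst p.1 ^ 2 + dist x.snd (WithLp.toLp 2 (p.2, x.snd.snd)) ^ 2 ≤ _
  rw [h3]
  have h4 : dist x.fst p.1 ^ 2 ≤ dist (boundedPart x) p ^ 2 := by gcongr
  have h5 : dist x.snd.fst p.2 ^ 2 ≤ dist (boundedPart x) p ^ 2 := by gcongr
  nlinarith

/-- The graph of `H₁` over `K`. -/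
def equilibriumGraph (H₁ : Slow n → Set (EuclideanSpace ℝ (Fin m))) (K : Set (Slow n)) :
    Set (Slow n × EuclideanSpace ℝ (Fin m)) := {p | p.1 ∈ K ∧ p.2 ∈ H₁ p.1}

/-- The assumptions on the system other than those on the Lyapunov functions and on the
regularity of the jumps. -/
structure Standing (Sys : SPSystem n m l) (A : Set (Slow n))
    (H₁ : Slow n → Set (EuclideanSpace ℝ (Fin m))) (β₀ γ₀ θ₀ : ℝ) : Prop where
  isCompact : IsCompact A
  nonempty : A.Nonempty
  subset : A ⊆ Sys.X₁
  basic : Sys.BasicAssumptions β₀ γ₀ θ₀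
  steady : Sys.SteadyStateAssumptions H₁ β₀ γ₀ θ₀
  invariant : Sys.JumpInvarianceAssumption A H₁ β₀ γ₀ θ₀

namespace Standing

theorem D_subset_C (h : Standing Sys A H₁ β₀ γ₀ θ₀) : Sys.D ⊆ Sys.C :=
  fun _ hx => ⟨h.basic.D₁_subset hx.1, h.basic.D₂_subset hx.2⟩

theorem exists_mem_C (h : Standing Sys A H₁ β₀ γ₀ θ₀) :
    ∃ x : State n m l, x ∈ Sys.attractor A H₁ ∧ x ∈ Sys.C := by
  obtain ⟨x₁, hx₁⟩ := h.nonempty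
  obtain ⟨x₂, hx₂⟩ := h.steady.nonempty x₁ (h.subset hx₁)
  exact ⟨WithLp.toLp 2 (x₁, x₂), ⟨hx₁, hx₂⟩, h.subset hx₁, h.steady.subset x₁ (h.subset hx₁) hx₂⟩

theorem isClosed_X₁ (h : Standing Sys A H₁ β₀ γ₀ θ₀) : IsClosed Sys.X₁ := by
  obtain ⟨x, -, hx⟩ := h.exists_mem_C
  have hc : Continuous fun y : Slow n => (WithLp.toLp 2 (y, x.snd) : State n m l) := by fun_prop
  have : Sys.X₁ = (fun y : Slow n => (WithLp.toLp 2 (y, x.snd) : State n m l)) ⁻¹' Sys.C :=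
    Set.ext fun y => ⟨fun hy => ⟨hy, hx.2⟩, fun hy => hy.1⟩
  rw [this]
  exact h.basic.isClosed_flowSet.preimage hc

theorem isClosed_X₂' (h : Standing Sys A H₁ β₀ γ₀ θ₀) : IsClosed Sys.X₂' := by
  obtain ⟨x, -, hx⟩ := h.exists_mem_C
  have hc : Continuous fun y : EuclideanSpace ℝ (Fin m) =>
    (WithLp.toLp 2 (x.fst, WithLp.toLp 2 (y, x.snd.snd)) : State n m l) := by fun_prop
  have : Sys.X₂' = (fun y : EuclideanSpace ℝ (Fin m) =>
      (WithLp.toLp 2 (x.fst, WithLp.toLp 2 (y, x.snd.snd)) : State n m l)) ⁻¹' Sys.C :=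
    Set.ext fun y => ⟨fun hy => ⟨hx.1, hy, hx.2.2⟩, fun hy => hy.2.1⟩
  rw [this]
  exact h.basic.isClosed_flowSet.preimage hc

theorem isCompact_tube (h : Standing Sys A H₁ β₀ γ₀ θ₀) (ρ : ℝ) : IsCompact (Sys.tube A ρ) :=
  (isCompact_infDist_le h.isCompact h.nonempty ρ).inter_left h.isClosed_X₁

theorem subset_tube (h : Standing Sys A H₁ β₀ γ₀ θ₀) {ρ : ℝ} (hρ : 0 ≤ ρ) : A ⊆ Sys.tube A ρ :=
  fun x hx => ⟨h.subset hx, by rw [Metric.infDist_zero_of_mem hx]; exact hρ⟩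

theorem isCompact_equilibriumGraph (h : Standing Sys A H₁ β₀ γ₀ θ₀) {K : Set (Slow n)}
    (hK : IsCompact K) (hKX : K ⊆ Sys.X₁) : IsCompact (equilibriumGraph H₁ K) :=
  isCompact_graph h.steady.outerSemicont h.steady.locallyBounded hK hKX

theorem equilibriumGraph_nonempty (h : Standing Sys A H₁ β₀ γ₀ θ₀) {K : Set (Slow n)}
    (hAK : A ⊆ K) : (equilibriumGraph H₁ K).Nonempty := by
  obtain ⟨x, hx, -⟩ := h.exists_mem_C
  exact ⟨boundedPart x, hAK hx.1, hx.2.1⟩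

theorem attractor_nonempty (h : Standing Sys A H₁ β₀ γ₀ θ₀) :
    (Sys.attractor A H₁).Nonempty := by
  obtain ⟨x, hx, -⟩ := h.exists_mem_C
  exact ⟨x, hx⟩

/-- The distance to a set of steady states is comparable with the distance of the bounded
components to the graph of `H₁`. -/
theorem infDist_graph_le {K : Set (Slow n)} {M : Set (State n m l)} (hne : M.Nonempty)
    (hM : ∀ x ∈ M, x.fst ∈ K ∧ x.snd ∈ Sys.H H₁ x.fst) (x : State n m l) :
    Metric.infDist (boundedPart x) (equilibriumGraph H₁ K) ≤ Metric.infDist x M := by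
  refine (Metric.le_infDist hne).2 fun {y} hy => ?_
  have h1 : boundedPart y ∈ equilibriumGraph H₁ K := ⟨(hM y hy).1, (hM y hy).2.1⟩
  exact (Metric.infDist_le_dist_of_mem h1).trans (dist_boundedPart_le x y)

/-- `H` leaves `x₂''` free in `X₂''`, so a point of the graph can be completed by the `x₂''` of the
state. Distances to possibly unbounded sets of steady states are thereby controlled by distances to
a graph that is compact for compact `K ⊆ X₁`. -/
theorem infDist_le_two_mul {K : Set (Slow n)} {M : Set (State n m l)}
    (hne : (equilibriumGraph H₁ K).Nonempty)
    (hM : ∀ x : State n m l, x.fst ∈ K → x.snd ∈ Sys.H H₁ x.fst → x ∈ M) {x : State n m l}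
    (hx : x.snd.snd ∈ Sys.X₂'') :
    Metric.infDist x M ≤ 2 * Metric.infDist (boundedPart x) (equilibriumGraph H₁ K) := by
  have : Metric.infDist x M / 2 ≤ Metric.infDist (boundedPart x) (equilibriumGraph H₁ K) := by
    refine (Metric.le_infDist hne).2 fun {p} hp => ?_
    have h1 : (WithLp.toLp 2 (p.1, WithLp.toLp 2 (p.2, x.snd.snd)) : State n m l) ∈ M :=
      hM _ hp.1 (And.intro hp.2 hx)
    have := (Metric.infDist_le_dist_of_mem h1).trans (dist_toLp_le x p)
    linarith
  linarith

theorem infDist_attractor_le_two_mul (h : Standing Sys A H₁ β₀ γ₀ θ₀) {x : State n m l}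
    (hx : x.snd.snd ∈ Sys.X₂'') : Metric.infDist x (Sys.attractor A H₁) ≤
      2 * Metric.infDist (boundedPart x) (equilibriumGraph H₁ A) :=
  infDist_le_two_mul (h.equilibriumGraph_nonempty (subset_refl A)) (fun _ h1 h2 => And.intro h1 h2) hx

theorem infDist_graph_le_attractor (h : Standing Sys A H₁ β₀ γ₀ θ₀) (x : State n m l) :
    Metric.infDist (boundedPart x) (equilibriumGraph H₁ A) ≤
      Metric.infDist x (Sys.attractor A H₁) :=
  infDist_graph_le h.attractor_nonempty (fun _ h1 => h1) x

theorem attractor_subset_manifold (h : Standing Sys A H₁ β₀ γ₀ θ₀) {ρ : ℝ} (hρ : 0 ≤ ρ) :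
    Sys.attractor A H₁ ⊆ Sys.manifold A H₁ ρ := fun _ hx => ⟨h.subset_tube hρ hx.1, hx.2⟩

theorem infDist_graph_le_manifold (h : Standing Sys A H₁ β₀ γ₀ θ₀) {ρ : ℝ} (hρ : 0 ≤ ρ)
    (x : State n m l) : Metric.infDist (boundedPart x) (equilibriumGraph H₁ (Sys.tube A ρ)) ≤
      Metric.infDist x (Sys.manifold A H₁ ρ) :=
  infDist_graph_le (h.attractor_nonempty.mono (h.attractor_subset_manifold hρ)) (fun _ h1 => h1) x

theorem infDist_manifold_le (h : Standing Sys A H₁ β₀ γ₀ θ₀) {ρ : ℝ} (hρ : 0 ≤ ρ)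
    (x : State n m l) : Metric.infDist x (Sys.manifold A H₁ ρ) ≤
      Metric.infDist x (Sys.attractor A H₁) :=
  Metric.infDist_le_infDist_of_subset (h.attractor_subset_manifold hρ) h.attractor_nonempty

theorem infDist_fst_le (h : Standing Sys A H₁ β₀ γ₀ θ₀) (x : State n m l) :
    Metric.infDist x.fst A ≤ Metric.infDist x (Sys.attractor A H₁) := by
  refine (Metric.le_infDist h.attractor_nonempty).2 fun {y} hy => ?_
  refine (Metric.infDist_le_dist_of_mem hy.1).trans ?_
  exact (le_max_left _ _).trans (dist_boundedPart_le x y)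

theorem isCompact_near_graph (h : Standing Sys A H₁ β₀ γ₀ θ₀) {ρ : ℝ} (hρ : 0 ≤ ρ) (r : ℝ) :
    IsCompact {p | Metric.infDist p (equilibriumGraph H₁ (Sys.tube A ρ)) ≤ r} :=
  isCompact_infDist_le (h.isCompact_equilibriumGraph (h.isCompact_tube ρ) fun _ hx => hx.1)
    (h.equilibriumGraph_nonempty (h.subset_tube hρ)) r

theorem isCompact_near_graph_attractor (h : Standing Sys A H₁ β₀ γ₀ θ₀) (r : ℝ) :
    IsCompact {p | Metric.infDist p (equilibriumGraph H₁ A) ≤ r} :=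
  isCompact_infDist_le (h.isCompact_equilibriumGraph h.isCompact h.subset)
    (h.equilibriumGraph_nonempty subset_rfl) r

/-- A state is close to the attractor if its slow component is close to `A` and it is close to
the boundary layer manifold. -/
theorem exists_infDist_attractor_le (h : Standing Sys A H₁ β₀ γ₀ θ₀) {ρ ν : ℝ} (hρ : 0 ≤ ρ)
    (hν : 0 < ν) : ∃ η > 0, ∀ x ∈ Sys.C, Metric.infDist x.fst A ≤ η →
      Metric.infDist x (Sys.manifold A H₁ ρ) ≤ η → Metric.infDist x (Sys.attractor A H₁) ≤ ν := by
  obtain ⟨η, hη, hlt⟩ := IsCompact.exists_pos_forall_le (h.isCompact_near_graph hρ 1)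
    (f := fun p => max (Metric.infDist p.1 A)
      (Metric.infDist p (equilibriumGraph H₁ (Sys.tube A ρ))))
    (g := fun p => 2 * Metric.infDist p (equilibriumGraph H₁ A) - ν)
    (((Metric.continuous_infDist_pt A).comp continuous_fst).max (Metric.continuous_infDist_pt _))
    ((continuous_const.mul (Metric.continuous_infDist_pt _)).sub continuous_const) (by
      intro p _ hp
      obtain ⟨h1, h2⟩ := max_le_iff.1 hp
      have hpA : p.1 ∈ A := (h.isCompact.isClosed.mem_iff_infDist_zero h.nonempty).2
        (le_antisymm h1 Metric.infDist_nonneg)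
      have hpg : p ∈ equilibriumGraph H₁ (Sys.tube A ρ) :=
        ((h.isCompact_equilibriumGraph (h.isCompact_tube ρ) fun _ hx => hx.1).isClosed.mem_iff_infDist_zero
          (h.equilibriumGraph_nonempty (h.subset_tube hρ))).2 (le_antisymm h2 Metric.infDist_nonneg)
      have : p ∈ equilibriumGraph H₁ A := ⟨hpA, hpg.2⟩
      rw [Metric.infDist_zero_of_mem this]
      linarith)
  refine ⟨min η 1, lt_min hη one_pos, fun x hx h1 h2 => ?_⟩
  have h3 := (h.infDist_graph_le_manifold hρ x).trans h2
  have := hlt (boundedPart x) (h3.trans (min_le_right _ _))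
    (max_le (h1.trans (min_le_left _ _)) (h3.trans (min_le_left _ _)))
  linarith [h.infDist_attractor_le_two_mul hx.2.2]

theorem exists_infDist_attractor_le_of_isBounded (h : Standing Sys A H₁ β₀ γ₀ θ₀)
    {B : Set (Slow n × EuclideanSpace ℝ (Fin m))} (hB : Bornology.IsBounded B) :
    ∃ R, ∀ x ∈ Sys.C, boundedPart x ∈ B → Metric.infDist x (Sys.attractor A H₁) ≤ R := by
  obtain ⟨p₀, hp₀⟩ := h.equilibriumGraph_nonempty (subset_refl A)
  obtain ⟨R, hR⟩ := hB.subset_closedBall p₀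
  refine ⟨2 * R, fun x hx hxB => (h.infDist_attractor_le_two_mul hx.2.2).trans ?_⟩
  have h1 := Metric.infDist_le_dist_of_mem (x := boundedPart x) hp₀
  have h2 : dist (boundedPart x) p₀ ≤ R := hR hxB
  linarith

theorem exists_infDist_attractor_le_of_manifold (h : Standing Sys A H₁ β₀ γ₀ θ₀) {ρ : ℝ}
    (hρ : 0 ≤ ρ) (r : ℝ) : ∃ R, ∀ x ∈ Sys.C, Metric.infDist x (Sys.manifold A H₁ ρ) ≤ r →
      Metric.infDist x (Sys.attractor A H₁) ≤ R := by
  obtain ⟨R, hR⟩ := h.exists_infDist_attractor_le_of_isBounded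
    (h.isCompact_near_graph hρ r).isBounded
  exact ⟨R, fun x hx hxr => hR x hx ((h.infDist_graph_le_manifold hρ x).trans hxr)⟩

/-! ### The jump map near compact sets -/

/-- `G₁` is jointly locally bounded on a compact set that includes the limit values of the
parameters, so `R'` does not depend on them. This is what the induction over irregular jumps needs.
-/
theorem exists_jump_bound (h : Standing Sys A H₁ β₀ γ₀ θ₀) (R : ℝ) :
    ∃ R', ∀ β ∈ Icc 0 β₀, ∀ γ ∈ Icc 0 γ₀, ∀ θ ∈ Icc 0 θ₀, ∀ x ∈ Sys.D,
      Metric.infDist x (Sys.attractor A H₁) ≤ R → ∀ g ∈ Sys.G β γ θ x,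
        Metric.infDist g (Sys.attractor A H₁) ≤ R' := by
  have hK : IsCompact ((Icc 0 β₀ ×ˢ (Icc 0 γ₀ ×ˢ Icc 0 θ₀)) ×ˢ
      ({p | Metric.infDist p (equilibriumGraph H₁ A) ≤ R} ∩ Sys.D')) :=
    (isCompact_Icc.prod (isCompact_Icc.prod isCompact_Icc)).prod
      ((h.isCompact_near_graph_attractor R).inter_right h.basic.isClosed_D')
  obtain ⟨R', hR'⟩ := h.exists_infDist_attractor_le_of_isBounded
    (h.basic.G₁_regular.2.isBounded_iUnion hK (prod_mono subset_rfl inter_subset_right))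
  refine ⟨R', fun β hβ γ hγ θ hθ x hx hxR g hg => hR' g ?_ ?_⟩
  · exact ((h.basic.jumpMap β hβ γ hγ θ hθ).2.2 x hx).2 hg
  · exact mem_biUnion (x := ((β, γ, θ), boundedPart x))
      ⟨⟨hβ, hγ, hθ⟩, (h.infDist_graph_le_attractor x).trans hxR, mem_image_of_mem _ hx⟩ hg.1

/-- `G` is a product with nonempty values, so a value of `G₁` can be completed by the last component
of any value of `G`. -/
theorem mem_G_of_mem_G₁ (h : Standing Sys A H₁ β₀ γ₀ θ₀) {β γ θ : ℝ} (hβ : β ∈ Icc 0 β₀)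
    (hγ : γ ∈ Icc 0 γ₀) (hθ : θ ∈ Icc 0 θ₀) {x : State n m l} (hx : x ∈ Sys.D)
    {p : Slow n × EuclideanSpace ℝ (Fin m)} (hp : p ∈ Sys.G₁ β γ θ (boundedPart x)) :
    ∃ g ∈ Sys.G β γ θ x, boundedPart g = p := by
  obtain ⟨g, hg⟩ := ((h.basic.jumpMap β hβ γ hγ θ hθ).2.2 x hx).1
  exact ⟨WithLp.toLp 2 (p.1, WithLp.toLp 2 (p.2, g.snd.snd)), ⟨hp, hg.2⟩, rfl⟩

/-- On the attractor itself this is jump invariance; compactness in the state and in the closed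
parameter box extends it to a neighbourhood, uniformly. -/
theorem exists_jump_near (h : Standing Sys A H₁ β₀ γ₀ θ₀) {ν : ℝ} (hν : 0 < ν) :
    ∃ η > 0, ∀ β ∈ Icc 0 β₀, ∀ γ ∈ Icc 0 γ₀, ∀ θ ∈ Icc 0 θ₀, ∀ x ∈ Sys.D,
      Metric.infDist x (Sys.attractor A H₁) ≤ η → ∀ g ∈ Sys.G β γ θ x,
        Metric.infDist g (Sys.attractor A H₁) ≤ ν := by
  have hK : IsCompact ((Icc 0 β₀ ×ˢ (Icc 0 γ₀ ×ˢ Icc 0 θ₀)) ×ˢ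
      ({p | Metric.infDist p (equilibriumGraph H₁ A) ≤ 1} ∩ Sys.D')) :=
    (isCompact_Icc.prod (isCompact_Icc.prod isCompact_Icc)).prod
      ((h.isCompact_near_graph_attractor 1).inter_right h.basic.isClosed_D')
  obtain ⟨η, hη, hlt⟩ := exists_pos_forall_of_outerSemicontOn h.basic.G₁_regular.1
    h.basic.G₁_regular.2 hK (prod_mono subset_rfl inter_subset_right)
    (f := fun p => Metric.infDist p.2 (equilibriumGraph H₁ A))
    (h := fun p => 2 * Metric.infDist p.2 (equilibriumGraph H₁ A) - ν)
    ((Metric.continuous_infDist_pt _).comp continuous_snd)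
    ((continuous_const.mul ((Metric.continuous_infDist_pt _).comp continuous_snd)).sub
      continuous_const) (by
      rintro ⟨⟨β, γ, θ⟩, p⟩ ⟨⟨hβ, hγ, hθ⟩, -, x, hx, rfl⟩ hp g' hg'
      have hpg : boundedPart x ∈ equilibriumGraph H₁ A :=
        ((h.isCompact_equilibriumGraph h.isCompact h.subset).isClosed.mem_iff_infDist_zero
          (h.equilibriumGraph_nonempty subset_rfl)).2 (le_antisymm hp Metric.infDist_nonneg)
      obtain ⟨g, hg, rfl⟩ := h.mem_G_of_mem_G₁ hβ hγ hθ hx hg'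
      have hgA := h.invariant β hβ γ hγ θ hθ x
        ⟨⟨hpg.1, hpg.2, (h.basic.D₂_subset hx.2).2⟩, hx⟩ hg
      have : boundedPart g ∈ equilibriumGraph H₁ A := ⟨hgA.1, hgA.2.1⟩
      simp only [Metric.infDist_zero_of_mem this]
      linarith)
  refine ⟨min η 1, lt_min hη one_pos, fun β hβ γ hγ θ hθ x hx hxη g hg => ?_⟩
  have h1 := (h.infDist_graph_le_attractor x).trans hxη
  have h2 := hlt ((β, γ, θ), boundedPart x)
    ⟨⟨hβ, hγ, hθ⟩, h1.trans (min_le_right _ _), mem_image_of_mem _ hx⟩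
    (h1.trans (min_le_left _ _)) (boundedPart g) hg.1
  have h3 := ((h.basic.jumpMap β hβ γ hγ θ hθ).2.2 x hx).2 hg
  simp only at h2
  linarith [h.infDist_attractor_le_two_mul h3.2.2]

/-! ### The slow dynamics near the boundary layer manifold -/

theorem mem_slowVelocities {β γ θ : ℝ} {x f : State n m l} (hx : x ∈ Sys.C)
    (hf : f ∈ Sys.F β γ θ x) : f.fst ∈ Sys.slowVelocities γ θ (β, boundedPart x) :=
  ⟨x, hx, rfl, f, hf, rfl⟩

theorem mem_near_graph_inter (h : Standing Sys A H₁ β₀ γ₀ θ₀) {ρ r : ℝ} (hρ : 0 ≤ ρ)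
    {x : State n m l} (hx : x ∈ Sys.C) (hxr : Metric.infDist x (Sys.manifold A H₁ ρ) ≤ r) :
    boundedPart x ∈ {p | Metric.infDist p (equilibriumGraph H₁ (Sys.tube A ρ)) ≤ r} ∩
      (Sys.X₁ ×ˢ Sys.X₂') :=
  ⟨(h.infDist_graph_le_manifold hρ x).trans hxr, hx.1, hx.2.1⟩

theorem isCompact_near_graph_inter (h : Standing Sys A H₁ β₀ γ₀ θ₀) {ρ : ℝ} (hρ : 0 ≤ ρ)
    (r : ℝ) : IsCompact ({p | Metric.infDist p (equilibriumGraph H₁ (Sys.tube A ρ)) ≤ r} ∩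
      (Sys.X₁ ×ˢ Sys.X₂')) :=
  (h.isCompact_near_graph hρ r).inter_right (h.isClosed_X₁.prod h.isClosed_X₂')

/-- The bound is uniform over the closed interval of `β`, so that `ε` may be chosen in terms of `L`
before `β`. -/
theorem exists_slow_bound (h : Standing Sys A H₁ β₀ γ₀ θ₀) {γ θ : ℝ} (hγ : γ ∈ Ioc 0 γ₀)
    (hθ : θ ∈ Ioc 0 θ₀) {ρ : ℝ} (hρ : 0 ≤ ρ) (r : ℝ) :
    ∃ L > 0, ∀ β ∈ Icc 0 β₀, ∀ x ∈ Sys.C, Metric.infDist x (Sys.manifold A H₁ ρ) ≤ r →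
      ∀ f ∈ Sys.F β γ θ x, ‖f.fst‖ ≤ L := by
  obtain ⟨L, hL, hb⟩ := ((h.basic.slowVelocities_regular γ hγ θ hθ).2.isBounded_iUnion
    ((isCompact_Icc (a := (0 : ℝ)) (b := β₀)).prod (h.isCompact_near_graph_inter hρ r))
    (prod_mono subset_rfl inter_subset_right)).exists_pos_norm_le
  exact ⟨L, hL, fun β hβ x hx hxr f hf => hb _ (mem_biUnion (x := (β, boundedPart x))
    ⟨hβ, h.mem_near_graph_inter hρ hx hxr⟩ (mem_slowVelocities hx hf))⟩

theorem isCompact_annulus (h : Standing Sys A H₁ β₀ γ₀ θ₀) {ρ : ℝ} (hρ : 0 ≤ ρ) (μ r : ℝ) :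
    IsCompact (({p | Metric.infDist p (equilibriumGraph H₁ (Sys.tube A ρ)) ≤ 1} ∩
      (Sys.X₁ ×ˢ Sys.X₂')) ∩ {p | Metric.infDist p.1 A ∈ Icc μ r}) :=
  (h.isCompact_near_graph_inter hρ 1).inter_right
    (isClosed_Icc.preimage ((Metric.continuous_infDist_pt A).comp continuous_fst))

theorem mem_equilibriumGraph_of_infDist_le (h : Standing Sys A H₁ β₀ γ₀ θ₀) {ρ : ℝ} (hρ : 0 ≤ ρ)
    {p : Slow n × EuclideanSpace ℝ (Fin m)}
    (hp : Metric.infDist p (equilibriumGraph H₁ (Sys.tube A ρ)) ≤ 0) :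
    p ∈ equilibriumGraph H₁ (Sys.tube A ρ) :=
  ((h.isCompact_equilibriumGraph (h.isCompact_tube ρ) fun _ hx => hx.1).isClosed.mem_iff_infDist_zero
    (h.equilibriumGraph_nonempty (h.subset_tube hρ))).2 (le_antisymm hp Metric.infDist_nonneg)

/-- A decrease of `V` along the reduced flow persists near the boundary layer manifold. -/
theorem exists_flow_decrease (h : Standing Sys A H₁ β₀ γ₀ θ₀) {γ θ : ℝ} (hγ : γ ∈ Ioc 0 γ₀)
    (hθ : θ ∈ Ioc 0 θ₀) {ρ μ r c : ℝ} (hρ : 0 ≤ ρ) (hc : 0 < c) {V : Slow n → ℝ}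
    (hV : ContDiff ℝ 1 V)
    (hdec : ∀ β ∈ Icc 0 β₀, ∀ x₁ ∈ Sys.X₁, μ ≤ Metric.infDist x₁ A → Metric.infDist x₁ A ≤ r →
      ∀ f₁ ∈ Sys.Fr H₁ β γ θ x₁, fderiv ℝ V x₁ f₁ ≤ -c) :
    ∃ η > 0, ∀ β ∈ Icc 0 β₀, ∀ x ∈ Sys.C, μ ≤ Metric.infDist x.fst A →
      Metric.infDist x.fst A ≤ r → Metric.infDist x (Sys.manifold A H₁ ρ) ≤ η →
      ∀ f ∈ Sys.F β γ θ x, fderiv ℝ V x.fst f.fst ≤ -(c / 2) := by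
  have hreg := h.basic.slowVelocities_regular γ hγ θ hθ
  obtain ⟨η, hη, hlt⟩ := exists_pos_forall_of_outerSemicontOn hreg.1 hreg.2
    ((isCompact_Icc (a := (0 : ℝ)) (b := β₀)).prod (h.isCompact_annulus hρ μ r))
    (prod_mono subset_rfl (inter_subset_left.trans inter_subset_right))
    (f := fun p => Metric.infDist p.2 (equilibriumGraph H₁ (Sys.tube A ρ)))
    (h := fun q => fderiv ℝ V q.1.2.1 q.2 + c / 2)
    ((Metric.continuous_infDist_pt _).comp continuous_snd)
    (by
      have h1 := hV.continuous_fderiv_apply (by simp)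
      have h2 : Continuous fun q : (ℝ × (Slow n × EuclideanSpace ℝ (Fin m))) × Slow n =>
        (q.1.2.1, q.2) := by fun_prop
      exact (h1.comp h2).add continuous_const) (by
      -- At distance zero `p` lies on the graph of `H₁`. Whatever `x₂''` realizes the velocity, the
      -- state is then a steady state and the velocity belongs to `Fr`.
      rintro ⟨β, p⟩ ⟨hβ, ⟨-, hpX⟩, hμr⟩ hp f₁ ⟨x, hx, hxp, f, hf, rfl⟩
      have hpg := h.mem_equilibriumGraph_of_infDist_le hρ hp
      simp only at hxp hpX hμr
      subst hxp
      have := hdec β hβ x.fst hx.1 hμr.1 hμr.2 f.fst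
        (subset_closedConvexHull ⟨x.snd, ⟨hpg.2, hx.2.2⟩, f, hf, rfl⟩)
      simp only [boundedPart]
      linarith)
  refine ⟨min η 1, lt_min hη one_pos, fun β hβ x hx hμ hr hxη f hf => ?_⟩
  have h1 := (h.infDist_graph_le_manifold hρ x).trans hxη
  have h2 := hlt (β, boundedPart x)
    ⟨hβ, h.mem_near_graph_inter hρ hx (hxη.trans (min_le_right _ _)), hμ, hr⟩
    (h1.trans (min_le_left _ _)) f.fst (mem_slowVelocities hx hf)
  simp only [boundedPart] at h2
  linarith

/-- A decrease of `V` along the reduced jumps persists near the boundary layer manifold. -/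
theorem exists_jump_decrease (h : Standing Sys A H₁ β₀ γ₀ θ₀) {γ θ : ℝ} (hγ : γ ∈ Ioc 0 γ₀)
    (hθ : θ ∈ Ioc 0 θ₀) {ρ μ r c : ℝ} (hρ : 0 ≤ ρ) (hc : 0 < c) {V : Slow n → ℝ}
    (hV : Continuous V)
    (hdec : ∀ β ∈ Icc 0 β₀, ∀ x₁ ∈ Sys.X₁, μ ≤ Metric.infDist x₁ A → Metric.infDist x₁ A ≤ r →
      x₁ ∈ Sys.D₁ → ∀ g₁ ∈ Sys.Gr H₁ β γ θ x₁, V g₁ - V x₁ ≤ -c) :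
    ∃ η > 0, ∀ β ∈ Icc 0 β₀, ∀ x ∈ Sys.D, μ ≤ Metric.infDist x.fst A →
      Metric.infDist x.fst A ≤ r → Metric.infDist x (Sys.manifold A H₁ ρ) ≤ η →
      ∀ g ∈ Sys.G β γ θ x, V g.fst - V x.fst ≤ -(c / 2) := by
  have hγ' : γ ∈ Icc 0 γ₀ := Ioc_subset_Icc_self hγ
  have hθ' : θ ∈ Icc 0 θ₀ := Ioc_subset_Icc_self hθ
  -- The decrease is available only at the given `γ` and `θ`, which are frozen; `β` ranges over a
  -- compact interval, so `η` does not depend on it.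
  have hK : IsCompact ((Icc 0 β₀ ×ˢ (({γ} : Set ℝ) ×ˢ ({θ} : Set ℝ))) ×ˢ
      ((({p | Metric.infDist p (equilibriumGraph H₁ (Sys.tube A ρ)) ≤ 1} ∩
      (Sys.X₁ ×ˢ Sys.X₂')) ∩ {p | Metric.infDist p.1 A ∈ Icc μ r}) ∩ Sys.D')) :=
    (isCompact_Icc.prod (isCompact_singleton.prod isCompact_singleton)).prod
      ((h.isCompact_annulus hρ μ r).inter_right h.basic.isClosed_D')
  obtain ⟨η, hη, hlt⟩ := exists_pos_forall_of_outerSemicontOn h.basic.G₁_regular.1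
    h.basic.G₁_regular.2 hK
    (prod_mono (prod_mono subset_rfl (prod_mono (singleton_subset_iff.2 hγ')
      (singleton_subset_iff.2 hθ'))) inter_subset_right)
    (f := fun p => Metric.infDist p.2 (equilibriumGraph H₁ (Sys.tube A ρ)))
    (h := fun q => V q.2.1 - V q.1.2.1 + c / 2)
    ((Metric.continuous_infDist_pt _).comp continuous_snd) (by fun_prop) (by
      rintro ⟨⟨β, γ', θ'⟩, p⟩ ⟨⟨hβ, hγe, hθe⟩, ⟨-, hμr⟩, x, hx, rfl⟩ hp g' hg'
      obtain rfl : γ' = γ := hγe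
      obtain rfl : θ' = θ := hθe
      have hpg := h.mem_equilibriumGraph_of_infDist_le hρ hp
      obtain ⟨g, hg, rfl⟩ := h.mem_G_of_mem_G₁ hβ hγ' hθ' hx hg'
      have := hdec β hβ x.fst (h.basic.D₁_subset hx.1) hμr.1 hμr.2 hx.1 g.fst
        ⟨x.snd, ⟨hpg.2, (h.basic.D₂_subset hx.2).2⟩, hx, g, hg, rfl⟩
      simp only [boundedPart]
      linarith)
  refine ⟨min η 1, lt_min hη one_pos, fun β hβ x hx hμ hr hxη g hg => ?_⟩
  have h1 := (h.infDist_graph_le_manifold hρ x).trans hxη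
  have h2 := hlt ((β, γ, θ), boundedPart x)
    ⟨⟨hβ, rfl, rfl⟩, ⟨h.mem_near_graph_inter hρ (h.D_subset_C hx) (hxη.trans (min_le_right _ _)),
      hμ, hr⟩, mem_image_of_mem _ hx⟩ (h1.trans (min_le_left _ _)) (boundedPart g) hg.1
  simp only [boundedPart] at h2
  linarith

end Standing

end SPSystem

/-! ### Arcs with regular jumps -/

/-- Along an arc without short levels, a fast function `v₂` falls below `ℓ₂` in every level, and a
slow function `v₁` decreases at rate `c` down to the level `v`, up to an error `ν`. -/
theorem IsArc.two_scale_bound {E : Type*} [NormedAddCommGroup E] [NormedSpace ℝ E]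
    {ℋ : HybridSystem E} {v₁ v₂ : E → ℝ} (hv₁ : ContDiff ℝ 1 v₁) (hv₂ : ContDiff ℝ 1 v₂)
    {b ν b₂ W ℓ₁ ℓ₂ L c c₂ cJ κ σ v : ℝ} (hL : 0 ≤ L) (hc : 0 ≤ c) (hc₂ : 0 ≤ c₂) (hκ : 0 ≤ κ)
    (hLκ : L * κ < ν) (hν : (c + L) * κ ≤ ν) (hcJ : (c + L) * κ ≤ cJ) (hκσ : κ ≤ σ) (hℓ₁ : ℓ₁ ≤ v)
    (hvb : v ≤ b) (hℓ₂ : ℓ₂ ≤ b₂) (hW : b₂ < W) (hκ₂ : b₂ - c₂ * κ ≤ ℓ₂)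
    (hflow : ∀ x ∈ closure ℋ.flowSet ∪ ℋ.jumpSet, v₁ x ≤ b + ν → v₂ x ≤ W →
      ∀ w ∈ ℋ.flowMap x, fderiv ℝ v₁ x w ≤ L ∧ (ℓ₂ < v₂ x → fderiv ℝ v₂ x w ≤ -c₂) ∧
        (v₂ x ≤ ℓ₂ → ℓ₁ < v₁ x → fderiv ℝ v₁ x w ≤ -c))
    (hjump : ∀ x ∈ ℋ.jumpSet, v₁ x ≤ b + ν → v₂ x ≤ ℓ₂ →
      ∀ g ∈ ℋ.jumpMap x, v₂ g ≤ b₂ ∧ v₁ g ≤ max (v₁ x - cJ) v)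
    {J : ℕ} {t : ℕ → ℝ} {φ : ℝ → ℕ → E} (h : IsArc ℋ J t φ) (hreg : shortLevels J t σ = ∅)
    (h₁ : v₁ (φ (t 0) 0) ≤ b) (h₂ : v₂ (φ (t 0) 0) ≤ b₂) :
    v₂ (φ (t (J + 1)) J) ≤ b₂ ∧ (t J + κ ≤ t (J + 1) → v₂ (φ (t (J + 1)) J) ≤ ℓ₂) ∧
      v₁ (φ (t (J + 1)) J) ≤ max (b - c * (t (J + 1) - t 0)) v + ν := by
  have hw : ∀ j ≤ J, max (b - c * (t j - t 0)) v ≤ b := fun j hj =>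
    max_le (by
      have := mul_nonneg hc (sub_nonneg.2 (h.monotone (Nat.zero_le j) (by omega)))
      linarith) hvb
  -- The decrease starts only after the transient. Charging it from the beginning of the level costs
  -- `c * κ`, and the growth in the transient costs `L * κ`.
  have hlevel : ∀ j ≤ J, v₁ (φ (t j) j) ≤ max (b - c * (t j - t 0)) v → v₂ (φ (t j) j) ≤ b₂ →
      v₂ (φ (t (j + 1)) j) ≤ b₂ ∧ (t j + κ ≤ t (j + 1) → v₂ (φ (t (j + 1)) j) ≤ ℓ₂) ∧
      v₁ (φ (t (j + 1)) j) ≤ max (b - c * (t (j + 1) - t 0)) v + (c + L) * κ := by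
    intro j hj h3 h4
    have hle := h.le j hj
    obtain ⟨h5, h6, h7⟩ := _root_.two_scale_bound (c := c) (c₂ := c₂) (ℓ₁ := ℓ₁) (ν := ν) (W := W)
      (AbsolutelyContinuousOnInterval.comp_contDiff hv₁ (h.absCont j hj))
      (AbsolutelyContinuousOnInterval.comp_contDiff hv₂ (h.absCont j hj)) hL hc hc₂ hκ hLκ
      (hw j hj) (hℓ₁.trans hvb) hℓ₂ hW hκ₂ h3 h4 (by
        filter_upwards [h.flow j hj] with s hs hmem h8 h9
        obtain ⟨w, hw, hd⟩ := hs hmem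
        obtain ⟨h10, h11, h12⟩ := hflow _ (h.mem j hj s (Ioo_subset_Icc_self hmem)) h8 h9 w hw
        exact ⟨_, _, ((hv₁.differentiable (by simp)) _).hasFDerivAt.comp_hasDerivAt s hd,
          ((hv₂.differentiable (by simp)) _).hasFDerivAt.comp_hasDerivAt s hd, h10, h11, h12⟩)
      (t (j + 1)) ⟨hle, le_rfl⟩
    refine ⟨h5, h6, h7.trans ?_⟩
    have h8 : max (max (b - c * (t j - t 0)) v - c * (t (j + 1) - t j - κ)) ℓ₁ ≤
        max (b - c * (t (j + 1) - t 0)) v + c * κ := by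
      have h9 : 0 ≤ c * κ := mul_nonneg hc hκ
      have h10 : 0 ≤ c * (t (j + 1) - t j) := mul_nonneg hc (by linarith)
      have h11 := le_max_left (b - c * (t (j + 1) - t 0)) v
      have h12 := le_max_right (b - c * (t (j + 1) - t 0)) v
      refine max_le ?_ (by linarith)
      rw [sub_le_iff_le_add]
      exact max_le (by nlinarith) (by nlinarith)
    linarith
  -- A level followed by a jump lasts at least `σ ≥ κ`, so `v₂ ≤ ℓ₂` at the jump; its decrease `cJ`
  -- repays the error `(c + L) * κ`, and each level starts without accumulated error.
  have hstart : ∀ j ≤ J, v₁ (φ (t j) j) ≤ max (b - c * (t j - t 0)) v ∧ v₂ (φ (t j) j) ≤ b₂ := by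
    intro j
    induction j with
    | zero => intro _; exact ⟨by simpa using Or.inl h₁, h₂⟩
    | succ j ih =>
      intro hj
      obtain ⟨h3, h4⟩ := ih (by omega)
      obtain ⟨-, h6, h7⟩ := hlevel j (by omega) h3 h4
      have hlong : σ ≤ t (j + 1) - t j := by
        by_contra! hlt
        have : j ∈ shortLevels J t σ := mem_shortLevels.2 ⟨by omega, hlt⟩
        simp [hreg] at this
      obtain ⟨h8, h9⟩ := h.jump j (by omega)
      obtain ⟨h10, h11⟩ := hjump _ h8 (h7.trans (add_le_add (hw (j + 1) hj) hν))
        (h6 (by linarith)) _ h9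
      exact ⟨h11.trans (max_le (by linarith) (le_max_right _ _)), h10⟩
  obtain ⟨h3, h4⟩ := hstart J le_rfl
  obtain ⟨h5, h6, h7⟩ := hlevel J le_rfl h3 h4
  exact ⟨h5, h6, h7.trans (by linarith)⟩

theorem contDiff_comp_fst {α β : Type*} [NormedAddCommGroup α] [NormedSpace ℝ α]
    [NormedAddCommGroup β] [NormedSpace ℝ β] {V : α → ℝ} (hV : ContDiff ℝ 1 V) :
    ContDiff ℝ 1 fun x : WithLp 2 (α × β) => V x.fst :=
  hV.comp (WithLp.fstL 2 ℝ α β).contDiff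

theorem fderiv_comp_fst {α β : Type*} [NormedAddCommGroup α] [NormedSpace ℝ α]
    [NormedAddCommGroup β] [NormedSpace ℝ β] {V : α → ℝ} (hV : Differentiable ℝ V)
    (x w : WithLp 2 (α × β)) :
    fderiv ℝ (fun x : WithLp 2 (α × β) => V x.fst) x w = fderiv ℝ V x.fst w.fst := by
  have h0 : HasFDerivAt (fun x : WithLp 2 (α × β) => x.fst) (WithLp.fstL 2 ℝ α β) x :=
    (WithLp.fstL 2 ℝ α β).hasFDerivAt
  have h1 := (hV x.fst).hasFDerivAt.comp x h0
  have h2 : fderiv ℝ (fun x : WithLp 2 (α × β) => V x.fst) x = _ := h1.fderiv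
  rw [h2]
  rfl

/-! ### Lyapunov estimates along arcs without short levels -/

namespace SPSystem

variable {n m l : ℕ} {Sys : SPSystem n m l} {A : Set (Slow n)}
  {H₁ : Slow n → Set (EuclideanSpace ℝ (Fin m))} {β₀ γ₀ θ₀ : ℝ}

/-- Lyapunov functions for the boundary layer system with bounds `a` and `a'`. -/
def LayerLyapunov (Sys : SPSystem n m l) (A : Set (Slow n))
    (H₁ : Slow n → Set (EuclideanSpace ℝ (Fin m))) (β₀ γ₀ θ₀ ρ : ℝ) (a a' : ℝ → ℝ) : Prop :=
  ∀ Δ > 0, ∃ (V : State n m l → ℝ) (α αβ : ℝ → ℝ),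
    ContDiff ℝ 1 V ∧ IsClassK α ∧ IsClassK αβ ∧
    (∀ x : State n m l, x.fst ∈ Sys.tube A ρ → x.snd ∈ Sys.X₂ →
      a (Metric.infDist x (Sys.manifold A H₁ ρ)) ≤ V x ∧
      V x ≤ a' (Metric.infDist x (Sys.manifold A H₁ ρ))) ∧
    (∀ β ∈ Ioc 0 β₀, ∀ γ ∈ Ioc 0 γ₀, ∀ θ ∈ Ioc 0 θ₀,
      ∀ x : State n m l, x.fst ∈ Sys.tube A ρ → x.snd ∈ Sys.X₂ →
      Metric.infDist x (Sys.manifold A H₁ ρ) ≤ Δ → ∀ f ∈ Sys.F β γ θ x,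
      αβ β ≤ Metric.infDist x (Sys.manifold A H₁ ρ) →
        fderiv ℝ V x (WithLp.toLp 2 (0, f.snd)) ≤ -α (Metric.infDist x (Sys.manifold A H₁ ρ))) ∧
    (∀ K : Set (Slow n × EuclideanSpace ℝ (Fin m)), IsCompact K →
      K ⊆ Sys.tube A ρ ×ˢ Sys.X₂' → ∃ M > 0, ∀ x : State n m l, boundedPart x ∈ K →
        x.snd.snd ∈ Sys.X₂'' → ∀ f : Slow n, fderiv ℝ V x (WithLp.toLp 2 (f, 0)) ≤ M * ‖f‖)

/-- The bounds `a` and `a'` are shared by the functions for all `Δ`. Sublevels and radii can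
therefore be fixed before the function that is valid up to that radius is chosen. -/
theorem BoundaryLayerAssumption.exists_layerLyapunov
    (h : Sys.BoundaryLayerAssumption A H₁ β₀ γ₀ θ₀) {ρ : ℝ} (hρ : 0 < ρ) :
    ∃ a a', IsClassKInfty a ∧ IsClassK a' ∧ LayerLyapunov Sys A H₁ β₀ γ₀ θ₀ ρ a a' := by
  obtain ⟨-, a, a', αβhat, ha, ha', -, hV⟩ := h ρ hρ
  refine ⟨a, a', ha, ha', fun Δ hΔ => ?_⟩
  obtain ⟨V, α, αβ, h1, h2, h3, h4, h5, -, h6⟩ := hV Δ hΔ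
  refine ⟨V, α, αβ, h1, h2, h3, h4, fun β hβ γ hγ θ hθ x hx hx₂ hxΔ f hf hle => ?_,
    fun K hK hKX => ?_⟩
  · rw [← inner_gradient_left]
    exact (h5 β hβ γ hγ θ hθ x hx hx₂ hxΔ f hf).1 hle
  · obtain ⟨M, hM, hb⟩ := h6 K hK hKX
    refine ⟨M, hM, fun x hx hx₂ f => ?_⟩
    rw [← inner_gradient_left, WithLp.prod_inner_apply]
    have h7 := real_inner_le_norm (gradient V x).fst f
    have h8 : ‖(gradient V x).fst‖ ≤ M := by linarith [hb x hx hx₂, abs_nonneg (V x)]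
    have h9 := mul_le_mul_of_nonneg_right h8 (norm_nonneg f)
    have h10 : inner ℝ (gradient V x).snd (0 : Fast m l) = 0 := inner_zero_right _
    change inner ℝ (gradient V x).fst f + inner ℝ (gradient V x).snd (0 : Fast m l) ≤ M * ‖f‖
    linarith

/-- Lyapunov functions for the reduced system with bounds `a` and `a'`. -/
def ReducedLyapunov (Sys : SPSystem n m l) (A : Set (Slow n))
    (H₁ : Slow n → Set (EuclideanSpace ℝ (Fin m))) (β₀ γ₀ θ₀ : ℝ) (a a' : ℝ → ℝ) : Prop :=
  ∀ Δ > 0, ∃ (V : Slow n → ℝ) (αγ : ℝ → ℝ), ContDiff ℝ 1 V ∧ IsClassK αγ ∧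
    (∀ x₁ ∈ Sys.X₁, a (Metric.infDist x₁ A) ≤ V x₁ ∧ V x₁ ≤ a' (Metric.infDist x₁ A)) ∧
    ∀ γ ∈ Ioc 0 γ₀, ∀ θ ∈ Ioc 0 θ₀, ∀ μ > 0, αγ γ ≤ μ → ∃ c > 0, ∀ β ∈ Icc 0 β₀,
      ∀ x₁ ∈ Sys.X₁, μ ≤ Metric.infDist x₁ A → Metric.infDist x₁ A ≤ Δ →
        (∀ f₁ ∈ Sys.Fr H₁ β γ θ x₁, fderiv ℝ V x₁ f₁ ≤ -c) ∧
        (x₁ ∈ Sys.D₁ → ∀ g₁ ∈ Sys.Gr H₁ β γ θ x₁, V g₁ - V x₁ ≤ -c)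

/-- For fixed `γ` and `θ` the rates are bounded below outside the `μ`-neighbourhood of `A` by one
positive constant, common to flow and jumps and independent of `β`. -/
theorem ReducedAssumption.exists_reducedLyapunov
    (h : Sys.ReducedAssumption A H₁ β₀ γ₀ θ₀) :
    ∃ a a', IsClassKInfty a ∧ IsClassK a' ∧ ReducedLyapunov Sys A H₁ β₀ γ₀ θ₀ a a' := by
  obtain ⟨-, a, a', αγhat, σhat, ha, ha', hαγhat, hσ, hV⟩ := h
  refine ⟨a, a', ha, ha', fun Δ hΔ => ?_⟩
  obtain ⟨V, α, αγ, h1, h2, h3, h4, h5⟩ := hV Δ hΔ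
  refine ⟨V, αγ, h1, h3, h4, fun γ hγ θ hθ μ hμ hle => ?_⟩
  have hσ' := hσ θ⁻¹ (inv_pos.2 hθ.1)
  have hγ' := hαγhat.pos hγ.1
  have hα := h2.pos hμ
  refine ⟨min (σhat θ⁻¹ * αγhat γ * α μ) (αγhat γ * α μ), by positivity,
    fun β hβ x₁ hx₁ hμx hxΔ => ?_⟩
  obtain ⟨h6, h7⟩ := h5 β hβ γ hγ θ hθ x₁ hx₁ (hle.trans hμx) hxΔ
  have h8 : α μ ≤ α (Metric.infDist x₁ A) := (h2.le_iff hμ.le (hμ.le.trans hμx)).2 hμx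
  refine ⟨fun f₁ hf₁ => ?_, fun hD g₁ hg₁ => (h7 hD g₁ hg₁).trans ?_⟩
  · rw [← inner_gradient_left]
    refine (h6 f₁ hf₁).trans (neg_le_neg ((min_le_left _ _).trans ?_))
    gcongr
  · refine neg_le_neg ((min_le_right _ _).trans ?_)
    gcongr

namespace Standing

/-- Boundedness and convergence of the arcs without short levels, for small parameters, between
given levels of the Lyapunov functions. -/
theorem eventuallySmall_arc_bound (h : Standing Sys A H₁ β₀ γ₀ θ₀) (hβ₀ : 0 < β₀) (hγ₀ : 0 < γ₀)
    (hθ₀ : 0 < θ₀) {σ : ℝ → ℝ} (hσ : ∀ τ > 0, 0 < σ τ) {ρ : ℝ} (hρ : 0 < ρ) {a₁ A₁ a₂ A₂ : ℝ → ℝ}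
    (ha₁ : IsClassKInfty a₁) (hA₁ : IsClassK A₁)
    (hred : ReducedLyapunov Sys A H₁ β₀ γ₀ θ₀ a₁ A₁)
    (ha₂ : IsClassKInfty a₂) (hA₂ : IsClassK A₂)
    (hlayer : LayerLyapunov Sys A H₁ β₀ γ₀ θ₀ ρ a₂ A₂)
    {b ν r₁ s b₂ W r₂ η₀ μ v η : ℝ} (hν : 0 < ν) (hr₁_pos : 0 < r₁) (hr₁ρ : r₁ ≤ ρ)
    (hr₁ : b + ν ≤ a₁ r₁) (hs : 0 ≤ s) (hb₂_pos : 0 < b₂) (hb₂ : A₂ s ≤ b₂) (hW : b₂ < W)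
    (hr₂_pos : 0 < r₂) (hr₂ : W ≤ a₂ r₂) (hη₀ : 0 < η₀)
    (hjump : ∀ β ∈ Icc 0 β₀, ∀ γ ∈ Icc 0 γ₀, ∀ θ ∈ Icc 0 θ₀, ∀ x ∈ Sys.D,
      Metric.infDist x.fst A ≤ r₁ → Metric.infDist x (Sys.manifold A H₁ ρ) ≤ η₀ →
      ∀ g ∈ Sys.G β γ θ x, Metric.infDist g (Sys.attractor A H₁) ≤ s)
    (hμ : 0 < μ) (hvμ : A₁ μ ≤ v) (hvb : v ≤ b)
    (hsmall : ∀ β ∈ Icc 0 β₀, ∀ γ ∈ Icc 0 γ₀, ∀ θ ∈ Icc 0 θ₀, ∀ x ∈ Sys.D,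
      Metric.infDist x.fst A ≤ μ → Metric.infDist x (Sys.manifold A H₁ ρ) ≤ η₀ →
      ∀ g ∈ Sys.G β γ θ x, A₁ (Metric.infDist g.fst A) ≤ v)
    (hη : 0 < η) :
    EventuallySmall fun γ θ ε β => ∃ c > 0, ∃ κ > 0, κ ≤ 1 ∧ κ ≤ σ θ⁻¹ ∧
      ∀ J t φ, IsArc (Sys.full β γ θ ε) J t φ → shortLevels J t (σ θ⁻¹) = ∅ →
      A₁ (Metric.infDist (φ (t 0) 0).fst A) ≤ b →
      Metric.infDist (φ (t 0) 0) (Sys.manifold A H₁ ρ) ≤ s →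
      Metric.infDist (φ (t (J + 1)) J).fst A ≤ r₁ ∧
      Metric.infDist (φ (t (J + 1)) J) (Sys.manifold A H₁ ρ) ≤ r₂ ∧
      a₁ (Metric.infDist (φ (t (J + 1)) J).fst A) ≤ max (b - c * (t (J + 1) - t 0)) v + ν ∧
      (t J + κ ≤ t (J + 1) → Metric.infDist (φ (t (J + 1)) J) (Sys.manifold A H₁ ρ) ≤ η) := by
  obtain ⟨V₁, αγ, hV₁, hαγ, hV₁b, hV₁d⟩ := hred r₁ hr₁_pos
  obtain ⟨V₂, α₂, αβ, hV₂, hα₂, hαβ, hV₂b, hV₂d, hV₂g⟩ := hlayer r₂ hr₂_pos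
  obtain ⟨γs, hγs, hγs'⟩ := hαγ.exists_le hμ
  unfold EventuallySmall
  filter_upwards [Ioc_mem_nhdsGT (lt_min hγ₀ hγs)] with γ hγm
  have hγ : γ ∈ Ioc 0 γ₀ := ⟨hγm.1, hγm.2.trans (min_le_left _ _)⟩
  filter_upwards [Ioc_mem_nhdsGT hθ₀] with θ hθ
  have hγ' := Ioc_subset_Icc_self hγ
  have hθ' := Ioc_subset_Icc_self hθ
  obtain ⟨c', hc', hdec⟩ := hV₁d γ hγ θ hθ μ hμ (hγs' γ hγ.1.le (hγm.2.trans (min_le_right _ _)))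
  obtain ⟨η₁, hη₁, hflow⟩ := h.exists_flow_decrease hγ hθ hρ.le hc' hV₁
    fun β hβ x₁ hx₁ h1 h2 => (hdec β hβ x₁ hx₁ h1 h2).1
  obtain ⟨η₂, hη₂, hjmp⟩ := h.exists_jump_decrease hγ hθ hρ.le hc' hV₁.continuous
    fun β hβ x₁ hx₁ h1 h2 => (hdec β hβ x₁ hx₁ h1 h2).2
  -- One distance to the manifold suits all purposes: the target `η`, the jump bounds `η₀`, and the
  -- decrease along flow `η₁` and jumps `η₂`.
  have hη' : 0 < min (min η η₀) (min η₁ η₂) := by positivity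
  have hℓ₂ : 0 < min (a₂ (min (min η η₀) (min η₁ η₂))) b₂ := lt_min (ha₂.toIsClassK.pos hη') hb₂_pos
  -- While `V₂` is above its target level, the distance to the manifold is at least `ζ`, which gives
  -- the fast rate `α₂ ζ`.
  obtain ⟨ζ, hζ, hζ'⟩ := hA₂.exists_le hℓ₂
  obtain ⟨L, hL, hLb⟩ := h.exists_slow_bound hγ hθ hρ.le r₂
  obtain ⟨M, hM, hMb⟩ := hV₂g
    ({p | Metric.infDist p (equilibriumGraph H₁ (Sys.tube A ρ)) ≤ r₂} ∩ (Sys.tube A ρ ×ˢ Sys.X₂'))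
    ((h.isCompact_near_graph hρ.le r₂).inter_right
      ((h.isCompact_tube ρ).isClosed.prod h.isClosed_X₂')) inter_subset_right
  obtain ⟨M₁, hM₁⟩ := (h.isCompact_tube ρ).exists_bound_of_continuousOn
    (hV₁.continuous_fderiv (by simp)).continuousOn
  obtain ⟨L₁, hL₁, hL₁b⟩ : ∃ L₁ ≥ 0, ∀ x₁ ∈ Sys.tube A ρ, ∀ f : Slow n, ‖f‖ ≤ L →
      fderiv ℝ V₁ x₁ f ≤ L₁ := by
    refine ⟨|M₁| * L, by positivity, fun x₁ hx₁ f hf => (le_abs_self _).trans ?_⟩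
    refine ((fderiv ℝ V₁ x₁).le_opNorm f).trans ?_
    exact mul_le_mul ((hM₁ x₁ hx₁).trans (le_abs_self _)) hf (norm_nonneg _) (abs_nonneg _)
  have hστ := hσ θ⁻¹ (inv_pos.2 hθ.1)
  -- The transient must fit before a regular jump and cost less than both the jump decrease `c' / 2`
  -- and the tolerance `ν`.
  obtain ⟨κ, hκ, hκ1, hκσ, hκ2⟩ : ∃ κ > 0, κ ≤ 1 ∧ κ ≤ σ θ⁻¹ ∧
      (c' / 2 + L₁) * κ < min (c' / 2) ν := by
    have hmin : 0 < min (c' / 2) ν := by positivity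
    refine ⟨min (min 1 (σ θ⁻¹)) (min (c' / 2) ν / (c' / 2 + L₁ + 1)), by positivity,
      (min_le_left _ _).trans (min_le_left _ _), (min_le_left _ _).trans (min_le_right _ _), ?_⟩
    have h1 := min_le_right (min 1 (σ θ⁻¹)) (min (c' / 2) ν / (c' / 2 + L₁ + 1))
    rw [le_div_iff₀ (by positivity)] at h1
    have h2 : 0 < min (min 1 (σ θ⁻¹)) (min (c' / 2) ν / (c' / 2 + L₁ + 1)) := by positivity
    nlinarith
  have hα₂ζ := hα₂.pos hζ
  have hden : 0 < M * L + b₂ / κ := by positivity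
  -- For such `ε`, the fast decrease beats the drift `M * L` of `V₂` caused by `x₁` with a margin
  -- `b₂ / κ`, enough to bring `V₂` down from `b₂` within time `κ`.
  filter_upwards [Ioc_mem_nhdsGT (show 0 < α₂ ζ / (M * L + b₂ / κ) by positivity)] with ε hε
  obtain ⟨βs, hβs, hβs'⟩ := hαβ.exists_le hζ
  filter_upwards [Ioc_mem_nhdsGT (lt_min hβ₀ hβs)] with β hβm
  have hβ : β ∈ Ioc 0 β₀ := ⟨hβm.1, hβm.2.trans (min_le_left _ _)⟩
  have hβ' := Ioc_subset_Icc_self hβ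
  have hεfast : M * L - ε⁻¹ * α₂ ζ ≤ -(b₂ / κ) := by
    have h1 := hε.2
    rw [le_div_iff₀ hden] at h1
    have h2 : ε⁻¹ * (ε * (M * L + b₂ / κ)) ≤ ε⁻¹ * α₂ ζ :=
      mul_le_mul_of_nonneg_left h1 (inv_pos.2 hε.1).le
    rw [inv_mul_cancel_left₀ hε.1.ne'] at h2
    linarith
  refine ⟨c' / 2, half_pos hc', κ, hκ, hκ1, hκσ, fun J t φ harc hreg hstart₁ hstart₂ => ?_⟩
  have hC : ∀ x ∈ closure (Sys.full β γ θ ε).flowSet ∪ (Sys.full β γ θ ε).jumpSet, x ∈ Sys.C := by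
    intro x hx
    rcases hx with hx | hx
    · exact h.basic.isClosed_flowSet.closure_eq ▸ hx
    · exact h.D_subset_C hx
  have hd₁ : ∀ x ∈ Sys.C, V₁ x.fst ≤ b + ν → Metric.infDist x.fst A ≤ r₁ := fun x hx hle =>
    (ha₁.toIsClassK.le_iff Metric.infDist_nonneg hr₁_pos.le).1
      ((hV₁b _ hx.1).1.trans (hle.trans hr₁))
  have hd₂ : ∀ x ∈ Sys.C, Metric.infDist x.fst A ≤ r₁ → V₂ x ≤ W →
      Metric.infDist x (Sys.manifold A H₁ ρ) ≤ r₂ := fun x hx hx₁ hle =>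
    (ha₂.toIsClassK.le_iff Metric.infDist_nonneg hr₂_pos.le).1
      ((hV₂b x ⟨hx.1, hx₁.trans hr₁ρ⟩ hx.2).1.trans (hle.trans hr₂))
  have hdη : ∀ x ∈ Sys.C, Metric.infDist x.fst A ≤ r₁ →
      V₂ x ≤ min (a₂ (min (min η η₀) (min η₁ η₂))) b₂ →
      Metric.infDist x (Sys.manifold A H₁ ρ) ≤ min (min η η₀) (min η₁ η₂) := fun x hx hx₁ hle =>
    (ha₂.toIsClassK.le_iff Metric.infDist_nonneg hη'.le).1
      ((hV₂b x ⟨hx.1, hx₁.trans hr₁ρ⟩ hx.2).1.trans (hle.trans (min_le_left _ _)))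
  have hμlt : ∀ x ∈ Sys.C, A₁ μ < V₁ x.fst → μ ≤ Metric.infDist x.fst A := by
    intro x hx hlt
    by_contra! hle
    have := (hA₁.le_iff Metric.infDist_nonneg hμ.le).2 hle.le
    linarith [(hV₁b _ hx.1).2]
  have hx₀ : φ (t 0) 0 ∈ Sys.C := hC _ (harc.mem 0 (Nat.zero_le _) _ ⟨le_rfl, harc.le 0 (Nat.zero_le _)⟩)
  have hV₁0 : V₁ (φ (t 0) 0).fst ≤ b := (hV₁b _ hx₀.1).2.trans hstart₁
  have hV₂0 : V₂ (φ (t 0) 0) ≤ b₂ :=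
    (hV₂b _ ⟨hx₀.1, (hd₁ _ hx₀ (by linarith)).trans hr₁ρ⟩ hx₀.2).2.trans
      (((hA₂.le_iff Metric.infDist_nonneg hs).2 hstart₂).trans hb₂)
  obtain ⟨h1, h2, h3⟩ := harc.two_scale_bound (contDiff_comp_fst hV₁) hV₂ (b := b) (ν := ν) (b₂ := b₂) (W := W)
    (ℓ₁ := A₁ μ) (ℓ₂ := min (a₂ (min (min η η₀) (min η₁ η₂))) b₂) (L := L₁) (c := c' / 2)
    (c₂ := b₂ / κ) (cJ := c' / 2) (κ := κ) (v := v) hL₁ (half_pos hc').le (by positivity) hκ.le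
    (by
      have := hκ2.trans_le (min_le_right _ _)
      have h0 : 0 ≤ c' / 2 * κ := by positivity
      linarith)
    (hκ2.le.trans (min_le_right _ _)) (hκ2.le.trans (min_le_left _ _)) hκσ hvμ hvb
    (min_le_right _ _) hW (by rw [div_mul_cancel₀ _ hκ.ne']; linarith)
    (by
      rintro x hx h1 h2 w ⟨f, hf, rfl⟩
      have hxC := hC x hx
      have h3 := hd₁ x hxC h1
      have h4 := hd₂ x hxC h3 h2
      have hxt : x.fst ∈ Sys.tube A ρ := ⟨hxC.1, h3.trans hr₁ρ⟩
      have hfL := hLb β hβ' x hxC h4 f hf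
      rw [fderiv_comp_fst (hV₁.differentiable (by simp))]
      refine ⟨hL₁b _ hxt _ hfL, fun h5 => ?_, fun h5 h6 => ?_⟩
      · have h6 : ζ ≤ Metric.infDist x (Sys.manifold A H₁ ρ) := by
          by_contra! hlt
          have := (hV₂b x hxt hxC.2).2.trans (hζ' _ Metric.infDist_nonneg hlt.le)
          linarith
        have h7 := hV₂d β hβ γ hγ θ hθ x hxt hxC.2 h4 f hf
          ((hβs' β hβ.1.le (hβm.2.trans (min_le_right _ _))).trans h6)
        have h8 := (hα₂.le_iff hζ.le Metric.infDist_nonneg).2 h6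
        have h9 := hMb x ⟨(h.infDist_graph_le_manifold hρ.le x).trans h4, hxt, hxC.2.1⟩ hxC.2.2
          f.fst
        have h10 : M * ‖f.fst‖ ≤ M * L := mul_le_mul_of_nonneg_left hfL hM.le
        have h11 : (WithLp.toLp 2 (f.fst, ε⁻¹ • f.snd) : State n m l) =
            WithLp.toLp 2 (f.fst, 0) + ε⁻¹ • WithLp.toLp 2 (0, f.snd) := by
          rw [← WithLp.toLp_smul, ← WithLp.toLp_add]
          simp
        rw [h11, map_add, map_smul, smul_eq_mul]
        have h12 := mul_le_mul_of_nonneg_left (h7.trans (neg_le_neg h8)) (inv_pos.2 hε.1).le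
        linarith
      · exact hflow β hβ' x hxC (hμlt x hxC h6) h3 ((hdη x hxC h3 h5).trans
          ((min_le_right _ _).trans (min_le_left _ _))) f hf)
    (by
      intro x hx h1 h2 g hg
      have hxC := h.D_subset_C hx
      have h3 := hd₁ x hxC h1
      have h4 := hdη x hxC h3 h2
      have h5 : Metric.infDist x (Sys.manifold A H₁ ρ) ≤ η₀ :=
        h4.trans ((min_le_left _ _).trans (min_le_right _ _))
      have hgC := ((h.basic.jumpMap β hβ' γ hγ' θ hθ').2.2 x hx).2 hg
      have h6 : V₁ g.fst ≤ max (V₁ x.fst - c' / 2) v := by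
        -- Away from `A` the reduced decrease persists; near `A` the jump lands below the level `v`.
        rcases le_total μ (Metric.infDist x.fst A) with hle | hle
        · have := hjmp β hβ' x hx hle h3
            (h4.trans ((min_le_right _ _).trans (min_le_right _ _))) g hg
          exact le_max_of_le_left (by linarith)
        · exact le_max_of_le_right ((hV₁b _ hgC.1).2.trans
            (hsmall β hβ' γ hγ' θ hθ' x hx hle h5 g hg))
      refine ⟨?_, h6⟩
      -- The bounds on `V₂` hold only over the tube, so `V₁` must first place `g` there.
      have h7 : V₁ g.fst ≤ b + ν := h6.trans (max_le (by linarith) (by linarith))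
      have h8 := (h.infDist_manifold_le hρ.le g).trans (hjump β hβ' γ hγ' θ hθ' x hx h3 h5 g hg)
      exact (hV₂b g ⟨hgC.1, (hd₁ g hgC h7).trans hr₁ρ⟩ hgC.2).2.trans
        (((hA₂.le_iff Metric.infDist_nonneg hs).2 h8).trans hb₂))
    hreg hV₁0 hV₂0
  have hx₁ : φ (t (J + 1)) J ∈ Sys.C := hC _ (harc.mem J le_rfl _ ⟨harc.le J le_rfl, le_rfl⟩)
  have h4 : max (b - c' / 2 * (t (J + 1) - t 0)) v ≤ b :=
    max_le (by
      have := mul_nonneg (half_pos hc').le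
        (sub_nonneg.2 (harc.monotone (Nat.zero_le (J + 1)) le_rfl))
      linarith) hvb
  have h5 := hd₁ _ hx₁ (h3.trans (by linarith))
  exact ⟨h5, hd₂ _ hx₁ h5 (h1.trans hW.le), (hV₁b _ hx₁.1).1.trans h3, fun hle =>
    (hdη _ hx₁ h5 (h2 hle)).trans ((min_le_left _ _).trans (min_le_left _ _))⟩

end Standing

end SPSystem

/-! ### Induction on the number of short levels -/

namespace SPSystem

variable {n m l : ℕ} {Sys : SPSystem n m l} {A : Set (Slow n)}
  {H₁ : Slow n → Set (EuclideanSpace ℝ (Fin m))} {β₀ γ₀ θ₀ : ℝ}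

namespace Standing

/-- Jumps from states close to the manifold and to `A` lead to states close to the attractor. -/
theorem exists_jump_near_manifold (h : Standing Sys A H₁ β₀ γ₀ θ₀) {ρ ν : ℝ} (hρ : 0 ≤ ρ)
    (hν : 0 < ν) : ∃ η > 0, ∀ β ∈ Icc 0 β₀, ∀ γ ∈ Icc 0 γ₀, ∀ θ ∈ Icc 0 θ₀, ∀ x ∈ Sys.D,
      Metric.infDist x.fst A ≤ η → Metric.infDist x (Sys.manifold A H₁ ρ) ≤ η →
      ∀ g ∈ Sys.G β γ θ x, Metric.infDist g (Sys.attractor A H₁) ≤ ν := by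
  obtain ⟨ζ, hζ, hjump⟩ := h.exists_jump_near hν
  obtain ⟨η, hη, hnear⟩ := h.exists_infDist_attractor_le hρ hζ
  exact ⟨η, hη, fun β hβ γ hγ θ hθ x hx h1 h2 =>
    hjump β hβ γ hγ θ hθ x hx (hnear x (h.D_subset_C hx) h1 h2)⟩

/-- Arcs without short levels that start close to the attractor remain close to it. -/
theorem exists_regular_arc_near (h : Standing Sys A H₁ β₀ γ₀ θ₀) (hβ₀ : 0 < β₀) (hγ₀ : 0 < γ₀)
    (hθ₀ : 0 < θ₀) (hlayer : Sys.BoundaryLayerAssumption A H₁ β₀ γ₀ θ₀)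
    (hreduced : Sys.ReducedAssumption A H₁ β₀ γ₀ θ₀) {σ : ℝ → ℝ} (hσ : ∀ τ > 0, 0 < σ τ)
    {δ : ℝ} (hδ : 0 < δ) :
    ∃ r > 0, EventuallySmall fun γ θ ε β => ∀ J t φ, IsArc (Sys.full β γ θ ε) J t φ →
      shortLevels J t (σ θ⁻¹) = ∅ → Metric.infDist (φ (t 0) 0) (Sys.attractor A H₁) ≤ r →
      Metric.infDist (φ (t (J + 1)) J) (Sys.attractor A H₁) ≤ δ := by
  obtain ⟨a₁, A₁, ha₁, hA₁, hred⟩ := hreduced.exists_reducedLyapunov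
  obtain ⟨a₂, A₂, ha₂, hA₂, hlay⟩ := hlayer.exists_layerLyapunov one_pos
  obtain ⟨r₂, hr₂, hfin⟩ := h.exists_infDist_attractor_le zero_le_one hδ
  have hW := ha₂.toIsClassK.pos hr₂
  obtain ⟨s, hs, hsb⟩ := hA₂.exists_le (half_pos hW)
  obtain ⟨η₁, hη₁, hj₁⟩ := h.exists_jump_near_manifold zero_le_one hs
  have hr₁ : 0 < min (min r₂ η₁) 1 := by positivity
  have hb := ha₁.toIsClassK.pos hr₁
  obtain ⟨s', hs', hsb'⟩ := hA₁.exists_le (half_pos hb)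
  obtain ⟨η₂, hη₂, hj₂⟩ := h.exists_jump_near_manifold zero_le_one hs'
  -- All radii are chosen backwards from `δ` and before the parameters. Only boundedness is needed
  -- here, so `b`, `ν` and `v` are all half the level of the final radius.
  have key := h.eventuallySmall_arc_bound hβ₀ hγ₀ hθ₀ hσ one_pos ha₁ hA₁ hred ha₂ hA₂ hlay
    (b := a₁ (min (min r₂ η₁) 1) / 2) (ν := a₁ (min (min r₂ η₁) 1) / 2)
    (v := a₁ (min (min r₂ η₁) 1) / 2) (μ := min s' η₂) (η₀ := min η₁ η₂) (W := a₂ r₂) (η := 1)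
    (half_pos hb) hr₁ (min_le_right _ _) (by linarith) hs.le (half_pos hW) (hsb s hs.le le_rfl)
    (half_lt_self hW) hr₂ le_rfl (lt_min hη₁ hη₂)
    (fun β hβ γ hγ θ hθ x hx h1 h2 => hj₁ β hβ γ hγ θ hθ x hx
      (h1.trans ((min_le_left _ _).trans (min_le_right _ _))) (h2.trans (min_le_left _ _)))
    (lt_min hs' hη₂) (hsb' _ (lt_min hs' hη₂).le (min_le_left _ _)) le_rfl
    (fun β hβ γ hγ θ hθ x hx h1 h2 g hg => hsb' _ Metric.infDist_nonneg
      ((h.infDist_fst_le g).trans (hj₂ β hβ γ hγ θ hθ x hx (h1.trans (min_le_right _ _))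
        (h2.trans (min_le_right _ _)) g hg))) one_pos
  refine ⟨min s s', lt_min hs hs', (key.and (eventuallySmall_mem_Ioc hβ₀ hγ₀ hθ₀)).mono ?_⟩
  rintro γ θ ε β ⟨⟨c, -, κ, -, -, -, harc⟩, hγ, hθ, hε, hβ⟩ J t φ hφ hreg hstart
  obtain ⟨h1, h2, -, -⟩ := harc J t φ hφ hreg
    (hsb' _ Metric.infDist_nonneg ((h.infDist_fst_le _).trans (hstart.trans (min_le_right _ _))))
    ((h.infDist_manifold_le zero_le_one _).trans (hstart.trans (min_le_left _ _)))
  refine hfin _ ?_ (h1.trans ((min_le_left _ _).trans (min_le_left _ _))) h2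
  rcases hφ.mem J le_rfl _ ⟨hφ.le J le_rfl, le_rfl⟩ with hx | hx
  · exact h.basic.isClosed_flowSet.closure_eq ▸ hx
  · exact h.D_subset_C hx

/-- Arcs without short levels that start in a bounded set are bounded, uniformly in the parameters,
and come close to the attractor. -/
theorem exists_regular_arc_bound (h : Standing Sys A H₁ β₀ γ₀ θ₀) (hβ₀ : 0 < β₀) (hγ₀ : 0 < γ₀)
    (hθ₀ : 0 < θ₀) (hlayer : Sys.BoundaryLayerAssumption A H₁ β₀ γ₀ θ₀)
    (hreduced : Sys.ReducedAssumption A H₁ β₀ γ₀ θ₀) {σ : ℝ → ℝ} (hσ : ∀ τ > 0, 0 < σ τ)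
    {R r : ℝ} (hR : 0 < R) (hr : 0 < r) :
    ∃ R', EventuallySmall fun γ θ ε β => ∃ T ≥ 0, ∀ J t φ, IsArc (Sys.full β γ θ ε) J t φ →
      shortLevels J t (σ θ⁻¹) = ∅ → Metric.infDist (φ (t 0) 0) (Sys.attractor A H₁) ≤ R →
      Metric.infDist (φ (t (J + 1)) J) (Sys.attractor A H₁) ≤ R' ∧
      (t 0 + T ≤ t (J + 1) → ∃ i ≤ J, ∃ s ∈ Icc (t i) (t (i + 1)),
        Metric.infDist (φ s i) (Sys.attractor A H₁) ≤ r) := by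
  obtain ⟨a₁, A₁, ha₁, hA₁, hred⟩ := hreduced.exists_reducedLyapunov
  have hb : 0 < A₁ R + 1 := by linarith [hA₁.pos hR]
  obtain ⟨r₁, hr₁_pos, hr₁⟩ := ha₁.exists_ge (A₁ R + 1 + 1)
  obtain ⟨a₂, A₂, ha₂, hA₂, hlay⟩ := hlayer.exists_layerLyapunov hr₁_pos
  obtain ⟨R₁, hR₁⟩ := h.exists_infDist_attractor_le_of_manifold hr₁_pos.le 1
  obtain ⟨R₂, hR₂⟩ := h.exists_jump_bound R₁
  -- `max R R₂` covers both the start of the arc and the states after jumps from within distance `1`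
  -- of the manifold.
  have hs : 0 ≤ max R R₂ := hR.le.trans (le_max_left _ _)
  obtain ⟨r₂, hr₂_pos, hr₂⟩ := ha₂.exists_ge (A₂ (max R R₂) + 1 + 1)
  obtain ⟨R', hR'⟩ := h.exists_infDist_attractor_le_of_manifold hr₁_pos.le r₂
  obtain ⟨η, hη, hfin⟩ := h.exists_infDist_attractor_le hr₁_pos.le hr
  have haη := ha₁.toIsClassK.pos hη
  have hv : 0 < min (a₁ η / 2) (A₁ R + 1) := lt_min (half_pos haη) hb
  obtain ⟨s', hs', hsb'⟩ := hA₁.exists_le hv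
  obtain ⟨η₂, hη₂, hj₂⟩ := h.exists_jump_near_manifold hr₁_pos.le hs'
  have key := h.eventuallySmall_arc_bound hβ₀ hγ₀ hθ₀ hσ hr₁_pos ha₁ hA₁ hred ha₂ hA₂ hlay
    (b := A₁ R + 1) (ν := min (a₁ η / 2) 1) (v := min (a₁ η / 2) (A₁ R + 1)) (μ := min s' η₂)
    (η₀ := min 1 η₂) (b₂ := A₂ (max R R₂) + 1) (W := A₂ (max R R₂) + 1 + 1) (η := η)
    (lt_min (half_pos haη) one_pos) hr₁_pos le_rfl
    (by linarith [min_le_right (a₁ η / 2) 1]) hs (by linarith [hA₂.nonneg hs]) (by linarith)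
    (by linarith) hr₂_pos hr₂ (lt_min one_pos hη₂)
    (fun β hβ γ hγ θ hθ x hx _ h2 g hg => (hR₂ β hβ γ hγ θ hθ x hx
      (hR₁ x (h.D_subset_C hx) (h2.trans (min_le_left _ _))) g hg).trans (le_max_right _ _))
    (lt_min hs' hη₂) (hsb' _ (lt_min hs' hη₂).le (min_le_left _ _)) (min_le_right _ _)
    (fun β hβ γ hγ θ hθ x hx h1 h2 g hg => hsb' _ Metric.infDist_nonneg
      ((h.infDist_fst_le g).trans (hj₂ β hβ γ hγ θ hθ x hx (h1.trans (min_le_right _ _))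
        (h2.trans (min_le_right _ _)) g hg))) hη
  refine ⟨R', key.mono ?_⟩
  rintro γ θ ε β ⟨c, hc, κ, hκ, hκ1, hκσ, harc⟩
  -- The quotient is the time in which the rate `c` exhausts the level `A₁ R + 1`; the summand `1 ≥
  -- κ` allows for an unfinished transient on the last level.
  refine ⟨1 + (A₁ R + 1) / c, by positivity, fun J t φ hφ hreg hstart => ?_⟩
  have hC : ∀ j ≤ J, φ (t (j + 1)) j ∈ Sys.C := by
    intro j hj
    rcases hφ.mem j hj _ ⟨hφ.le j hj, le_rfl⟩ with hx | hx
    · exact h.basic.isClosed_flowSet.closure_eq ▸ hx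
    · exact h.D_subset_C hx
  -- Applied to initial parts, the estimate is available at the end of every level.
  have hall : ∀ j ≤ J, _ := fun j hj => harc j t φ (hφ.take hj)
    (Finset.subset_empty.1 (hreg ▸ shortLevels_mono hj t (σ θ⁻¹)))
    (((hA₁.le_iff Metric.infDist_nonneg hR.le).2 ((h.infDist_fst_le _).trans hstart)).trans
      (by linarith))
    ((h.infDist_manifold_le hr₁_pos.le _).trans (hstart.trans (le_max_left _ _)))
  have hreach : ∀ j ≤ J, t j + κ ≤ t (j + 1) → t 0 + (A₁ R + 1) / c ≤ t (j + 1) →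
      Metric.infDist (φ (t (j + 1)) j) (Sys.attractor A H₁) ≤ r := by
    intro j hj hjκ hlate
    obtain ⟨-, -, h3, h4⟩ := hall j hj
    refine hfin _ (hC j hj) ?_ (h4 hjκ)
    refine (ha₁.toIsClassK.le_iff Metric.infDist_nonneg hη.le).1 (h3.trans ?_)
    have h5 : A₁ R + 1 - c * (t (j + 1) - t 0) ≤ 0 := by
      have : c * ((A₁ R + 1) / c) ≤ c * (t (j + 1) - t 0) :=
        mul_le_mul_of_nonneg_left (by linarith) hc.le
      rw [mul_div_cancel₀ _ hc.ne'] at this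
      linarith
    rw [max_eq_right (h5.trans hv.le)]
    linarith [min_le_left (a₁ η / 2) (A₁ R + 1), min_le_left (a₁ η / 2) 1]
  refine ⟨hR' _ (hC J le_rfl) (hall J le_rfl).2.1, fun hT => ?_⟩
  by_cases hJκ : t J + κ ≤ t (J + 1)
  · exact ⟨J, le_rfl, t (J + 1), ⟨hφ.le J le_rfl, le_rfl⟩, hreach J le_rfl hJκ (by linarith)⟩
  -- If the arc ends within a transient, the end of the preceding level serves instead: that level
  -- is regular, and less than `κ ≤ 1` of time is lost.
  · have hpos : 0 < (A₁ R + 1) / c := by positivity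
    cases J with
    | zero => exact absurd hT (by push Not at hJκ ⊢; linarith)
    | succ J =>
      have hJ := Nat.le_succ J
      have hlong : σ θ⁻¹ ≤ t (J + 1) - t J := by
        by_contra! hlt
        have : J ∈ shortLevels (J + 1) t (σ θ⁻¹) := mem_shortLevels.2 ⟨by omega, hlt⟩
        simp [hreg] at this
      push Not at hJκ
      exact ⟨J, hJ, t (J + 1), ⟨hφ.le J hJ, le_rfl⟩, hreach J hJ (by linarith) (by linarith)⟩

/-- Arcs with at most `k` short levels that start close to the attractor remain close to it. -/
theorem exists_arc_near (h : Standing Sys A H₁ β₀ γ₀ θ₀) (hβ₀ : 0 < β₀) (hγ₀ : 0 < γ₀)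
    (hθ₀ : 0 < θ₀) (hlayer : Sys.BoundaryLayerAssumption A H₁ β₀ γ₀ θ₀)
    (hreduced : Sys.ReducedAssumption A H₁ β₀ γ₀ θ₀) {σ : ℝ → ℝ} (hσ : ∀ τ > 0, 0 < σ τ) (k : ℕ) :
    ∀ δ > 0, ∃ r > 0, EventuallySmall fun γ θ ε β => ∀ J t φ, IsArc (Sys.full β γ θ ε) J t φ →
      (shortLevels J t (σ θ⁻¹)).card ≤ k →
      Metric.infDist (φ (t 0) 0) (Sys.attractor A H₁) ≤ r →
      Metric.infDist (φ (t (J + 1)) J) (Sys.attractor A H₁) ≤ δ := by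
  induction k with
  | zero =>
    intro δ hδ
    obtain ⟨r, hr, hsmall⟩ := h.exists_regular_arc_near hβ₀ hγ₀ hθ₀ hlayer hreduced hσ hδ
    exact ⟨r, hr, hsmall.mono fun γ θ ε β harc J t φ hφ hcard =>
      harc J t φ hφ (Finset.card_eq_zero.1 (Nat.le_zero.1 hcard))⟩
  | succ k ih =>
    intro δ hδ
    -- Radii are chosen backwards: `r'` for the part after the first short level, `δ'` so that the
    -- jump lands within `r'`, and `r` for the regular part before it.
    obtain ⟨r', hr', htail⟩ := ih δ hδ
    obtain ⟨δ', hδ', hjump⟩ := h.exists_jump_near hr'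
    obtain ⟨r, hr, hhead⟩ := h.exists_regular_arc_near hβ₀ hγ₀ hθ₀ hlayer hreduced hσ
      (lt_min hδ hδ')
    refine ⟨r, hr, ((htail.and hhead).and (eventuallySmall_mem_Ioc hβ₀ hγ₀ hθ₀)).mono ?_⟩
    rintro γ θ ε β ⟨⟨htail, hhead⟩, hγ, hθ, hε, hβ⟩ J t φ hφ hcard hstart
    by_cases hreg : shortLevels J t (σ θ⁻¹) = ∅
    · exact (hhead J t φ hφ hreg hstart).trans (min_le_left _ _)
    · obtain ⟨j, hj, hj0, -, hjcard⟩ := exists_first_shortLevel hreg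
      have hjJ := (mem_shortLevels.1 hj).1
      have h1 := hhead j t φ (hφ.take hjJ.le) hj0 hstart
      obtain ⟨h2, h3⟩ := hφ.jump j hjJ
      have h4 := hjump β (Ioc_subset_Icc_self hβ) γ (Ioc_subset_Icc_self hγ) θ
        (Ioc_subset_Icc_self hθ) _ h2 (h1.trans (min_le_right _ _)) _ h3
      have h5 := htail _ _ _ (hφ.tail (k := j + 1) hjJ) (by omega) (by simpa [add_comm] using h4)
      have e1 : J - (j + 1) + 1 + (j + 1) = J + 1 := by omega
      have e2 : J - (j + 1) + (j + 1) = J := by omega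
      simpa only [e1, e2] using h5

/-- Arcs with at most `k` short levels that start in a bounded set come close to the attractor
within a given time after the last short level. -/
theorem exists_arc_reach (h : Standing Sys A H₁ β₀ γ₀ θ₀) (hβ₀ : 0 < β₀) (hγ₀ : 0 < γ₀)
    (hθ₀ : 0 < θ₀) (hlayer : Sys.BoundaryLayerAssumption A H₁ β₀ γ₀ θ₀)
    (hreduced : Sys.ReducedAssumption A H₁ β₀ γ₀ θ₀) {σ : ℝ → ℝ} (hσ : ∀ τ > 0, 0 < σ τ)
    {r : ℝ} (hr : 0 < r) (k : ℕ) :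
    ∀ R > 0, EventuallySmall fun γ θ ε β => ∃ T ≥ 0, ∀ J t φ, IsArc (Sys.full β γ θ ε) J t φ →
      (shortLevels J t (σ θ⁻¹)).card ≤ k →
      Metric.infDist (φ (t 0) 0) (Sys.attractor A H₁) ≤ R → ∀ T', t 0 ≤ T' →
      (∀ j ∈ shortLevels J t (σ θ⁻¹), t (j + 1) ≤ T') → T' + T ≤ t (J + 1) →
      ∃ i ≤ J, ∃ s ∈ Icc (t i) (t (i + 1)),
        Metric.infDist (φ s i) (Sys.attractor A H₁) ≤ r := by
  induction k with
  | zero =>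
    intro R hR
    obtain ⟨R', hsmall⟩ := h.exists_regular_arc_bound hβ₀ hγ₀ hθ₀ hlayer hreduced hσ hR hr
    refine hsmall.mono fun γ θ ε β => ?_
    rintro ⟨T, hT, harc⟩
    exact ⟨T, hT, fun J t φ hφ hcard hstart T' hT' _ hlate =>
      (harc J t φ hφ (Finset.card_eq_zero.1 (Nat.le_zero.1 hcard)) hstart).2 (by linarith)⟩
  | succ k ih =>
    intro R hR
    obtain ⟨R', hhead⟩ := h.exists_regular_arc_bound hβ₀ hγ₀ hθ₀ hlayer hreduced hσ hR hr
    obtain ⟨R'', hjump⟩ := h.exists_jump_bound R'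
    -- `R''` does not depend on the parameters, so the induction hypothesis applies before they are
    -- chosen; the `1` only ensures positivity.
    have htail := ih (max R'' 1) (lt_max_of_lt_right one_pos)
    refine ((htail.and hhead).and (eventuallySmall_mem_Ioc hβ₀ hγ₀ hθ₀)).mono ?_
    rintro γ θ ε β ⟨⟨⟨T₁, hT₁, htail⟩, T₂, hT₂, hhead⟩, hγ, hθ, hε, hβ⟩
    refine ⟨max T₁ T₂, hT₁.le.trans (le_max_left _ _), fun J t φ hφ hcard hstart T' hT' hshort hlate => ?_⟩
    by_cases hreg : shortLevels J t (σ θ⁻¹) = ∅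
    · exact (hhead J t φ hφ hreg hstart).2 (by linarith [le_max_right T₁ T₂])
    · obtain ⟨j, hj, hj0, hjsub, hjcard⟩ := exists_first_shortLevel hreg
      have hjJ := (mem_shortLevels.1 hj).1
      have h1 := (hhead j t φ (hφ.take hjJ.le) hj0 hstart).1
      obtain ⟨h2, h3⟩ := hφ.jump j hjJ
      have h4 := (hjump β (Ioc_subset_Icc_self hβ) γ (Ioc_subset_Icc_self hγ) θ
        (Ioc_subset_Icc_self hθ) _ h2 h1 _ h3).trans (le_max_left _ 1)
      have e1 : J - (j + 1) + 1 + (j + 1) = J + 1 := by omega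
      have e2 : ∀ i, i + 1 + (j + 1) = i + (j + 1) + 1 := fun i => by ring
      obtain ⟨i, hi, s, hs, hsr⟩ := htail _ _ _ (hφ.tail (k := j + 1) hjJ) (by omega)
        (by simpa [add_comm] using h4) T' (by simpa using hshort j hj)
        (fun i hi => by
          simp only [e2]
          exact hshort _ (hjsub i hi))
        (by simp only [e1]; linarith [le_max_left T₁ T₂])
      simp only [e2] at hs
      exact ⟨i + (j + 1), by omega, s, hs, hsr⟩

end Standing

end SPSystem

end SingPert

/-! ### Stability and attractivity of the restricted attractor -/

theorem theorem2 {n m l : ℕ} (Sys : SPSystem n m l) (A : Set (Slow n))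
    (H₁ : Slow n → Set (EuclideanSpace ℝ (Fin m))) (β₀ γ₀ θ₀ : ℝ)
    (hβ₀ : 0 < β₀) (hγ₀ : 0 < γ₀) (hθ₀ : 0 < θ₀)
    (hA : IsCompact A) (hA_nonempty : A.Nonempty) (hAX : A ⊆ Sys.X₁)
    (h_basic : Sys.BasicAssumptions β₀ γ₀ θ₀)
    (h_steady : Sys.SteadyStateAssumptions H₁ β₀ γ₀ θ₀)
    (h_layer : Sys.BoundaryLayerAssumption A H₁ β₀ γ₀ θ₀)
    (h_regular : Sys.JumpRegularityAssumption A β₀ γ₀ θ₀)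
    (h_reduced : Sys.ReducedAssumption A H₁ β₀ γ₀ θ₀)
    (h_invariant : Sys.JumpInvarianceAssumption A H₁ β₀ γ₀ θ₀) :
    -- the parameters are `p = (γ, 1/τ, ε, β)`
    SGPAS 4 (fun p : Fin 4 → ℝ => Sys.full (p 3) (p 0) (p 1) (p 2)) (Sys.attractor A H₁) := by
  have h : SPSystem.Standing Sys A H₁ β₀ γ₀ θ₀ :=
    ⟨hA, hA_nonempty, hAX, h_basic, h_steady, h_invariant⟩
  obtain ⟨σ, hσ, h_regular⟩ := h_regular
  intro δ Δ hδ hδΔ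
  have hΔ : 0 < Δ := hδ.trans hδΔ
  -- `N` depends on `Δ` only and can serve as the length of the induction; the time bound `T₀` is
  -- obtained after the parameters.
  obtain ⟨N, hN⟩ := h_regular Δ hΔ
  obtain ⟨r₀, hr₀, hnear⟩ := h.exists_arc_near hβ₀ hγ₀ hθ₀ h_layer h_reduced hσ N δ hδ
  have hr : 0 < min r₀ Δ := lt_min hr₀ hΔ
  have hreach := h.exists_arc_reach hβ₀ hγ₀ hθ₀ h_layer h_reduced hσ hr N Δ hΔ
  rw [successivelySmall_four]
  refine ((hnear.and hreach).and (eventuallySmall_mem_Ioc hβ₀ hγ₀ hθ₀)).mono ?_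
  rintro γ θ ε β ⟨⟨hnear, T₁, hT₁, hreach⟩, hγ, hθ, hε, hβ⟩
  change SemiGlobalStable δ (Sys.full β γ θ ε) _ ∧ PracticallyAttractive δ Δ (Sys.full β γ θ ε) _
  have hσθ := hσ θ⁻¹ (inv_pos.2 hθ.1)
  obtain ⟨T₀, hT₀⟩ := hN β hβ γ hγ θ hθ ε hε
  have hG : ∀ x ∈ (Sys.full β γ θ ε).jumpSet,
      (Sys.full β γ θ ε).jumpMap x ⊆ (Sys.full β γ θ ε).flowSet := fun x hx =>
    ((h_basic.jumpMap β (Ioc_subset_Icc_self hβ) γ (Ioc_subset_Icc_self hγ) θ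
      (Ioc_subset_Icc_self hθ)).2.2 x hx).2
  -- To exclude branching, finiteness is needed for solutions from arbitrary initial points, with
  -- `N` and `T` depending on the solution.
  have hirr : ∀ S φ, IsSolution (Sys.full β γ θ ε) S φ → ∃ (N : ℕ) (T : ℝ),
      (SPSystem.irregularJumps S (σ θ⁻¹)).encard ≤ N ∧
      ∀ j ∈ SPSystem.irregularJumps S (σ θ⁻¹), ∀ t, (t, j) ∈ S → t ≤ T := by
    intro S φ hφ
    obtain ⟨N, hN⟩ := h_regular (max 1 (Metric.infDist (φ 0 0)
      {x : State n m l | x.fst ∈ A ∧ x.snd ∈ Sys.X₂})) (lt_max_of_lt_left one_pos)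
    obtain ⟨T, hT⟩ := hN β hβ γ hγ θ hθ ε hε
    exact ⟨N, T, hT S φ hφ (le_max_right _ _)⟩
  have hsub : Sys.attractor A H₁ ⊆ {x : State n m l | x.fst ∈ A ∧ x.snd ∈ Sys.X₂} :=
    fun x hx => ⟨hx.1, h_steady.subset _ (hAX hx.1) hx.2⟩
  have hirrΔ : ∀ S' ψ, IsSolution (Sys.full β γ θ ε) S' ψ →
      Metric.infDist (ψ 0 0) (Sys.attractor A H₁) ≤ Δ →
      (SPSystem.irregularJumps S' (σ θ⁻¹)).encard ≤ N ∧
        ∀ j ∈ SPSystem.irregularJumps S' (σ θ⁻¹), ∀ t, (t, j) ∈ S' → t ≤ T₀ :=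
    fun S' ψ hψ hle => hT₀ S' ψ hψ
      ((Metric.infDist_le_infDist_of_subset hsub h.attractor_nonempty).trans hle)
  have hcard : ∀ (S' : Set (ℝ × ℕ)) (J : ℕ) (t : ℕ → ℝ),
      (SPSystem.irregularJumps S' (σ θ⁻¹)).encard ≤ N →
      (∀ j ∈ shortLevels J t (σ θ⁻¹), j ∈ SPSystem.irregularJumps S' (σ θ⁻¹)) →
      (shortLevels J t (σ θ⁻¹)).card ≤ N := by
    intro S' J t henc hmem
    have := (Set.encard_le_encard (s := (shortLevels J t (σ θ⁻¹) : Set ℕ)) hmem).trans henc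
    rw [Set.encard_coe_eq_coe_finsetCard] at this
    exact_mod_cast this
  have hcomplete := h_basic.complete β hβ γ hγ θ hθ ε hε
  have hstable : ∀ S φ, IsSolution (Sys.full β γ θ ε) S φ → ∀ p ∈ S, ∀ q ∈ S,
      p.1 + (p.2 : ℝ) ≤ q.1 + (q.2 : ℝ) →
      Metric.infDist (φ p.1 p.2) (Sys.attractor A H₁) ≤ min r₀ Δ →
      Metric.infDist (φ q.1 q.2) (Sys.attractor A H₁) ≤ δ := by
    intro S φ hφ p hp q hq hpq hle
    obtain ⟨S', ψ, J, t, hψ, harc, ht0, hψ0, -, -, hend, -, hshort⟩ :=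
      hφ.exists_arc hG hcomplete hσθ hirr hp hq hpq
    obtain ⟨h1, -⟩ := hirrΔ S' ψ hψ (hψ0 ▸ hle.trans (min_le_right _ _))
    rw [← hend]
    exact hnear J t ψ harc (hcard S' J t h1 hshort)
      (by rw [ht0, hψ0]; exact hle.trans (min_le_left _ _))
  refine ⟨fun R hR => ⟨min r₀ Δ, hr, fun S φ hφ p hp q hq hpq hle =>
    (hstable S φ hφ p hp q hq hpq hle).trans hR⟩, fun R r hRΔ hrR hδr => ?_⟩
  have hX : 0 ≤ max T₀ 0 + T₁ := add_nonneg (le_max_right _ _) hT₁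
  -- Within time `max T₀ 0 + T₁` there are at most `N` short levels and at most that time divided by
  -- `σ` regular ones. A larger increase of `t + j` therefore forces the ordinary time past this
  -- bound.
  refine ⟨max T₀ 0 + T₁ + (N + (max T₀ 0 + T₁) / σ θ⁻¹) + 1, by positivity,
    fun S φ hφ p hp q hq hpq hle => ?_⟩
  have hX' : 0 ≤ (max T₀ 0 + T₁) / σ θ⁻¹ := by positivity
  obtain ⟨S', ψ, J, t, hψ, harc, ht0, hψ0, hq1, hq2, hend, hpts, hshort⟩ :=
    hφ.exists_arc hG hcomplete hσθ hirr hp hq (by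
      have : (0 : ℝ) ≤ N := Nat.cast_nonneg N
      linarith)
  obtain ⟨h1, h2⟩ := hirrΔ S' ψ hψ (hψ0 ▸ hle.trans hRΔ)
  have hcardN := hcard S' J t h1 hshort
  have hlate : max T₀ 0 + T₁ ≤ t (J + 1) := by
    by_contra! hlt
    have h3 := harc.jumps_mul_le hσθ
    have h4 : ((shortLevels J t (σ θ⁻¹)).card : ℝ) ≤ N := by exact_mod_cast hcardN
    have h5 : (J : ℝ) ≤ N + (max T₀ 0 + T₁) / σ θ⁻¹ := by
      rw [← sub_le_iff_le_add', le_div_iff₀ hσθ]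
      have := mul_le_mul_of_nonneg_left h4 hσθ.le
      rw [ht0] at h3
      linarith
    have h6 : (q.2 : ℝ) = J + p.2 := by rw [hq2]; push_cast; ring
    linarith
  obtain ⟨i, hi, s, hs, hsr⟩ := hreach J t ψ harc hcardN
    (by rw [ht0, hψ0]; exact hle.trans hRΔ) (max T₀ 0) (by rw [ht0]; exact le_max_right _ _)
    (fun j hj => by
      have hjJ := (mem_shortLevels.1 hj).1.le
      exact (h2 j (hshort j hj) _ (hpts j hjJ _ ⟨harc.le j hjJ, le_rfl⟩).1).trans
        (le_max_left _ _)) hlate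
  obtain ⟨-, p', hp', hpe, hpq'⟩ := hpts i hi s hs
  -- Stability is applied to the original solution from the point `p'` at which the attractor is
  -- approached.
  exact (hstable S φ hφ p' hp' q hq hpq' (hpe ▸ hsr)).trans hδr
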